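/- Let $f(x)=x+ax^{k+1}+\mathrm{h.o.t.}(x)$, $a\neq0$, $k\geq1$, be analytic near $0\in\mathbb C$, and let $\rho=\operatorname{res}_{x=0}\frac{dx}{f(x)-x}+\frac{k+1}{2}$ be its residual invariant. A *formal Fatou coordinate* of $f$ is a formal expression $\hat\psi(x)=\sum_{j\ge -k,\,j\ne0}r_jx^{j}+\rho\log x+C$ satisfying the Abel equation $\hat\psi\circ f=\hat\psi+1$. Call a domain $W\subset\mathbb C\setminus\{0\}$ on which $f$ is analytic a *sectorial domain of $f$ in the attracting direction $v$* ($|v|=1$, $-av^k>0$) if $f(W)\subset W$, $W$ contains a sector $\{0<|x|<\varepsilon,\ |\arg(x/v)|<\delta\}$, and every orbit of $f$ in $W$ tends to $0$ in the direction $v$. There is $R>0$ such that the following holds for all $0<r\le R$. Let $x_0\ne0$ be a point all of whose iterates $x_m=f^{\circ m}(x_0)$, $m\ge0$, stay in the disc $\{|x|<r\}$. 1. There are a sectorial domain $W$ of $f$ that contains the orbit $(x_m)$, a branch of $\log x$ on $W$, an analytic function $\psi_{\mathbb A}$ on $W$ (the sectorial Fatou coordinate) with $\psi_{\mathbb A}\circ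 f=\psi_{\mathbb A}+1$, $\psi_{\mathbb A}(x_0)=0$ and $\psi_{\mathbb A}(x)-\big(r_{-k}x^{-k}+\dots+r_{-1}x^{-1}+\rho\log x\big)$ bounded on $W$, and a formal Fatou coordinate $\hat\psi_{\mathbb A}$ of $f$ to which $\psi_{\mathbb A}$ is asymptotic on $W$, i.e. for every $N\ge0$, $$\psi_{\mathbb A}(x)=\sum_{-k\le j<N,\ j\neq0}r_jx^j+\rho\log x+C_N+O(x^N)\quad(x\to0,\ x\in W),$$ where $C_N=C$ for $N\ge1$ and $C_0=0$. 2. For all such $W$, $\log$, $\psi_{\mathbb A}$, $\hat\psi_{\mathbb A}$, the limit $\mu=\lim_{m\to\infty}\big(\log x_m+\tfrac1k\log m\big)$ exists, $e^{-k\mu}=-ak$, and there is exactly one power series $\Phi(z,w)=\sum_{i,j\ge0}\varphi_{ij}z^iw^j\in\mathbb C[[z,w]]$ with $\Phi(0,0)=e^{\mu}$ for which $$\hat\psi_{\mathbb A}^{\circ(-1)}(m):=m^{-1/k}\,\Phi\big(m^{-1/k},\rho\tfrac{\log m}{m}\big)\in m^{-1/k}\mathbb C[[m^{-1/k},\rho\tfrac{\log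 m}{m}]]$$ is a formal inverse of $\hat\psi_{\mathbb A}$, that is, $\hat\psi_{\mathbb A}\big(\hat\psi_{\mathbb A}^{\circ(-1)}(m)\big)=m$ formally, with $\log\hat\psi_{\mathbb A}^{\circ(-1)}(m)=-\tfrac1k\log m+\mu+\log(e^{-\mu}\Phi)$; here $z=m^{-1/k}$ and $w=\rho\frac{\log m}{m}$ are treated as independent variables. The orbit has the complete asymptotic expansion $x_m\sim\hat\psi_{\mathbb A}^{\circ(-1)}(m)$ as $m\to\infty$: for every $N\ge0$, $$x_m=\sum_{i+kj<N}\varphi_{ij}\,m^{-\frac{1+i}{k}}\Big(\rho\frac{\log m}{m}\Big)^j+O\Big(m^{-\frac{N+1}{k}}(\log m)^{\lfloor N/k\rfloor}\Big).$$ 3. In particular $k$ and $a$ can be read off the orbit (with the principal logarithm): $$k=\lim_{m\to\infty}-\frac{\log m}{\log x_m},\qquad a=\lim_{m\to\infty}-\frac{x_m^{-k}}{km}.$$ -/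

import Mathlib

open Filter Topology Asymptotics

noncomputable section

namespace ParabolicGerm

/-- `f(x) = x + a x^(k+1) + h.o.t.(x)`, analytic at the origin, with `a ≠ 0` and `k > 0`. -/
structure IsParabolicGerm (f : ℂ → ℂ) (k : ℕ) (a : ℂ) : Prop where
  pos : 0 < k
  ne_zero : a ≠ 0
  analyticAt : AnalyticAt ℂ f 0
  expansion : (fun x => f x - x - a * x ^ (k + 1)) =O[𝓝 0] fun x => x ^ (k + 2)

/-- The set `D_f` of the points whose iterates (including the point itself) all stay in the disc
of radius `r`. -/
def stableSet (f : ℂ → ℂ) (r : ℝ) : Set ℂ :=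
  {x | ∀ n : ℕ, f^[n] x ∈ Metric.ball (0 : ℂ) r}

/-! ### The formal Fatou coordinate -/

/-- The Taylor series of `f` at the origin. -/
def taylor (f : ℂ → ℂ) : PowerSeries ℂ :=
  PowerSeries.mk fun n => iteratedDeriv n f 0 / (n.factorial : ℂ)

/-- The series `f(x) / x` (for `f(0) = 0`). -/
def taylorDivX (f : ℂ → ℂ) : PowerSeries ℂ :=
  PowerSeries.mk fun n => PowerSeries.coeff (n + 1) (taylor f)

/-- The residual invariant `ρ = res_{x=0} (dx / (f(x) - x)) + (k + 1) / 2`. The power series that is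
inverted is `(f(x) - x) / x^(k+1) = a + ⋯`, so the residue is the coefficient of `x^k`
of its inverse. -/
def residualInvariant (f : ℂ → ℂ) (k : ℕ) : ℂ :=
  PowerSeries.coeff k
    (PowerSeries.mk fun n => PowerSeries.coeff (n + k + 1) (taylor f - PowerSeries.X))⁻¹
    + ((k : ℂ) + 1) / 2

/-- A power series `h` encodes the formal expression
`ψ(x) = x^(-k) h(x) + ρ log x = h₀ x^(-k) + ⋯ + h_{k-1} x^(-1) + ρ log x + h_k + h_{k+1} x + ⋯`,
where `ρ` is the residual invariant of `f`. It is a formal Fatou coordinate of `f` if it satisfies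
the Abel equation `ψ ∘ f = ψ + 1`, where `f` is identified with its Taylor series and
`log f(x) - log x` is the power series `log (f(x) / x)`. The equation is written multiplied
by `x^k`. -/
def IsFormalFatou (f : ℂ → ℂ) (k : ℕ) (h : PowerSeries ℂ) : Prop :=
  (taylorDivX f)⁻¹ ^ k * (PowerSeries.subst (taylor f) h : PowerSeries ℂ)
      + PowerSeries.C (residualInvariant f k) * PowerSeries.X ^ k
        * PowerSeries.logOf (taylorDivX f)
    = h + PowerSeries.X ^ k

/-! ### Sectorial Fatou coordinates -/

/-- The open sector with vertex `0`, radius `ε` and half-opening `δ` around the direction `v`. -/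
def sector (v : ℂ) (ε δ : ℝ) : Set ℂ :=
  {x | 0 < ‖x‖ ∧ ‖x‖ < ε ∧ |Complex.arg (x / v)| < δ}

/-- `W` is a sectorial domain attached to an attracting direction `v` of `f` (a unit vector with
`-a v^k > 0`): a domain in `ℂ ∖ {0}` that contains a sector around `v`, is mapped to itself by `f`,
and all of whose orbits tend to `0` in the direction `v`. -/
structure IsAttractingDomain (f : ℂ → ℂ) (k : ℕ) (a v : ℂ) (W : Set ℂ) : Prop where
  norm_eq_one : ‖v‖ = 1
  attracting : a * v ^ k = -(‖a‖ : ℂ)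
  isOpen : IsOpen W
  isConnected : IsConnected W
  zero_notMem : (0 : ℂ) ∉ W
  differentiableOn : DifferentiableOn ℂ f W
  mapsTo : Set.MapsTo f W W
  sector_subset : ∃ ε > 0, ∃ δ > 0, sector v ε δ ⊆ W
  tendsto_zero : ∀ x ∈ W, Tendsto (fun n : ℕ => f^[n] x) atTop (𝓝 0)
  tendsto_direction :
    ∀ x ∈ W, Tendsto (fun n : ℕ => f^[n] x / (‖f^[n] x‖ : ℂ)) atTop (𝓝 v)

/-- `ℓ` is a branch of the logarithm on `W`. -/
def IsLogBranch (W : Set ℂ) (ℓ : ℂ → ℂ) : Prop :=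
  ContinuousOn ℓ W ∧ ∀ x ∈ W, Complex.exp (ℓ x) = x

/-- The sum of the terms of `x^(-k) h(x) + ρ log x` given by the first `n` coefficients of `h` and
by the logarithm, with the branch `ℓ`. -/
def truncation (k : ℕ) (ρ : ℂ) (h : PowerSeries ℂ) (ℓ : ℂ → ℂ) (n : ℕ) (x : ℂ) : ℂ :=
  ∑ i ∈ Finset.range n, PowerSeries.coeff i h * x ^ ((i : ℤ) - (k : ℤ)) + ρ * ℓ x

/-- `ψ` is a sectorial Fatou coordinate of `f` on `W`: analytic, satisfying the Abel equation, and
at a bounded distance from the principal part of the formal Fatou coordinate. -/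
structure IsSectorialFatou (f : ℂ → ℂ) (k : ℕ) (h : PowerSeries ℂ) (W : Set ℂ) (ℓ ψ : ℂ → ℂ) :
    Prop where
  differentiableOn : DifferentiableOn ℂ ψ W
  abel : ∀ x ∈ W, ψ (f x) = ψ x + 1
  bounded : ∃ M : ℝ, ∀ x ∈ W, ‖ψ x - truncation k (residualInvariant f k) h ℓ k x‖ ≤ M

/-- `ψ` is asymptotic on `W` to the formal expression `x^(-k) h(x) + ρ log x`, to all orders. -/
def IsAsymptoticTo (k : ℕ) (ρ : ℂ) (h : PowerSeries ℂ) (W : Set ℂ) (ℓ ψ : ℂ → ℂ) : Prop :=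
  ∀ N : ℕ, (fun x => ψ x - truncation k ρ h ℓ (k + N) x) =O[𝓝[W] 0] fun x => x ^ N

/-- The data attached to the orbit of `x₀`: a sectorial domain `W` that contains the orbit, a branch
`ℓ` of the logarithm on it, the sectorial Fatou coordinate `ψ` with `ψ x₀ = 0`, and the formal
Fatou coordinate `x^(-k) h(x) + ρ log x` to which `ψ` is asymptotic on `W`. -/
structure IsOrbitFatou (f : ℂ → ℂ) (k : ℕ) (a x₀ v : ℂ) (W : Set ℂ) (ℓ ψ : ℂ → ℂ)
    (h : PowerSeries ℂ) : Prop where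
  domain : IsAttractingDomain f k a v W
  orbit_mem : ∀ m : ℕ, f^[m] x₀ ∈ W
  log_branch : IsLogBranch W ℓ
  formal : IsFormalFatou f k h
  sectorial : IsSectorialFatou f k h W ℓ ψ
  normalized : ψ x₀ = 0
  asymptotic : IsAsymptoticTo k (residualInvariant f k) h W ℓ ψ

/-! ### Power-log series -/

/-- The coefficient of `z^i w^j` of `Φ ∈ ℂ⟦z, w⟧`. -/
def coeff₂ (i j : ℕ) (Φ : MvPowerSeries (Fin 2) ℂ) : ℂ :=
  MvPowerSeries.coeff (Finsupp.single 0 i + Finsupp.single 1 j) Φ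

/-- `Φ ∈ ℂ⟦z, w⟧` encodes the power-log series `X(m) = z Φ(z, w)` with `z = m^(-1/k)` and
`w = ρ (log m) / m`. It is the formal inverse of `ψ(x) = x^(-k) h(x) + ρ log x`, for the
determination of the logarithm with `log X(m) = -(1/k) log m + μ + log (e^(-μ) Φ)`, if `Φ` has
constant term `e^μ` and `ψ(X(m)) = m`. The equation is written multiplied by `z^k = 1/m`, and the
term `-(1/k) ρ (log m) / m` is `-w/k`. -/
def IsFormalInverse (k : ℕ) (ρ : ℂ) (h : PowerSeries ℂ) (μ : ℂ) (Φ : MvPowerSeries (Fin 2) ℂ) :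
    Prop :=
  MvPowerSeries.constantCoeff Φ = Complex.exp μ ∧
  Φ⁻¹ ^ k * PowerSeries.subst (MvPowerSeries.X 0 * Φ) h
      + MvPowerSeries.C ρ * MvPowerSeries.X 0 ^ k
        * (MvPowerSeries.C μ
          + PowerSeries.subst (MvPowerSeries.C (Complex.exp (-μ)) * Φ - 1) (PowerSeries.log ℂ))
      - MvPowerSeries.C (1 / (k : ℂ)) * MvPowerSeries.X 1
    = 1

/-- The sum of the terms `φ_{ij} z^(1+i) w^j` with `i + k j < N` of the power-log series `z Φ(z, w)`
at `z = m^(-1/k)`, `w = ρ (log m) / m`. -/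
def powerLogSum (k : ℕ) (ρ : ℂ) (Φ : MvPowerSeries (Fin 2) ℂ) (N m : ℕ) : ℂ :=
  ∑ p ∈ (Finset.range N ×ˢ Finset.range N).filter (fun p => p.1 + k * p.2 < N),
    coeff₂ p.1 p.2 Φ * (((m : ℝ) ^ (-(1 : ℝ) / (k : ℝ)) : ℝ) : ℂ) ^ (1 + p.1)
      * (ρ * ((Real.log m / m : ℝ) : ℂ)) ^ p.2

/-- The sequence `x` has the complete asymptotic expansion `z Φ(z, w)`, `z = m^(-1/k)`,
`w = ρ (log m) / m`: for every `N`, the terms of order less than `(N+1)/k` in `1/m` approximate `x`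
up to the size `m^(-(N+1)/k) (log m)^⌊N/k⌋` of the largest possible term of order `(N+1)/k`. -/
def HasPowerLogExpansion (k : ℕ) (ρ : ℂ) (x : ℕ → ℂ) (Φ : MvPowerSeries (Fin 2) ℂ) : Prop :=
  ∀ N : ℕ, (fun m : ℕ => x m - powerLogSum k ρ Φ N m) =O[atTop]
    fun m : ℕ => (m : ℝ) ^ (-((N : ℝ) + 1) / (k : ℝ)) * Real.log m ^ (N / k)

end ParabolicGerm

end

/-! In the coordinate w = -1/(k a x^k) the germ is w ↦ w + 1 + o(1). An orbit confined to a small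
punctured disc therefore gains at least 3/4 in Re w at each step, so it tends to 0, and Cesàro
averaging gives w(x_m)/m → 1 (`IsParabolicGerm.tendsto_approxCoord_div`). This yields part 3 and,
once the branch of the logarithm is known near the direction v, the limit μ
(`IsOrbitFatou.exists_tendsto_log`).

Formal side. Write f = x U with U = 1 + x^k q. For ψ = x^(-k) h the map ψ ↦ ψ ∘ f - ψ becomes
`fatouDiff`, which raises orders by k and is triangular with diagonal entries (n - k) q(0). Only n =
k is resonant. The obstruction there is the linear form `residueForm`, and ρ is the coefficient of
the logarithm for which it vanishes (`exists_formalFatou_series`). The formal inverse comes from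
successive approximation: replacing Φ by Φ(1 + δ) changes its equation by -kδ to leading order
(`inverseEquation_mul_one_add`), which also gives uniqueness.

Analytic side. The sectorial coordinate is a truncation of the formal one plus the sum of its Abel
errors along the orbit. The errors are O(x^(2k)) and |x_n|^(2k) is O(n^(-2)), uniformly on sets Re w
> -L. Longer truncations give the same function by telescoping (`AdaptedDisc.basinFatou_eq`), hence
the asymptotics to all orders. The delicate point is that one connected domain must contain the
whole orbit, which may start far from the petal. It is a component of the `basin` of the petal: the
segment from x_m to x_{m+1} lies in the basin, because orbits of neighbouring points stay at bounded
distance in w. That is a discrete Grönwall estimate, resting on a bound for ∑ |x_j|^(k+1) uniform in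
the starting point (`AdaptedDisc.exists_sum_bound`, `ControlledDisc.exists_iterate_eq`).

Expansion. For any admissible data, ψ(x_m) = m exactly. By the asymptotics of ψ, x_m m^(1/k) solves
the equation of the formal inverse up to an error of any prescribed order, and so do the truncations
of Φ. Near e^μ the equation has nonzero derivative in its unknown, so the two agree to that order
(`isBigO_sub_of_numericEquation`, `IsFormalInverse.hasExp_rescaled`). -/

noncomputable section

namespace ParabolicGerm

/-! ### The order filtration of the ring of power series -/

section Order

variable {σ : Type*}

/-- The ideal of the power series without terms of total degree less than `n`. -/
def ordIdeal (σ : Type*) (n : ℕ) : Ideal (MvPowerSeries σ ℂ) where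
  carrier := {P | (n : ℕ∞) ≤ P.order}
  add_mem' ha hb := (le_min ha hb).trans MvPowerSeries.min_order_le_add
  zero_mem' := by simp
  smul_mem' c P hP := by
    refine le_trans ?_ (MvPowerSeries.le_order_mul (f := c) (g := P))
    exact le_add_left hP

theorem mem_ordIdeal {n : ℕ} {P : MvPowerSeries σ ℂ} :
    P ∈ ordIdeal σ n ↔ (n : ℕ∞) ≤ P.order := Iff.rfl

theorem mem_ordIdeal_iff_coeff {n : ℕ} {P : MvPowerSeries σ ℂ} :
    P ∈ ordIdeal σ n ↔ ∀ d : σ →₀ ℕ, d.degree < n → MvPowerSeries.coeff d P = 0 :=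
  ⟨fun h _ hd => MvPowerSeries.coeff_of_lt_order (lt_of_lt_of_le (by exact_mod_cast hd) h),
    fun h => MvPowerSeries.nat_le_order h⟩

theorem mul_mem_ordIdeal {m n : ℕ} {P Q : MvPowerSeries σ ℂ} (hP : P ∈ ordIdeal σ m)
    (hQ : Q ∈ ordIdeal σ n) : P * Q ∈ ordIdeal σ (m + n) := by
  refine le_trans ?_ (MvPowerSeries.le_order_mul (f := P) (g := Q))
  push_cast
  exact add_le_add hP hQ

theorem mem_ordIdeal_zero (P : MvPowerSeries σ ℂ) : P ∈ ordIdeal σ 0 := by simp [mem_ordIdeal]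

theorem mem_ordIdeal_one {P : MvPowerSeries σ ℂ} :
    P ∈ ordIdeal σ 1 ↔ MvPowerSeries.constantCoeff P = 0 := by
  rw [mem_ordIdeal, Nat.cast_one, MvPowerSeries.one_le_order_iff_constCoeff_eq_zero]

theorem X_mem_ordIdeal (i : σ) : (MvPowerSeries.X i : MvPowerSeries σ ℂ) ∈ ordIdeal σ 1 :=
  mem_ordIdeal_one.2 (by simp)

theorem pow_mem_ordIdeal {P : MvPowerSeries σ ℂ} (hP : MvPowerSeries.constantCoeff P = 0) (n : ℕ) :
    P ^ n ∈ ordIdeal σ n :=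
  MvPowerSeries.le_order_pow_of_constantCoeff_eq_zero n hP

theorem ordIdeal_anti {m n : ℕ} (h : m ≤ n) : ordIdeal σ n ≤ ordIdeal σ m := fun _ hP =>
  mem_ordIdeal.2 (le_trans (by exact_mod_cast h) (mem_ordIdeal.1 hP))

theorem eq_zero_of_forall_mem_ordIdeal {P : MvPowerSeries σ ℂ} (h : ∀ n, P ∈ ordIdeal σ n) :
    P = 0 := by
  ext d
  exact mem_ordIdeal_iff_coeff.1 (h (d.degree + 1)) d (Nat.lt_succ_self _)

theorem sub_truncTotal_mem [Finite σ] (P : MvPowerSeries σ ℂ) (n : ℕ) :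
    P - (MvPowerSeries.truncTotal n P : MvPolynomial σ ℂ) ∈ ordIdeal σ n := by
  rw [mem_ordIdeal_iff_coeff]
  intro d hd
  rw [map_sub, MvPolynomial.coeff_coe, MvPowerSeries.coeff_truncTotal _ hd, sub_self]

/-- The tail of h is X^n times a series, and substitution turns X^n into P^n, which has order at
least n since P has no constant term. Infinite substitutions are handled through this finite form
throughout. -/
theorem subst_sub_sum_mem {P : MvPowerSeries σ ℂ} (hP : MvPowerSeries.constantCoeff P = 0)
    (h : PowerSeries ℂ) (n : ℕ) :
    PowerSeries.subst P h - ∑ i ∈ Finset.range n, MvPowerSeries.C (PowerSeries.coeff i h) * P ^ i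
      ∈ ordIdeal σ n := by
  have hs : PowerSeries.HasSubst P := PowerSeries.HasSubst.of_constantCoeff_zero hP
  have h1 := PowerSeries.eq_X_pow_mul_shift_add_trunc n h
  have h2 : PowerSeries.subst P (h.trunc n : PowerSeries ℂ)
      = ∑ i ∈ Finset.range n, MvPowerSeries.C (PowerSeries.coeff i h) * P ^ i := by
    rw [PowerSeries.subst_coe hs]
    rcases Nat.eq_zero_or_pos n with rfl | hn
    · simp
    · rw [Polynomial.aeval_eq_sum_range' (n := n)]
      · refine Finset.sum_congr rfl fun i hi => ?_
        rw [PowerSeries.coeff_trunc, if_pos (Finset.mem_range.1 hi), MvPowerSeries.smul_eq_C_mul]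
      · obtain ⟨m, rfl⟩ := Nat.exists_eq_succ_of_ne_zero hn.ne'
        exact PowerSeries.natDegree_trunc_lt h m
  conv => enter [2, 1]; rw [h1]
  rw [PowerSeries.subst_add hs, h2, add_sub_cancel_right, PowerSeries.subst_mul hs,
    PowerSeries.subst_pow hs, PowerSeries.subst_X hs]
  exact Ideal.mul_mem_right _ _ (pow_mem_ordIdeal hP n)

theorem pow_sub_pow_mem {I : Ideal (MvPowerSeries σ ℂ)} {P Q : MvPowerSeries σ ℂ} (h : P - Q ∈ I)
    (i : ℕ) : P ^ i - Q ^ i ∈ I := by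
  obtain ⟨c, hc⟩ := sub_dvd_pow_sub_pow P Q i
  rw [hc]
  exact Ideal.mul_mem_right _ _ h

theorem subst_sub_subst_mem {P Q : MvPowerSeries σ ℂ} (hP : MvPowerSeries.constantCoeff P = 0)
    (hQ : MvPowerSeries.constantCoeff Q = 0) (h : PowerSeries ℂ) {n : ℕ}
    (hPQ : P - Q ∈ ordIdeal σ n) :
    PowerSeries.subst P h - PowerSeries.subst Q h ∈ ordIdeal σ n := by
  have h3 : ∑ i ∈ Finset.range n, MvPowerSeries.C (PowerSeries.coeff i h) * P ^ i
      - ∑ i ∈ Finset.range n, MvPowerSeries.C (PowerSeries.coeff i h) * Q ^ i ∈ ordIdeal σ n := by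
    rw [← Finset.sum_sub_distrib]
    refine Ideal.sum_mem _ fun i _ => ?_
    rw [← mul_sub]
    exact Ideal.mul_mem_left _ _ (pow_sub_pow_mem hPQ i)
  have := Ideal.add_mem _ (Ideal.sub_mem _ (subst_sub_sum_mem hP h n) (subst_sub_sum_mem hQ h n)) h3
  convert this using 1
  ring

end Order

/-! ### Functions with an expansion given by a power series -/

section Expansion

variable {α σ : Type*}

/-- The scale `ξ` consists of functions that are bounded by multiples of the gauge `τ → 0`. -/
structure IsGauge (l : Filter α) (ξ : σ → α → ℂ) (τ : α → ℝ) : Prop where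
  isBigO : ∀ i, ξ i =O[l] τ
  tendsto : Tendsto τ l (𝓝 0)

/-- The function `s` agrees with the power series `P` in the functions `ξ i` up to `O(τ ^ n)`, terms
of order at least `n` of `P` being disregarded. -/
def HasExp (l : Filter α) (ξ : σ → α → ℂ) (τ : α → ℝ) (n : ℕ) (s : α → ℂ)
    (P : MvPowerSeries σ ℂ) : Prop :=
  ∃ p : MvPolynomial σ ℂ, P - (p : MvPowerSeries σ ℂ) ∈ ordIdeal σ n ∧
    (fun t => s t - MvPolynomial.eval (fun i => ξ i t) p) =O[l] fun t => τ t ^ n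

variable {l : Filter α} {ξ : σ → α → ℂ} {τ : α → ℝ} {n : ℕ} {s s' : α → ℂ}
  {P Q : MvPowerSeries σ ℂ}

theorem IsGauge.isBigO_pow_of_le (hg : IsGauge l ξ τ) {m n : ℕ} (h : m ≤ n) :
    (fun t => τ t ^ n) =O[l] fun t => τ t ^ m := by
  obtain ⟨d, rfl⟩ := Nat.exists_eq_add_of_le h
  have h1 : (fun t => τ t ^ d) =O[l] fun _ => (1 : ℝ) := by
    simpa using ((hg.tendsto.pow d).isBigO_one ℝ)
  simpa [pow_add] using (isBigO_refl (fun t => τ t ^ m) l).mul h1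

theorem IsGauge.monomial_isBigO (hg : IsGauge l ξ τ) (d : σ →₀ ℕ) :
    (fun t => d.prod fun i e => ξ i t ^ e) =O[l] fun t => τ t ^ d.degree := by
  have := IsBigO.finsetProd (s := d.support) (f := fun i t => ξ i t ^ d i)
    (g := fun i t => τ t ^ d i) (l := l) (fun i _ => (hg.isBigO i).pow _)
  simpa [Finsupp.prod, Finset.prod_pow_eq_pow_sum, Finsupp.degree_apply] using this

theorem IsGauge.eval_isBigO (hg : IsGauge l ξ τ) {p : MvPolynomial σ ℂ}
    (hp : (p : MvPowerSeries σ ℂ) ∈ ordIdeal σ n) :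
    (fun t => MvPolynomial.eval (fun i => ξ i t) p) =O[l] fun t => τ t ^ n := by
  simp only [MvPolynomial.eval_eq]
  refine IsBigO.fun_sum fun d hd => ?_
  have hn : n ≤ d.degree := by
    by_contra hlt
    have := mem_ordIdeal_iff_coeff.1 hp d (not_le.1 hlt)
    rw [MvPolynomial.coeff_coe] at this
    exact (MvPolynomial.mem_support_iff.1 hd) this
  exact ((hg.monomial_isBigO d).const_mul_left _).trans (hg.isBigO_pow_of_le hn)

theorem IsGauge.eval_isBigO_one (hg : IsGauge l ξ τ) (p : MvPolynomial σ ℂ) :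
    (fun t => MvPolynomial.eval (fun i => ξ i t) p) =O[l] fun _ => (1 : ℝ) := by
  simpa using hg.eval_isBigO (mem_ordIdeal_zero (p : MvPowerSeries σ ℂ))

/-- The polynomial in `HasExp` can be exchanged: two candidates differ by a polynomial of order at
least n, whose values are O(τ^n). -/
theorem HasExp.isBigO_sub_eval (hg : IsGauge l ξ τ) (h : HasExp l ξ τ n s P)
    {p : MvPolynomial σ ℂ} (hp : P - (p : MvPowerSeries σ ℂ) ∈ ordIdeal σ n) :
    (fun t => s t - MvPolynomial.eval (fun i => ξ i t) p) =O[l] fun t => τ t ^ n := by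
  obtain ⟨q, hq, hs⟩ := h
  have h1 : ((q - p : MvPolynomial σ ℂ) : MvPowerSeries σ ℂ) ∈ ordIdeal σ n := by
    have := Ideal.sub_mem _ hp hq
    rw [sub_sub_sub_cancel_left] at this
    have e : ((q - p : MvPolynomial σ ℂ) : MvPowerSeries σ ℂ) = q - p :=
      map_sub MvPolynomial.coeToMvPowerSeries.ringHom q p
    rwa [e]
  have := hs.add (hg.eval_isBigO h1)
  simpa using this

theorem HasExp.isBigO_one (hg : IsGauge l ξ τ) (h : HasExp l ξ τ n s P) :
    s =O[l] fun _ => (1 : ℝ) := by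
  obtain ⟨p, -, hs⟩ := h
  have := (hs.trans (hg.isBigO_pow_of_le (Nat.zero_le n))).add
    ((hg.eval_isBigO_one p).trans (by simpa using isBigO_refl (fun _ : α => (1 : ℝ)) l))
  simpa using this

theorem HasExp.congr (h : HasExp l ξ τ n s P) (hs : (fun t => s' t - s t) =O[l] fun t => τ t ^ n)
    (hP : P - Q ∈ ordIdeal σ n) : HasExp l ξ τ n s' Q := by
  obtain ⟨p, hp, hsp⟩ := h
  refine ⟨p, ?_, ?_⟩
  · have := Ideal.sub_mem _ hp hP
    convert this using 1
    ring
  · simpa using hs.add hsp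

theorem HasExp.congr_eventuallyEq (h : HasExp l ξ τ n s P) (hs : s =ᶠ[l] s') :
    HasExp l ξ τ n s' P := by
  refine h.congr ?_ (by simp)
  refine IsBigO.congr' (isBigO_zero _ _) ?_ EventuallyEq.rfl
  filter_upwards [hs] with t ht
  simp [ht]

theorem hasExp_eval (p : MvPolynomial σ ℂ) :
    HasExp l ξ τ n (fun t => MvPolynomial.eval (fun i => ξ i t) p) (p : MvPowerSeries σ ℂ) :=
  ⟨p, by simp, by simpa using isBigO_zero _ _⟩

theorem hasExp_const (c : ℂ) : HasExp l ξ τ n (fun _ => c) (MvPowerSeries.C c : MvPowerSeries σ ℂ) := by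
  simpa using hasExp_eval (l := l) (ξ := ξ) (τ := τ) (n := n) (MvPolynomial.C c)

theorem hasExp_X (i : σ) : HasExp l ξ τ n (ξ i) (MvPowerSeries.X i : MvPowerSeries σ ℂ) := by
  simpa using hasExp_eval (l := l) (ξ := ξ) (τ := τ) (n := n) (MvPolynomial.X i)

theorem HasExp.add (h : HasExp l ξ τ n s P) (h' : HasExp l ξ τ n s' Q) :
    HasExp l ξ τ n (fun t => s t + s' t) (P + Q) := by
  obtain ⟨p, hp, hs⟩ := h
  obtain ⟨q, hq, hs'⟩ := h'
  refine ⟨p + q, ?_, ?_⟩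
  · have := Ideal.add_mem _ hp hq
    rw [MvPolynomial.coe_add]
    convert this using 1
    ring
  · refine (hs.add hs').congr_left fun t => ?_
    rw [map_add]; ring

theorem HasExp.mul (hg : IsGauge l ξ τ) (h : HasExp l ξ τ n s P) (h' : HasExp l ξ τ n s' Q) :
    HasExp l ξ τ n (fun t => s t * s' t) (P * Q) := by
  have hb := h.isBigO_one hg
  obtain ⟨p, hp, hs⟩ := h
  obtain ⟨q, hq, hs'⟩ := h'
  refine ⟨p * q, ?_, ?_⟩
  · have := Ideal.add_mem _ (Ideal.mul_mem_left _ P hq)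
      (Ideal.mul_mem_right (q : MvPowerSeries σ ℂ) _ hp)
    rw [MvPolynomial.coe_mul]
    convert this using 1
    ring
  · have h1 := hb.mul hs'
    have h2 := hs.mul (hg.eval_isBigO_one q)
    simp only [one_mul, mul_one] at h1 h2
    refine (h1.add h2).congr_left fun t => ?_
    rw [map_mul]; ring

theorem HasExp.const_mul (hg : IsGauge l ξ τ) (h : HasExp l ξ τ n s P) (c : ℂ) :
    HasExp l ξ τ n (fun t => c * s t) (MvPowerSeries.C c * P) :=
  (hasExp_const c).mul hg h

theorem HasExp.sub (hg : IsGauge l ξ τ) (h : HasExp l ξ τ n s P) (h' : HasExp l ξ τ n s' Q) :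
    HasExp l ξ τ n (fun t => s t - s' t) (P - Q) := by
  have := h.add (h'.const_mul hg (-1))
  simpa [sub_eq_add_neg] using this

theorem HasExp.pow (hg : IsGauge l ξ τ) (h : HasExp l ξ τ n s P) (i : ℕ) :
    HasExp l ξ τ n (fun t => s t ^ i) (P ^ i) := by
  induction i with
  | zero => simpa using hasExp_const (l := l) (ξ := ξ) (τ := τ) (n := n) (1 : ℂ)
  | succ i ih => simpa [pow_succ] using ih.mul hg h

theorem HasExp.sum {ι : Type*} {A : Finset ι} {F : ι → α → ℂ} {R : ι → MvPowerSeries σ ℂ}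
    (h : ∀ i ∈ A, HasExp l ξ τ n (F i) (R i)) :
    HasExp l ξ τ n (fun t => ∑ i ∈ A, F i t) (∑ i ∈ A, R i) := by
  classical
  induction A using Finset.induction_on with
  | empty => simpa using hasExp_const (l := l) (ξ := ξ) (τ := τ) (n := n) (0 : ℂ)
  | insert i A hi ih =>
    simp only [Finset.sum_insert hi]
    exact (h i (Finset.mem_insert_self _ _)).add
      (ih fun j hj => h j (Finset.mem_insert_of_mem hj))

theorem HasExp.isBigO_of_mem (hg : IsGauge l ξ τ) (h : HasExp l ξ τ n s P)
    (hP : P ∈ ordIdeal σ n) : s =O[l] fun t => τ t ^ n := by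
  simpa using h.isBigO_sub_eval hg (p := 0) (by simpa using hP)

theorem HasExp.mono (hg : IsGauge l ξ τ) (h : HasExp l ξ τ n s P) {m : ℕ} (hm : m ≤ n) :
    HasExp l ξ τ m s P := by
  obtain ⟨p, hp, hs⟩ := h
  exact ⟨p, ordIdeal_anti hm hp, hs.trans (hg.isBigO_pow_of_le hm)⟩

theorem HasExp.tendsto (hg : IsGauge l ξ τ) (h : HasExp l ξ τ n s P) (hn : 1 ≤ n) :
    Tendsto s l (𝓝 (MvPowerSeries.constantCoeff P)) := by
  have h1 := (h.mono hg hn).isBigO_sub_eval hg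
    (p := MvPolynomial.C (MvPowerSeries.constantCoeff P)) (by rw [mem_ordIdeal_one]; simp)
  simp only [MvPolynomial.eval_C, pow_one] at h1
  have := h1.trans_tendsto hg.tendsto
  simpa using this.add_const (MvPowerSeries.constantCoeff P)

/-- Let q be a truncation of P⁻¹. Then 1 - s q has the expansion 1 - P P⁻¹ = 0, so it is O(τ^n);
multiplying by the bounded function s⁻¹ compares s⁻¹ with q. -/
theorem HasExp.inv [Finite σ] (hg : IsGauge l ξ τ) (h : HasExp l ξ τ n s P) (hn : 1 ≤ n)
    (hP : MvPowerSeries.constantCoeff P ≠ 0) : HasExp l ξ τ n (fun t => (s t)⁻¹) P⁻¹ := by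
  have hT := (h.tendsto hg hn).inv₀ hP
  have hne := (h.tendsto hg hn).eventually_ne hP
  refine ⟨MvPowerSeries.truncTotal n P⁻¹, sub_truncTotal_mem _ _, ?_⟩
  set q := MvPowerSeries.truncTotal n P⁻¹ with hq
  have h1 : HasExp l ξ τ n (fun t => MvPolynomial.eval (fun i => ξ i t) q) P⁻¹ :=
    (hasExp_eval q).congr (by simpa using isBigO_zero _ _)
      (by rw [← neg_sub]; exact Ideal.neg_mem_iff _ |>.2 (sub_truncTotal_mem _ _))
  have h2 := ((hasExp_const 1).sub hg (h.mul hg h1)).isBigO_of_mem hg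
    (by rw [MvPowerSeries.mul_inv_cancel _ hP]; simp)
  have h3 := (hT.isBigO_one ℝ).mul h2
  simp only [one_mul] at h3
  refine h3.congr' ?_ EventuallyEq.rfl
  filter_upwards [hne] with t ht
  field_simp

/-- Since P has no constant term, s = O(τ). Both the analytic remainder O(s^n) of g and the formal
remainder of H are then negligible, and only a polynomial in s remains. -/
theorem HasExp.subst (hg : IsGauge l ξ τ) (h : HasExp l ξ τ n s P)
    (hP : MvPowerSeries.constantCoeff P = 0) (hn : 1 ≤ n) {g : ℂ → ℂ} {H : PowerSeries ℂ}
    (hgH : (fun x => g x - ∑ i ∈ Finset.range n, PowerSeries.coeff i H * x ^ i)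
      =O[𝓝 0] fun x => x ^ n) :
    HasExp l ξ τ n (fun t => g (s t)) (PowerSeries.subst P H) := by
  have hT := h.tendsto hg hn
  rw [hP] at hT
  have hs : s =O[l] τ := by
    simpa using (h.mono hg hn).isBigO_of_mem hg (mem_ordIdeal_one.2 hP)
  have h1 : HasExp l ξ τ n (fun t => ∑ i ∈ Finset.range n, PowerSeries.coeff i H * s t ^ i)
      (∑ i ∈ Finset.range n, MvPowerSeries.C (PowerSeries.coeff i H) * P ^ i) :=
    HasExp.sum fun i _ => (h.pow hg i).const_mul hg _
  refine h1.congr ((hgH.comp_tendsto hT).trans (hs.pow n)) ?_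
  rw [← neg_sub]
  exact (Ideal.neg_mem_iff _).2 (subst_sub_sum_mem hP H n)

end Expansion

/-! ### The formal inverse -/

section FormalInverse

/-- The left-hand side of the equation of the formal inverse. -/
def inverseEquation (k : ℕ) (ρ : ℂ) (h : PowerSeries ℂ) (μ : ℂ) (Φ : MvPowerSeries (Fin 2) ℂ) :
    MvPowerSeries (Fin 2) ℂ :=
  Φ⁻¹ ^ k * PowerSeries.subst (MvPowerSeries.X 0 * Φ) h
      + MvPowerSeries.C ρ * MvPowerSeries.X 0 ^ k
        * (MvPowerSeries.C μ
          + PowerSeries.subst (MvPowerSeries.C (Complex.exp (-μ)) * Φ - 1) (PowerSeries.log ℂ))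
      - MvPowerSeries.C (1 / (k : ℂ)) * MvPowerSeries.X 1

variable {σ : Type*}

/-- First-order binomial expansion: the quadratic terms contain δ², of order 2n ≥ n + 1 because n ≥
1. -/
theorem inv_one_add_pow_sub_mem {n : ℕ} (hn : 1 ≤ n) {δ : MvPowerSeries σ ℂ}
    (hδ : δ ∈ ordIdeal σ n) (k : ℕ) :
    (1 + δ)⁻¹ ^ k - (1 - MvPowerSeries.C (k : ℂ) * δ) ∈ ordIdeal σ (n + 1) := by
  have hc : MvPowerSeries.constantCoeff (1 + δ) ≠ 0 := by
    rw [map_add, mem_ordIdeal_one.1 (ordIdeal_anti hn hδ)]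
    simp
  set V := (1 + δ)⁻¹ with hV
  have hVδ : V * (1 + δ) = 1 := MvPowerSeries.inv_mul_cancel _ hc
  have hδ2 : δ * δ ∈ ordIdeal σ (n + 1) :=
    ordIdeal_anti (by omega) (mul_mem_ordIdeal hδ hδ)
  have h1 : V - (1 - δ) ∈ ordIdeal σ (n + 1) := by
    have : V - (1 - δ) = V * (δ * δ) := by linear_combination (1 - δ) * hVδ
    rw [this]
    exact Ideal.mul_mem_left _ _ hδ2
  induction k with
  | zero => simp
  | succ k ih =>
    have := Ideal.add_mem _ (Ideal.add_mem _ (Ideal.mul_mem_right V _ ih)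
      (Ideal.mul_mem_left _ (1 - MvPowerSeries.C (k : ℂ) * δ) h1))
      (Ideal.mul_mem_left _ (MvPowerSeries.C (k : ℂ)) hδ2)
    convert this using 1
    push_cast
    rw [map_add, map_one]
    ring

theorem constantCoeff_X_mul {σ : Type*} (i : σ) (Φ : MvPowerSeries σ ℂ) :
    MvPowerSeries.constantCoeff (MvPowerSeries.X i * Φ) = 0 := by
  rw [map_mul, MvPowerSeries.constantCoeff_X, zero_mul]

theorem constantCoeff_normalized {σ : Type*} {μ : ℂ} {Φ : MvPowerSeries σ ℂ}
    (hΦ : MvPowerSeries.constantCoeff Φ = Complex.exp μ) :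
    MvPowerSeries.constantCoeff (MvPowerSeries.C (Complex.exp (-μ)) * Φ - 1) = 0 := by
  rw [map_sub, map_mul, hΦ, MvPowerSeries.constantCoeff_C, ← Complex.exp_add]
  simp

theorem constantCoeff_subst_of_constantCoeff_eq_zero {σ : Type*} {P : MvPowerSeries σ ℂ}
    (hP : MvPowerSeries.constantCoeff P = 0) (h : PowerSeries ℂ) :
    MvPowerSeries.constantCoeff (PowerSeries.subst P h) = PowerSeries.coeff 0 h := by
  have := mem_ordIdeal_one.1 (subst_sub_sum_mem hP h 1)
  simpa [sub_eq_zero] using this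

variable {k : ℕ} {ρ : ℂ} {h : PowerSeries ℂ} {μ : ℂ} {Φ Φ' : MvPowerSeries (Fin 2) ℂ}

theorem exp_neg_pow (μ : ℂ) (k : ℕ) : (Complex.exp μ)⁻¹ ^ k = Complex.exp (-(k : ℂ) * μ) := by
  rw [← Complex.exp_neg, ← Complex.exp_nat_mul]
  congr 1
  ring

theorem constantCoeff_inv_pow_mul_subst (hΦ : MvPowerSeries.constantCoeff Φ = Complex.exp μ)
    (h0 : Complex.exp (-(k : ℂ) * μ) * PowerSeries.coeff 0 h = 1) :
    MvPowerSeries.constantCoeff (Φ⁻¹ ^ k * PowerSeries.subst (MvPowerSeries.X 0 * Φ) h) = 1 := by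
  rw [map_mul, map_pow, MvPowerSeries.constantCoeff_inv, hΦ, exp_neg_pow,
    constantCoeff_subst_of_constantCoeff_eq_zero (constantCoeff_X_mul 0 Φ), h0]

theorem inverseEquation_sub_one_mem (hk : 0 < k)
    (hΦ : MvPowerSeries.constantCoeff Φ = Complex.exp μ)
    (h0 : Complex.exp (-(k : ℂ) * μ) * PowerSeries.coeff 0 h = 1) :
    inverseEquation k ρ h μ Φ - 1 ∈ ordIdeal (Fin 2) 1 := by
  rw [mem_ordIdeal_one, inverseEquation, map_sub, map_sub, map_add,
    constantCoeff_inv_pow_mul_subst hΦ h0]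
  simp [hk.ne']

/-- The linearisation at Φ is multiplication by -k. The perturbation inside h and the one inside the
logarithm each carry a power of X₀, which gains an order. Only the factor Φ⁻ᵏ contributes; its
cofactor makes Φ⁻ᵏ h(X₀Φ) equal to 1 modulo order 1, by the normalisation `h0`. -/
theorem inverseEquation_mul_one_add (hk : 0 < k)
    (hΦ : MvPowerSeries.constantCoeff Φ = Complex.exp μ)
    (h0 : Complex.exp (-(k : ℂ) * μ) * PowerSeries.coeff 0 h = 1)
    {n : ℕ} (hn : 1 ≤ n) {δ : MvPowerSeries (Fin 2) ℂ} (hδ : δ ∈ ordIdeal (Fin 2) n) :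
    inverseEquation k ρ h μ (Φ * (1 + δ)) - inverseEquation k ρ h μ Φ
      + MvPowerSeries.C (k : ℂ) * δ ∈ ordIdeal (Fin 2) (n + 1) := by
  have hΦ' : MvPowerSeries.constantCoeff (Φ * (1 + δ)) = Complex.exp μ := by
    rw [map_mul, map_add, mem_ordIdeal_one.1 (ordIdeal_anti hn hδ), hΦ]
    simp
  unfold inverseEquation
  set S := PowerSeries.subst (MvPowerSeries.X 0 * Φ) h with hS
  set S' := PowerSeries.subst (MvPowerSeries.X 0 * (Φ * (1 + δ))) h with hS'
  set L := PowerSeries.subst (MvPowerSeries.C (Complex.exp (-μ)) * Φ - 1) (PowerSeries.log ℂ)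
    with hL
  set L' := PowerSeries.subst (MvPowerSeries.C (Complex.exp (-μ)) * (Φ * (1 + δ)) - 1)
    (PowerSeries.log ℂ) with hL'
  have hSS : S' - S ∈ ordIdeal (Fin 2) (n + 1) := by
    refine subst_sub_subst_mem (constantCoeff_X_mul _ _) (constantCoeff_X_mul _ _) h ?_
    have := Ideal.mul_mem_left _ Φ (mul_mem_ordIdeal hδ (X_mem_ordIdeal (0 : Fin 2)))
    convert this using 1
    ring
  have hLL : MvPowerSeries.X 0 ^ k * (L' - L) ∈ ordIdeal (Fin 2) (n + 1) := by
    have h1 : L' - L ∈ ordIdeal (Fin 2) n := by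
      refine subst_sub_subst_mem (constantCoeff_normalized hΦ') (constantCoeff_normalized hΦ) _ ?_
      have := Ideal.mul_mem_left _ (MvPowerSeries.C (Complex.exp (-μ)) * Φ) hδ
      convert this using 1
      ring
    have h2 : (MvPowerSeries.X 0 : MvPowerSeries (Fin 2) ℂ) ^ k ∈ ordIdeal (Fin 2) 1 :=
      ordIdeal_anti hk (pow_mem_ordIdeal (by simp) k)
    exact add_comm n 1 ▸ mul_mem_ordIdeal h2 h1
  have hV := inv_one_add_pow_sub_mem hn hδ k
  have hBS : 1 - Φ⁻¹ ^ k * S ∈ ordIdeal (Fin 2) 1 := by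
    rw [mem_ordIdeal_one, map_sub, constantCoeff_inv_pow_mul_subst hΦ h0]
    simp
  have hkδ := Ideal.mul_mem_left _ (MvPowerSeries.C (k : ℂ)) (mul_mem_ordIdeal hδ hBS)
  have h1 := Ideal.mul_mem_left _ (Φ⁻¹ ^ k * (1 + δ)⁻¹ ^ k) hSS
  have h2 := Ideal.mul_mem_left _ (Φ⁻¹ ^ k * S) hV
  have h3 := Ideal.mul_mem_left _ (MvPowerSeries.C ρ) hLL
  have := Ideal.add_mem _ (Ideal.add_mem _ (Ideal.add_mem _ h1 h2) h3) hkδ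
  convert this using 1
  rw [MvPowerSeries.mul_inv_rev, mul_pow]
  ring

theorem eq_mul_one_add (hΦ : MvPowerSeries.constantCoeff Φ = Complex.exp μ)
    (Φ' : MvPowerSeries (Fin 2) ℂ) : Φ' = Φ * (1 + Φ⁻¹ * (Φ' - Φ)) := by
  have : Φ * Φ⁻¹ = 1 := MvPowerSeries.mul_inv_cancel _ (by rw [hΦ]; exact Complex.exp_ne_zero _)
  linear_combination (Φ - Φ') * this

theorem C_natCast_mul_mem_iff {σ : Type*} (hk : 0 < k) {n : ℕ} {δ : MvPowerSeries σ ℂ} :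
    MvPowerSeries.C (k : ℂ) * δ ∈ ordIdeal σ n ↔ δ ∈ ordIdeal σ n := by
  refine ⟨fun hδ => ?_, Ideal.mul_mem_left _ _⟩
  have := Ideal.mul_mem_left _ (MvPowerSeries.C (k : ℂ)⁻¹) hδ
  rwa [← mul_assoc, ← map_mul, inv_mul_cancel₀ (by exact_mod_cast hk.ne'), map_one,
    one_mul] at this

/-- If the relative difference δ of two solutions has order n + 1, the linearisation puts kδ in
order n + 2; iterating gives δ = 0. -/
theorem IsFormalInverse.unique (hk : 0 < k)
    (h0 : Complex.exp (-(k : ℂ) * μ) * PowerSeries.coeff 0 h = 1)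
    (hΦ : IsFormalInverse k ρ h μ Φ) (hΦ' : IsFormalInverse k ρ h μ Φ') : Φ' = Φ := by
  obtain ⟨hc, he⟩ := hΦ
  obtain ⟨hc', he'⟩ := hΦ'
  set δ := Φ⁻¹ * (Φ' - Φ) with hδ
  have hmul : Φ' = Φ * (1 + δ) := eq_mul_one_add hc Φ'
  have hmem : ∀ n, δ ∈ ordIdeal (Fin 2) (n + 1) := by
    intro n
    induction n with
    | zero =>
      rw [zero_add, mem_ordIdeal_one, hδ, map_mul, map_sub, hc, hc', sub_self, mul_zero]
    | succ n ih =>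
      have := inverseEquation_mul_one_add (ρ := ρ) hk hc h0 (Nat.le_add_left 1 n) ih
      rw [← hmul] at this
      unfold inverseEquation at this
      rw [he, he', sub_self, zero_add] at this
      exact (C_natCast_mul_mem_iff hk).1 this
  have : δ = 0 := eq_zero_of_forall_mem_ordIdeal fun n => ordIdeal_anti (Nat.le_succ n) (hmem n)
  rw [hmul, this, add_zero, mul_one]

/-- The successive approximations of the formal inverse. -/
def inverseApprox (k : ℕ) (ρ : ℂ) (h : PowerSeries ℂ) (μ : ℂ) : ℕ → MvPowerSeries (Fin 2) ℂ
  | 0 => MvPowerSeries.C (Complex.exp μ)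
  | n + 1 => inverseApprox k ρ h μ n *
      (1 + MvPowerSeries.C ((k : ℂ)⁻¹) * (inverseEquation k ρ h μ (inverseApprox k ρ h μ n) - 1))

/-- The correction factor 1 + k⁻¹(E - 1) moves the value E of the equation by -(E - 1) modulo one
order more, so each approximation gains an order. -/
theorem inverseApprox_spec (hk : 0 < k)
    (h0 : Complex.exp (-(k : ℂ) * μ) * PowerSeries.coeff 0 h = 1) (n : ℕ) :
    MvPowerSeries.constantCoeff (inverseApprox k ρ h μ n) = Complex.exp μ ∧
      inverseEquation k ρ h μ (inverseApprox k ρ h μ n) - 1 ∈ ordIdeal (Fin 2) (n + 1) := by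
  induction n with
  | zero =>
    have : MvPowerSeries.constantCoeff (inverseApprox k ρ h μ 0) = Complex.exp μ := by
      simp [inverseApprox]
    exact ⟨this, inverseEquation_sub_one_mem hk this h0⟩
  | succ n ih =>
    obtain ⟨hc, he⟩ := ih
    have hδ := Ideal.mul_mem_left _ (MvPowerSeries.C (k : ℂ)⁻¹) he
    constructor
    · rw [inverseApprox, map_mul, map_add,
        mem_ordIdeal_one.1 (ordIdeal_anti (Nat.le_add_left 1 n) hδ), hc]
      simp
    · have := inverseEquation_mul_one_add (ρ := ρ) hk hc h0 (Nat.le_add_left 1 n) hδ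
      rw [inverseApprox]
      convert this using 1
      rw [← mul_assoc, ← map_mul, mul_inv_cancel₀ (by exact_mod_cast hk.ne'), map_one]
      ring

theorem inverseApprox_sub_mem (hk : 0 < k)
    (h0 : Complex.exp (-(k : ℂ) * μ) * PowerSeries.coeff 0 h = 1) (n j : ℕ) :
    inverseApprox k ρ h μ (n + j) - inverseApprox k ρ h μ n ∈ ordIdeal (Fin 2) (n + 1) := by
  induction j with
  | zero => simp
  | succ j ih =>
    have := Ideal.mul_mem_left _ (inverseApprox k ρ h μ (n + j) * MvPowerSeries.C (k : ℂ)⁻¹)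
      (ordIdeal_anti (by omega : n + 1 ≤ n + j + 1) (inverseApprox_spec (ρ := ρ) hk h0 (n + j)).2)
    have := Ideal.add_mem _ ih this
    convert this using 1
    rw [← add_assoc, inverseApprox]
    ring

theorem exists_isFormalInverse (hk : 0 < k)
    (h0 : Complex.exp (-(k : ℂ) * μ) * PowerSeries.coeff 0 h = 1) :
    ∃ Φ, IsFormalInverse k ρ h μ Φ := by
  -- Coefficients of total degree at most n no longer change after the n-th approximation, so the
  -- limit is read off diagonally.
  let Φ : MvPowerSeries (Fin 2) ℂ := fun d => inverseApprox k ρ h μ d.degree d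
  have hcoeff : ∀ d, MvPowerSeries.coeff d Φ
      = MvPowerSeries.coeff d (inverseApprox k ρ h μ d.degree) := fun d => rfl
  have hsub : ∀ n, Φ - inverseApprox k ρ h μ n ∈ ordIdeal (Fin 2) (n + 1) := by
    intro n
    rw [mem_ordIdeal_iff_coeff]
    intro d hd
    obtain ⟨j, hj⟩ := Nat.exists_eq_add_of_le (Nat.lt_succ_iff.1 hd)
    have := mem_ordIdeal_iff_coeff.1 (inverseApprox_sub_mem (ρ := ρ) hk h0 d.degree j) d
      (Nat.lt_succ_self _)
    rw [← hj, map_sub, sub_eq_zero] at this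
    rw [map_sub, hcoeff, this, sub_self]
  have hc : MvPowerSeries.constantCoeff Φ = Complex.exp μ := by
    have := mem_ordIdeal_one.1 (hsub 0)
    rw [map_sub, (inverseApprox_spec hk h0 0).1, sub_eq_zero] at this
    exact this
  refine ⟨Φ, hc, ?_⟩
  have : inverseEquation k ρ h μ Φ - 1 = 0 := by
    refine eq_zero_of_forall_mem_ordIdeal fun n => ordIdeal_anti (Nat.le_succ n) ?_
    obtain ⟨hcn, hen⟩ := inverseApprox_spec (ρ := ρ) hk h0 n
    have hδ := Ideal.mul_mem_left _ (inverseApprox k ρ h μ n)⁻¹ (hsub n)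
    have h1 := inverseEquation_mul_one_add (ρ := ρ) hk hcn h0 (Nat.le_add_left 1 n) hδ
    rw [← eq_mul_one_add hcn Φ] at h1
    have := Ideal.sub_mem _ (Ideal.add_mem _ (ordIdeal_anti (Nat.le_succ _) h1) hen)
      (Ideal.mul_mem_left _ (MvPowerSeries.C (k : ℂ)) hδ)
    convert this using 1
    ring
  exact sub_eq_zero.1 this

end FormalInverse

/-! ### Existence of a formal Fatou coordinate -/

section FormalFatou

open PowerSeries

theorem mem_ordIdeal_unit_iff_coeff {n : ℕ} {P : PowerSeries ℂ} :
    P ∈ ordIdeal Unit n ↔ ∀ i < n, PowerSeries.coeff i P = 0 := by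
  rw [mem_ordIdeal_iff_coeff]
  constructor
  · intro h i hi
    exact h _ (by simpa using hi)
  · intro h d hd
    have h1 : d = Finsupp.single () (d ()) := by ext; simp
    have h2 : d.degree = d () := by rw [h1]; simp
    rw [h1]
    exact h _ (h2 ▸ hd)

theorem mem_ordIdeal_unit_iff_dvd {n : ℕ} {P : PowerSeries ℂ} :
    P ∈ ordIdeal Unit n ↔ (X : PowerSeries ℂ) ^ n ∣ P := by
  rw [mem_ordIdeal_unit_iff_coeff, PowerSeries.X_pow_dvd_iff]

variable {k : ℕ} {a : ℂ} {q U : PowerSeries ℂ}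

/-- The operator `h ↦ U⁻ᵏ h(x U) - h`, which corresponds to `ψ ↦ ψ ∘ f - ψ` for
`ψ = x⁻ᵏ h(x)` and `f = x U`. -/
def fatouDiff (k : ℕ) (U h : PowerSeries ℂ) : PowerSeries ℂ :=
  U⁻¹ ^ k * (PowerSeries.subst (X * U) h : PowerSeries ℂ) - h

theorem constantCoeff_X_mul' (U : PowerSeries ℂ) :
    MvPowerSeries.constantCoeff (X * U : PowerSeries ℂ) = 0 :=
  constantCoeff_X_mul () U

theorem hasSubst_X_mul (U : PowerSeries ℂ) : PowerSeries.HasSubst (X * U : PowerSeries ℂ) :=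
  PowerSeries.HasSubst.of_constantCoeff_zero (constantCoeff_X_mul' U)

theorem fatouDiff_add (h h' : PowerSeries ℂ) :
    fatouDiff k U (h + h') = fatouDiff k U h + fatouDiff k U h' := by
  simp only [fatouDiff, PowerSeries.subst_add (hasSubst_X_mul U)]
  ring

theorem fatouDiff_X_pow (n : ℕ) : fatouDiff k U (X ^ n) = X ^ n * (U⁻¹ ^ k * U ^ n - 1) := by
  rw [fatouDiff, PowerSeries.subst_pow (hasSubst_X_mul U), PowerSeries.subst_X (hasSubst_X_mul U)]
  ring

theorem fatouDiff_C_mul (c : ℂ) (h : PowerSeries ℂ) :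
    fatouDiff k U (C c * h) = C c * fatouDiff k U h := by
  simp only [fatouDiff, PowerSeries.subst_mul (hasSubst_X_mul U), PowerSeries.subst_C]
  change _ * (C c * _) - _ = _
  ring

/-- Continuity of `fatouDiff` for the order filtration; it reduces what follows to monomials. -/
theorem fatouDiff_sub_sum_mem (h : PowerSeries ℂ) (n : ℕ) :
    fatouDiff k U h - ∑ i ∈ Finset.range n, C (coeff i h) * fatouDiff k U (X ^ i)
      ∈ ordIdeal Unit n := by
  have h1 := subst_sub_sum_mem (constantCoeff_X_mul' U) h n
  have h2 : h - ∑ i ∈ Finset.range n, C (coeff i h) * X ^ i ∈ ordIdeal Unit n := by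
    have := subst_sub_sum_mem (P := (X : PowerSeries ℂ)) (MvPowerSeries.constantCoeff_X _) h n
    rwa [PowerSeries.X_subst] at this
  have := Ideal.sub_mem _ (Ideal.mul_mem_left _ (U⁻¹ ^ k : PowerSeries ℂ) h1) h2
  convert this using 1
  simp only [fatouDiff_X_pow]
  rw [mul_sub, Finset.mul_sum]
  have : ∀ i ∈ Finset.range n, (C (coeff i h) * (X ^ i * (U⁻¹ ^ k * U ^ i - 1)) : PowerSeries ℂ)
      = U⁻¹ ^ k * (C (coeff i h) * (X * U) ^ i) - C (coeff i h) * X ^ i := fun i _ => by ring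
  rw [Finset.sum_congr rfl this, Finset.sum_sub_distrib]
  unfold fatouDiff
  change _ = U⁻¹ ^ k * _ - ∑ i ∈ Finset.range n, U⁻¹ ^ k * (C (coeff i h) * (X * U) ^ i) - _
  ring

theorem constantCoeff_one_add_X_pow_mul (hk : 0 < k) (q : PowerSeries ℂ) :
    constantCoeff (1 + X ^ k * q) = 1 := by
  simp [hk.ne']

/-- The second-order term is needed: with e = X^k q it reaches the resonant degree 2k, and its
coefficient k(k+1)/2 is the origin of the summand (k+1)/2 of the residual invariant. -/
theorem inv_pow_expansion {e V : PowerSeries ℂ} (h : V * (1 + e) = 1) (k : ℕ) :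
    ∃ r, V ^ k = 1 - C (k : ℂ) * e + C ((k : ℂ) * (k + 1) / 2) * e ^ 2 + e ^ 3 * r := by
  have hV : V = 1 - e + e ^ 2 - e ^ 3 * V := by linear_combination (1 - e + e ^ 2) * h
  induction k with
  | zero => exact ⟨0, by simp⟩
  | succ k ih =>
    obtain ⟨r, hr⟩ := ih
    have hC : (C ((k + 1 : ℂ) * (k + 1 + 1) / 2) : PowerSeries ℂ)
        = C ((k : ℂ) * (k + 1) / 2) + C (k : ℂ) + 1 := by
      rw [← map_one C, ← map_add, ← map_add]; congr 1; ring
    refine ⟨r * V - V ^ 1 * (1 - C (k : ℂ) * e + C ((k : ℂ) * (k + 1) / 2) * e ^ 2)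
      - C (k : ℂ) - C ((k : ℂ) * (k + 1) / 2) + C ((k : ℂ) * (k + 1) / 2) * e, ?_⟩
    rw [pow_succ, hr]
    push_cast
    rw [hC, map_add, map_one]
    linear_combination (1 - C (k : ℂ) * e + C ((k : ℂ) * (k + 1) / 2) * e ^ 2) * hV

theorem one_add_pow_expansion (e : PowerSeries ℂ) (n : ℕ) :
    ∃ r, (1 + e) ^ n = 1 + C (n : ℂ) * e + e ^ 2 * r := by
  induction n with
  | zero => exact ⟨0, by simp⟩
  | succ n ih =>
    obtain ⟨r, hr⟩ := ih
    refine ⟨C (n : ℂ) + r * (1 + e), ?_⟩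
    rw [pow_succ, hr]
    push_cast
    rw [map_add, map_one]
    ring

theorem inv_mul_one_add_X_pow_mul (hk : 0 < k) (q : PowerSeries ℂ) :
    (1 + X ^ k * q)⁻¹ * (1 + X ^ k * q) = 1 :=
  PowerSeries.inv_mul_cancel _ (by rw [constantCoeff_one_add_X_pow_mul hk]; exact one_ne_zero)

/-- The first-order parts of U⁻ᵏ and Uⁿ add up to (n - k) X^k q, which vanishes exactly in the
resonance n = k. -/
theorem fatouDiff_X_pow_expansion (hk : 0 < k) (q : PowerSeries ℂ) (n : ℕ) :
    ∃ r, fatouDiff k (1 + X ^ k * q) (X ^ n)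
      = X ^ (n + k) * (C ((n : ℂ) - k) * q + X ^ k * r) := by
  obtain ⟨r, hr⟩ := inv_pow_expansion (inv_mul_one_add_X_pow_mul hk q) k
  obtain ⟨r', hr'⟩ := one_add_pow_expansion (X ^ k * q) n
  refine ⟨q ^ 2 * (C ((k : ℂ) * (k + 1) / 2) + X ^ k * q * r
    - C (k : ℂ) * C (n : ℂ) + (C ((k : ℂ) * (k + 1) / 2) + X ^ k * q * r) * C (n : ℂ) * X ^ k * q
    + r' * (1 - C (k : ℂ) * (X ^ k * q) + C ((k : ℂ) * (k + 1) / 2) * (X ^ k * q) ^ 2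
      + (X ^ k * q) ^ 3 * r)), ?_⟩
  rw [fatouDiff_X_pow, hr, hr', map_sub]
  ring

theorem fatouDiff_X_pow_self (hk : 0 < k) (q : PowerSeries ℂ) :
    fatouDiff k (1 + X ^ k * q) (X ^ k) = 0 := by
  rw [fatouDiff_X_pow, ← mul_pow, inv_mul_one_add_X_pow_mul hk]
  simp

/-- The linear form that vanishes on the image of `fatouDiff`. -/
def residueForm (k : ℕ) (q P : PowerSeries ℂ) : ℂ :=
  coeff (2 * k) (P * (q⁻¹ + C (((k : ℂ) + 1) / 2) * X ^ k))

theorem residueForm_eq_zero_of_mem {P : PowerSeries ℂ} (hP : P ∈ ordIdeal Unit (2 * k + 1)) :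
    residueForm k q P = 0 :=
  mem_ordIdeal_unit_iff_coeff.1 (Ideal.mul_mem_right _ _ hP) _ (Nat.lt_succ_self _)

theorem residueForm_add (P Q : PowerSeries ℂ) :
    residueForm k q (P + Q) = residueForm k q P + residueForm k q Q := by
  simp [residueForm, add_mul]

theorem residueForm_C_mul (c : ℂ) (P : PowerSeries ℂ) :
    residueForm k q (C c * P) = c * residueForm k q P := by
  rw [residueForm, mul_assoc, coeff_C_mul, residueForm]

/-- For n ≥ 1, multiplication by the weight leaves (n - k) X^(n+k) plus terms of degree above 2k;
degree 2k is hit only for n = k, where the factor is zero. For n = 0 the quadratic term of U⁻ᵏ also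
reaches degree 2k, and the summand (k+1)/2 · X^k of the weight is there to cancel it. -/
theorem residueForm_fatouDiff_X_pow (hk : 0 < k) (hq : constantCoeff q ≠ 0) (n : ℕ) :
    residueForm k q (fatouDiff k (1 + X ^ k * q) (X ^ n)) = 0 := by
  have hqq : q * q⁻¹ = 1 := PowerSeries.mul_inv_cancel _ hq
  rcases Nat.eq_zero_or_pos n with rfl | hn
  · obtain ⟨r, hr⟩ := inv_pow_expansion (inv_mul_one_add_X_pow_mul hk q) k
    have hC : (C ((k : ℂ) * (k + 1) / 2) : PowerSeries ℂ) = C (k : ℂ) * C (((k : ℂ) + 1) / 2) := by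
      rw [← map_mul]; congr 1; ring
    have : fatouDiff k (1 + X ^ k * q) (X ^ 0) * (q⁻¹ + C (((k : ℂ) + 1) / 2) * X ^ k)
        = C (-(k : ℂ)) * X ^ k + X ^ (3 * k) * (q ^ 2 *
          (C ((k : ℂ) * (k + 1) / 2) * C (((k : ℂ) + 1) / 2) + q * r *
            (q⁻¹ + C (((k : ℂ) + 1) / 2) * X ^ k))) := by
      rw [fatouDiff_X_pow, hr, map_neg, hC]
      linear_combination (- C (k : ℂ) * X ^ k
        + C (k : ℂ) * C (((k : ℂ) + 1) / 2) * X ^ k * X ^ k * q) * hqq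
    rw [residueForm, this, map_add, coeff_C_mul, coeff_X_pow, if_neg (by omega),
      coeff_X_pow_mul', if_neg (by omega)]
    simp
  · obtain ⟨r, hr⟩ := fatouDiff_X_pow_expansion hk q n
    have : fatouDiff k (1 + X ^ k * q) (X ^ n) * (q⁻¹ + C (((k : ℂ) + 1) / 2) * X ^ k)
        = C ((n : ℂ) - k) * X ^ (n + k) + X ^ (n + 2 * k) * (r * q⁻¹ +
          C (((k : ℂ) + 1) / 2) * (C ((n : ℂ) - k) * q + X ^ k * r)) := by
      rw [hr]
      linear_combination (X ^ (n + k) * C ((n : ℂ) - k)) * hqq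
    rw [residueForm, this, map_add, coeff_C_mul, coeff_X_pow, coeff_X_pow_mul',
      if_neg (by omega : ¬ n + 2 * k ≤ 2 * k)]
    split_ifs with h
    · have : n = k := by omega
      simp [this]
    · simp

theorem residueForm_fatouDiff (hk : 0 < k) (hq : constantCoeff q ≠ 0) (h : PowerSeries ℂ) :
    residueForm k q (fatouDiff k (1 + X ^ k * q) h) = 0 := by
  have h1 := residueForm_eq_zero_of_mem (q := q)
    (fatouDiff_sub_sum_mem (k := k) (U := 1 + X ^ k * q) h (2 * k + 1))
  have hsum : ∀ A : Finset ℕ, residueForm k q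
      (∑ i ∈ A, C (coeff i h) * fatouDiff k (1 + X ^ k * q) (X ^ i)) = 0 := by
    intro A
    induction A using Finset.induction_on with
    | empty => simp [residueForm]
    | insert i A hi ih =>
      rw [Finset.sum_insert hi, residueForm_add, ih, residueForm_C_mul,
        residueForm_fatouDiff_X_pow hk hq]
      simp
  have h2 := residueForm_add (k := k) (q := q) (fatouDiff k (1 + X ^ k * q) h
    - ∑ i ∈ Finset.range (2 * k + 1), C (coeff i h) * fatouDiff k (1 + X ^ k * q) (X ^ i))
    (∑ i ∈ Finset.range (2 * k + 1), C (coeff i h) * fatouDiff k (1 + X ^ k * q) (X ^ i))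
  rw [sub_add_cancel, h1, hsum, add_zero] at h2
  exact h2

theorem coeff_fatouDiff (hk : 0 < k) (h : PowerSeries ℂ) (n : ℕ) :
    coeff (n + k) (fatouDiff k (1 + X ^ k * q) h)
      = ∑ i ∈ Finset.range (n + 1),
        coeff i h * coeff (n + k) (fatouDiff k (1 + X ^ k * q) (X ^ i)) := by
  have h1 := mem_ordIdeal_unit_iff_coeff.1
    (fatouDiff_sub_sum_mem (k := k) (U := 1 + X ^ k * q) h (n + k + 1)) (n + k) (Nat.lt_succ_self _)
  rw [map_sub, sub_eq_zero, map_sum] at h1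
  simp only [coeff_C_mul] at h1
  rw [h1]
  symm
  refine Finset.sum_subset (Finset.range_mono (by omega)) fun i hi hi' => ?_
  obtain ⟨r, hr⟩ := fatouDiff_X_pow_expansion hk q i
  rw [hr, coeff_X_pow_mul', if_neg (by simp at hi'; omega), mul_zero]

theorem coeff_fatouDiff_X_pow (hk : 0 < k) (n : ℕ) :
    coeff (n + k) (fatouDiff k (1 + X ^ k * q) (X ^ n)) = ((n : ℂ) - k) * constantCoeff q := by
  obtain ⟨r, hr⟩ := fatouDiff_X_pow_expansion hk q n
  rw [hr, coeff_X_pow_mul', if_pos le_rfl, Nat.sub_self]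
  simp [hk.ne']

theorem coeff_fatouDiff_of_lt (hk : 0 < k) (h : PowerSeries ℂ) {m : ℕ} (hm : m < k) :
    coeff m (fatouDiff k (1 + X ^ k * q) h) = 0 := by
  have h1 := mem_ordIdeal_unit_iff_coeff.1
    (fatouDiff_sub_sum_mem (k := k) (U := 1 + X ^ k * q) h (m + 1)) m (Nat.lt_succ_self _)
  rw [map_sub, sub_eq_zero, map_sum] at h1
  rw [h1]
  refine Finset.sum_eq_zero fun i _ => ?_
  obtain ⟨r, hr⟩ := fatouDiff_X_pow_expansion hk q i
  rw [coeff_C_mul, hr, coeff_X_pow_mul', if_neg (by omega), mul_zero]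

theorem fatouDiff_mem (hk : 0 < k) {h : PowerSeries ℂ} {n : ℕ} (hh : h ∈ ordIdeal Unit n) :
    fatouDiff k (1 + X ^ k * q) h ∈ ordIdeal Unit (n + k) := by
  rw [mem_ordIdeal_unit_iff_coeff] at hh ⊢
  intro m hm
  rcases lt_or_ge m k with h1 | h1
  · exact coeff_fatouDiff_of_lt hk h h1
  · obtain ⟨j, rfl⟩ := Nat.exists_eq_add_of_le' h1
    rw [coeff_fatouDiff hk]
    refine Finset.sum_eq_zero fun i hi => ?_
    rw [hh i (by simp at hi; omega), zero_mul]

/-- Finite systems are solved row by row. Their solutions are unique on the rows they cover, hence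
compatible, and the infinite solution is taken diagonally from them. -/
theorem exists_triangular_solution (c : ℕ → ℕ → ℂ) (hc : ∀ n, c n n ≠ 0) (P : ℕ → ℂ) :
    ∃ x : ℕ → ℂ, ∀ n, ∑ i ∈ Finset.range (n + 1), x i * c n i = P n := by
  have key : ∀ N : ℕ, ∃ x : ℕ → ℂ, (∀ n < N, ∑ i ∈ Finset.range (n + 1), x i * c n i = P n) := by
    intro N
    induction N with
    | zero => exact ⟨0, by simp⟩
    | succ N ih =>
      obtain ⟨x, hx⟩ := ih
      refine ⟨Function.update x N ((P N - ∑ i ∈ Finset.range N, x i * c N i) / c N N), ?_⟩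
      have hu : ∀ n ≤ N, ∀ m, ∑ i ∈ Finset.range n,
          Function.update x N ((P N - ∑ i ∈ Finset.range N, x i * c N i) / c N N) i * c m i
          = ∑ i ∈ Finset.range n, x i * c m i := by
        intro n hn m
        refine Finset.sum_congr rfl fun i hi => ?_
        rw [Function.update_of_ne]
        have := Finset.mem_range.1 hi
        omega
      intro n hn
      rcases Nat.lt_succ_iff_lt_or_eq.1 hn with h | rfl
      · rw [hu _ (by omega), hx n h]
      · rw [Finset.sum_range_succ, hu _ le_rfl, Function.update_self, div_mul_cancel₀ _ (hc n)]
        ring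
  have uniq : ∀ x y : ℕ → ℂ, ∀ N : ℕ, (∀ n < N, ∑ i ∈ Finset.range (n + 1), x i * c n i = P n) →
      (∀ n < N, ∑ i ∈ Finset.range (n + 1), y i * c n i = P n) → ∀ n < N, x n = y n := by
    intro x y N hx hy n
    induction n using Nat.strong_induction_on with
    | _ n ih =>
      intro hn
      have h1 := hx n hn
      rw [← hy n hn, Finset.sum_range_succ, Finset.sum_range_succ,
        Finset.sum_congr rfl fun i hi => by
          rw [ih i (Finset.mem_range.1 hi) ((Finset.mem_range.1 hi).trans hn)]] at h1
      exact mul_right_cancel₀ (hc n) (add_left_cancel h1)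
  choose x hx using key
  refine ⟨fun n => x (n + 1) n, fun n => ?_⟩
  rw [← hx (n + 1) n (Nat.lt_succ_self n)]
  refine Finset.sum_congr rfl fun i hi => ?_
  congr 1
  have hi' := Finset.mem_range.1 hi
  exact uniq _ _ (i + 1) (hx (i + 1)) (fun m hm => hx (n + 1) m (by omega)) i (Nat.lt_succ_self i)

/-- All rows of the triangular system but the resonant one can be solved, leaving a discrepancy c
X^(2k). Its `residueForm` is c / q(0), and it vanishes because that of P and that of every
`fatouDiff` do; hence c = 0. -/
theorem exists_fatouDiff_eq (hk : 0 < k) (hq : constantCoeff q ≠ 0) {P : PowerSeries ℂ}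
    (hP : P ∈ ordIdeal Unit k) (hres : residueForm k q P = 0) :
    ∃ h, fatouDiff k (1 + X ^ k * q) h = P := by
  obtain ⟨x, hx⟩ := exists_triangular_solution
    -- The resonant row is replaced by a dummy equation for the k-th unknown. Any value would serve,
    -- since `fatouDiff` kills X^k.
    (fun n i => if n = k then (if i = k then 1 else 0) else
      coeff (n + k) (fatouDiff k (1 + X ^ k * q) (X ^ i)))
    (fun n => by
      by_cases hn : n = k
      · simp [hn]
      · simp only [hn, if_false]
        rw [coeff_fatouDiff_X_pow hk]
        exact mul_ne_zero (sub_ne_zero.2 (by exact_mod_cast hn)) hq)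
    (fun n => coeff (n + k) P)
  set h : PowerSeries ℂ := PowerSeries.mk x with hh
  have hne : ∀ m, m ≠ 2 * k → coeff m (P - fatouDiff k (1 + X ^ k * q) h) = 0 := by
    intro m hm
    rw [map_sub, sub_eq_zero]
    rcases lt_or_ge m k with h1 | h1
    · rw [coeff_fatouDiff_of_lt hk h h1, mem_ordIdeal_unit_iff_coeff.1 hP m h1]
    · obtain ⟨n, rfl⟩ := Nat.exists_eq_add_of_le' h1
      have hn : n ≠ k := by omega
      have := hx n
      simp only [hn, if_false] at this
      rw [coeff_fatouDiff hk, ← this]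
      simp [hh]
  have hE : P - fatouDiff k (1 + X ^ k * q) h
      = C (coeff (2 * k) (P - fatouDiff k (1 + X ^ k * q) h)) * X ^ (2 * k) := by
    ext m
    rw [coeff_C_mul, coeff_X_pow]
    split_ifs with hm
    · simp [hm]
    · rw [hne m hm, mul_zero]
  set c := coeff (2 * k) (P - fatouDiff k (1 + X ^ k * q) h) with hc
  have hr : residueForm k q (P - fatouDiff k (1 + X ^ k * q) h) = 0 := by
    have := residueForm_add (k := k) (q := q) (P - fatouDiff k (1 + X ^ k * q) h)
      (fatouDiff k (1 + X ^ k * q) h)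
    rw [sub_add_cancel, hres, residueForm_fatouDiff hk hq, add_zero] at this
    exact this.symm
  rw [hE, residueForm_C_mul, residueForm, coeff_X_pow_mul', if_pos le_rfl, Nat.sub_self] at hr
  have hc0 : c = 0 := by
    rcases mul_eq_zero.1 hr with h | h
    · exact h
    · simp [hk.ne', hq] at h
  rw [hc0, map_zero, zero_mul, sub_eq_zero] at hE
  exact ⟨h, hE.symm⟩

theorem logOf_one_add_sub_mem {n : ℕ} (hn : 0 < n) (q : PowerSeries ℂ) :
    logOf (1 + X ^ n * q) - X ^ n * q ∈ ordIdeal Unit (2 * n) := by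
  have hc : MvPowerSeries.constantCoeff (X ^ n * q : PowerSeries ℂ) = 0 := by
    change constantCoeff (X ^ n * q : PowerSeries ℂ) = 0
    simp [hn.ne']
  have he : (X ^ n * q : PowerSeries ℂ) ∈ ordIdeal Unit n :=
    Ideal.mul_mem_right _ _ (mem_ordIdeal_unit_iff_dvd.2 dvd_rfl)
  have hs := PowerSeries.HasSubst.of_constantCoeff_zero hc
  have hlog : PowerSeries.log ℂ - X = X ^ 2 * PowerSeries.mk fun i => coeff (i + 2) (log ℂ) := by
    ext i
    rcases i with _ | _ | i
    · simp
    · rw [coeff_X_pow_mul', if_neg (by omega)]; simp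
    · rw [coeff_X_pow_mul', if_pos (by omega)]; simp [coeff_X, add_assoc, one_add_one_eq_two]
  have h2 : logOf (1 + X ^ n * q) - X ^ n * q
      = (PowerSeries.subst (X ^ n * q) (PowerSeries.log ℂ - X) : PowerSeries ℂ) := by
    rw [PowerSeries.subst_sub hs, PowerSeries.subst_X hs, logOf_eq, add_sub_cancel_left]
  rw [h2, hlog, PowerSeries.subst_mul hs, PowerSeries.subst_pow hs, PowerSeries.subst_X hs]
  refine Ideal.mul_mem_right _ _ ?_
  have := mul_mem_ordIdeal he he
  rw [← two_mul] at this
  rwa [pow_two]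

/-- `residueForm` takes the value ρ at X^k, and the value 1 at X^k log U because log U = X^k q
modulo X^(2k). So X^k - ρ X^k log U satisfies the solvability condition, precisely for this
coefficient of the logarithm. -/
theorem exists_formalFatou_series (hk : 0 < k) (hq : constantCoeff q ≠ 0) :
    ∃ h, fatouDiff k (1 + X ^ k * q) h
      + C (coeff k q⁻¹ + ((k : ℂ) + 1) / 2) * X ^ k * logOf (1 + X ^ k * q) = X ^ k := by
  set ρ := coeff k q⁻¹ + ((k : ℂ) + 1) / 2 with hρ
  have hres : residueForm k q (X ^ k + C (-ρ) * (X ^ k * logOf (1 + X ^ k * q))) = 0 := by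
    have h1 : residueForm k q (X ^ k) = ρ := by
      rw [residueForm, coeff_X_pow_mul', if_pos (by omega), two_mul, Nat.add_sub_cancel, map_add,
        coeff_C_mul, coeff_X_pow]
      simp [hρ]
    have hl := logOf_one_add_sub_mem hk q
    have hl' : X ^ k * (logOf (1 + X ^ k * q) - X ^ k * q) ∈ ordIdeal Unit (2 * k + 1) :=
      ordIdeal_anti (by omega) (mul_mem_ordIdeal
        (mem_ordIdeal_unit_iff_dvd.2 (dvd_refl (X ^ k : PowerSeries ℂ))) hl)
    have h2 := residueForm_eq_zero_of_mem (q := q) hl'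
    have h3 : residueForm k q (X ^ k * (X ^ k * q)) = 1 := by
      have : X ^ k * (X ^ k * q) * (q⁻¹ + C (((k : ℂ) + 1) / 2) * X ^ k)
          = X ^ (2 * k) * (1 + X ^ k * (C (((k : ℂ) + 1) / 2) * q)) := by
        linear_combination (X ^ k * X ^ k) * PowerSeries.mul_inv_cancel _ hq
      rw [residueForm, this, coeff_X_pow_mul', if_pos le_rfl, Nat.sub_self]
      simp [hk.ne']
    have h4 := residueForm_add (k := k) (q := q) (X ^ k * (logOf (1 + X ^ k * q) - X ^ k * q))
      (X ^ k * (X ^ k * q))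
    rw [← mul_add, sub_add_cancel, h2, h3, zero_add] at h4
    rw [residueForm_add, residueForm_C_mul, h1, h4]
    ring
  obtain ⟨h, hh⟩ := exists_fatouDiff_eq hk hq
    (Ideal.add_mem _ (mem_ordIdeal_unit_iff_dvd.2 dvd_rfl) (Ideal.mul_mem_left _ _
      (Ideal.mul_mem_right _ _ (mem_ordIdeal_unit_iff_dvd.2 dvd_rfl)))) hres
  refine ⟨h, ?_⟩
  rw [hh, map_neg]
  ring

end FormalFatou

/-! ### Expansions of functions of one variable -/

section OneVariable

/-- The function `s` of one complex variable has the expansion `P` at the origin up to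
`O(x ^ n)`. -/
abbrev HasExpAtZero (n : ℕ) (s : ℂ → ℂ) (P : PowerSeries ℂ) : Prop :=
  HasExp (σ := Unit) (𝓝[≠] (0 : ℂ)) (fun _ x => x) (fun x => ‖x‖) n s P

theorem isGauge_unit : IsGauge (σ := Unit) (𝓝[≠] (0 : ℂ)) (fun _ x => x) (fun x => ‖x‖) where
  isBigO _ := (isBigO_refl _ _).norm_right
  tendsto := (tendsto_norm_zero (E := ℂ)).mono_left nhdsWithin_le_nhds

variable {n : ℕ} {s : ℂ → ℂ} {P Q : PowerSeries ℂ}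

theorem hasExpAtZero_id : HasExpAtZero n (fun x => x) PowerSeries.X := hasExp_X ()

theorem hasExpAtZero_sum (P : PowerSeries ℂ) (n : ℕ) :
    HasExpAtZero n (fun x => ∑ i ∈ Finset.range n, PowerSeries.coeff i P * x ^ i) P := by
  have h : HasExpAtZero n (fun x => ∑ i ∈ Finset.range n, PowerSeries.coeff i P * x ^ i)
      (∑ i ∈ Finset.range n, PowerSeries.C (PowerSeries.coeff i P) * PowerSeries.X ^ i) :=
    HasExp.sum fun i _ => (hasExpAtZero_id.pow isGauge_unit i).const_mul isGauge_unit _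
  refine h.congr (by simpa using isBigO_zero _ _) ?_
  rw [← neg_sub]
  refine (Ideal.neg_mem_iff _).2 ?_
  have := subst_sub_sum_mem (P := (PowerSeries.X : PowerSeries ℂ))
    (MvPowerSeries.constantCoeff_X _) P n
  rwa [PowerSeries.X_subst] at this

theorem hasExpAtZero_of_isBigO
    (h : (fun x => s x - ∑ i ∈ Finset.range n, PowerSeries.coeff i P * x ^ i)
      =O[𝓝[≠] 0] fun x => x ^ n) : HasExpAtZero n s P :=
  (hasExpAtZero_sum P n).congr (by simpa using h.norm_right) (by simp)

theorem HasExpAtZero.isBigO (h : HasExpAtZero n s P) (hP : P ∈ ordIdeal Unit n) :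
    s =O[𝓝[≠] 0] fun x => x ^ n := by
  have := HasExp.isBigO_of_mem isGauge_unit h hP
  simpa [← norm_pow] using this

/-- By induction on the degree: once the lower coefficients vanish, c x^i = O(x^(i+1)), which forces
c = 0. -/
theorem HasExpAtZero.mem_of_isBigO (h : HasExpAtZero n s P) (hs : s =O[𝓝[≠] 0] fun x => x ^ n) :
    P ∈ ordIdeal Unit n := by
  rw [mem_ordIdeal_unit_iff_coeff]
  intro i
  induction i using Nat.strong_induction_on with
  | _ i ih =>
    intro hi
    set c := PowerSeries.coeff i P with hc
    have h1 : HasExpAtZero (i + 1) s P := HasExp.mono isGauge_unit h hi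
    have h2 : HasExpAtZero (i + 1) (fun x => c * x ^ i)
        (PowerSeries.C c * PowerSeries.X ^ i) :=
      (hasExpAtZero_id.pow isGauge_unit i).const_mul isGauge_unit c
    have h3 := HasExpAtZero.isBigO (HasExp.sub isGauge_unit h1 h2) (by
      rw [mem_ordIdeal_unit_iff_coeff]
      intro j hj
      change PowerSeries.coeff j (P - PowerSeries.C c * PowerSeries.X ^ i) = 0
      rw [map_sub, PowerSeries.coeff_C_mul, PowerSeries.coeff_X_pow]
      split_ifs with hji
      · rw [hji, hc]; ring
      · rw [ih j (by omega) (by omega)]; ring)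
    have h4 : (fun x : ℂ => x ^ n) =O[𝓝[≠] 0] fun x => x ^ (i + 1) := by
      have := isGauge_unit.isBigO_pow_of_le hi
      simpa [← norm_pow] using this
    have h5 := (hs.trans h4).sub h3
    simp only [sub_sub_cancel] at h5
    by_contra hne
    have h6 : (fun _ : ℂ => (1 : ℂ)) =O[𝓝[≠] 0] fun x : ℂ => x := by
      have h7 := h5.mul (isBigO_refl (fun x : ℂ => (c * x ^ i)⁻¹) (𝓝[≠] 0))
      have h8 : (fun x : ℂ => x ^ (i + 1) * (c * x ^ i)⁻¹) =ᶠ[𝓝[≠] 0] fun x => c⁻¹ * x := by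
        filter_upwards [self_mem_nhdsWithin] with x hx
        have hx : x ≠ 0 := hx
        field_simp
        ring
      have h9 : (fun x : ℂ => c * x ^ i * (c * x ^ i)⁻¹) =ᶠ[𝓝[≠] 0] fun x => 1 := by
        filter_upwards [self_mem_nhdsWithin] with x hx
        exact mul_inv_cancel₀ (mul_ne_zero hne (pow_ne_zero _ hx))
      exact (h7.congr' h9 h8).trans (isBigO_const_mul_self _ _ _)
    have h7 := h6.trans_tendsto (tendsto_id.mono_left nhdsWithin_le_nhds)
    exact one_ne_zero (tendsto_nhds_unique tendsto_const_nhds h7)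

theorem HasExpAtZero.unique (h : ∀ n, HasExpAtZero n s P) (h' : ∀ n, HasExpAtZero n s Q) :
    P = Q := by
  rw [← sub_eq_zero]
  refine eq_zero_of_forall_mem_ordIdeal (σ := Unit) fun n => ?_
  refine HasExpAtZero.mem_of_isBigO (HasExp.sub isGauge_unit (h n) (h' n)) ?_
  simpa using isBigO_zero _ _

theorem hasExpAtZero_taylor {g : ℂ → ℂ} (hg : AnalyticAt ℂ g 0) (n : ℕ) :
    HasExpAtZero n g (taylor g) := by
  have h := hg.hasFPowerSeriesAt.isBigO_sub_partialSum_pow n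
  refine hasExpAtZero_of_isBigO ?_
  have h2 := h.mono (nhdsWithin_le_nhds (s := {0}ᶜ))
  simp only [← norm_pow] at h2
  refine (h2.of_norm_right).congr_left fun x => ?_
  simp [FormalMultilinearSeries.partialSum, taylor, mul_comm]

theorem hasExpAtZero_log (n : ℕ) :
    (fun x => Complex.log (1 + x) - ∑ i ∈ Finset.range n,
      PowerSeries.coeff i (PowerSeries.log ℂ) * x ^ i) =O[𝓝 0] fun x => x ^ n := by
  rcases n with _ | n
  · have : ContinuousAt (fun x : ℂ => Complex.log (1 + x)) 0 := by
      refine ContinuousAt.clog (by fun_prop) ?_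
      simp
    simpa using this.tendsto.isBigO_one ℂ
  · refine (Complex.log_sub_logTaylor_isBigO n).congr_left fun x => ?_
    congr 1
    rw [Complex.logTaylor]
    refine Finset.sum_congr rfl fun i _ => ?_
    rw [PowerSeries.coeff_log]
    split_ifs with hi
    · simp [hi]
    · simp
      ring

/-- Each further order of vanishing makes the current quotient vanish at 0, and passing to its slope
function divides out one more factor x. -/
theorem AnalyticAt.exists_eq_pow_mul {g : ℂ → ℂ} (hg : AnalyticAt ℂ g 0) (n : ℕ)
    (h : g =O[𝓝 0] fun x => x ^ n) :
    ∃ q : ℂ → ℂ, AnalyticAt ℂ q 0 ∧ ∀ᶠ x in 𝓝 0, g x = x ^ n * q x := by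
  induction n with
  | zero => exact ⟨g, hg, by simp⟩
  | succ n ih =>
    obtain ⟨q, hq, he⟩ := ih (h.trans (by
      simpa [pow_succ] using (isBigO_refl (fun x : ℂ => x ^ n) (𝓝 0)).mul
        ((continuous_id.tendsto (0 : ℂ)).isBigO_one ℂ)))
    have hq0 : q 0 = 0 := by
      have h1 : q =O[𝓝[≠] 0] fun x => x := by
        have h2 := (h.mono (nhdsWithin_le_nhds (s := {0}ᶜ))).mul
          (isBigO_refl (fun x : ℂ => (x ^ n)⁻¹) _)
        refine h2.congr' ?_ ?_
        · filter_upwards [self_mem_nhdsWithin, nhdsWithin_le_nhds he] with x hx hx'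
          have : x ^ n ≠ 0 := pow_ne_zero _ hx
          rw [hx']
          field_simp
        · filter_upwards [self_mem_nhdsWithin] with x hx
          have : x ≠ 0 := hx
          field_simp
          ring
      have h3 := h1.trans_tendsto (tendsto_id.mono_left nhdsWithin_le_nhds)
      exact tendsto_nhds_unique (hq.continuousAt.tendsto.mono_left nhdsWithin_le_nhds) h3
    refine ⟨dslope q 0, ?_, ?_⟩
    · obtain ⟨p, hp⟩ := hq
      exact ⟨_, hp.has_fpower_series_dslope_fslope⟩
    · filter_upwards [he] with x hx
      have := sub_smul_dslope q 0 x
      rw [hq0, sub_zero, sub_zero, smul_eq_mul] at this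
      rw [hx, ← this]
      ring

end OneVariable

/-! ### Parabolic germs f = x (1 + x^k q) and the error in the Abel equation -/

section Germ

variable {f : ℂ → ℂ} {k : ℕ} {a : ℂ}

theorem IsParabolicGerm.exists_eq (hf : IsParabolicGerm f k a) :
    ∃ q : ℂ → ℂ, AnalyticAt ℂ q 0 ∧ q 0 = a ∧ ∀ᶠ x in 𝓝 0, f x = x * (1 + x ^ k * q x) := by
  obtain ⟨q, hq, he⟩ := AnalyticAt.exists_eq_pow_mul (n := k + 2)
    (g := fun x => f x - x - a * x ^ (k + 1)) ((hf.analyticAt.sub analyticAt_id).sub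
      (analyticAt_const.mul (analyticAt_id.pow _))) hf.expansion
  refine ⟨fun x => a + x * q x, analyticAt_const.add (analyticAt_id.mul hq), by simp, ?_⟩
  filter_upwards [he] with x hx
  linear_combination hx

variable {q : ℂ → ℂ}

/-- Both series are expansions of f at 0 to all orders, and such an expansion is unique; no
derivative has to be computed. -/
theorem taylor_eq (hf : AnalyticAt ℂ f 0) (hq : AnalyticAt ℂ q 0)
    (he : ∀ᶠ x in 𝓝 0, f x = x * (1 + x ^ k * q x)) :
    taylor f = PowerSeries.X * (1 + PowerSeries.X ^ k * taylor q) := by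
  refine HasExpAtZero.unique (s := f) (fun n => hasExpAtZero_taylor hf n) fun n => ?_
  have h1 : HasExpAtZero n (fun x => x * (1 + x ^ k * q x))
      (PowerSeries.X * (1 + PowerSeries.X ^ k * taylor q)) := by
    refine HasExp.mul isGauge_unit hasExpAtZero_id ?_
    refine HasExp.add (by simpa using hasExp_const (σ := Unit) (1 : ℂ)) ?_
    exact (hasExpAtZero_id.pow isGauge_unit k).mul isGauge_unit (hasExpAtZero_taylor hq n)
  refine HasExp.congr_eventuallyEq h1 ?_
  filter_upwards [nhdsWithin_le_nhds he] with x hx using hx.symm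

theorem taylorDivX_eq (hf : AnalyticAt ℂ f 0) (hq : AnalyticAt ℂ q 0)
    (he : ∀ᶠ x in 𝓝 0, f x = x * (1 + x ^ k * q x)) :
    taylorDivX f = 1 + PowerSeries.X ^ k * taylor q := by
  ext n
  rw [taylorDivX, PowerSeries.coeff_mk, taylor_eq hf hq he, PowerSeries.coeff_succ_X_mul]

theorem residualInvariant_eq (hf : AnalyticAt ℂ f 0) (hq : AnalyticAt ℂ q 0)
    (he : ∀ᶠ x in 𝓝 0, f x = x * (1 + x ^ k * q x)) :
    residualInvariant f k = PowerSeries.coeff k (taylor q)⁻¹ + ((k : ℂ) + 1) / 2 := by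
  have : (PowerSeries.mk fun n => PowerSeries.coeff (n + k + 1) (taylor f - PowerSeries.X))
      = taylor q := by
    ext n
    rw [PowerSeries.coeff_mk, taylor_eq hf hq he]
    have : (PowerSeries.X * (1 + PowerSeries.X ^ k * taylor q) - PowerSeries.X : PowerSeries ℂ)
        = PowerSeries.X ^ (k + 1) * taylor q := by ring
    rw [this, PowerSeries.coeff_X_pow_mul', if_pos (by omega)]
    congr 2
    omega
  rw [residualInvariant, this]

theorem constantCoeff_taylor (q : ℂ → ℂ) : PowerSeries.constantCoeff (taylor q) = q 0 := by
  rw [← PowerSeries.coeff_zero_eq_constantCoeff_apply]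
  simp [taylor]

theorem isFormalFatou_iff (hf : AnalyticAt ℂ f 0) (hq : AnalyticAt ℂ q 0)
    (he : ∀ᶠ x in 𝓝 0, f x = x * (1 + x ^ k * q x)) (h : PowerSeries ℂ) :
    IsFormalFatou f k h ↔ fatouDiff k (1 + PowerSeries.X ^ k * taylor q) h
      + PowerSeries.C (residualInvariant f k) * PowerSeries.X ^ k
        * PowerSeries.logOf (1 + PowerSeries.X ^ k * taylor q) = PowerSeries.X ^ k := by
  rw [IsFormalFatou, taylorDivX_eq hf hq he, taylor_eq hf hq he, fatouDiff]
  constructor <;> intro h <;> linear_combination h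

theorem IsParabolicGerm.exists_isFormalFatou (hf : IsParabolicGerm f k a) :
    ∃ h, IsFormalFatou f k h := by
  obtain ⟨q, hq, hq0, he⟩ := hf.exists_eq
  obtain ⟨h, hh⟩ := exists_formalFatou_series (q := taylor q) hf.pos
    (by rw [constantCoeff_taylor, hq0]; exact hf.ne_zero)
  refine ⟨h, (isFormalFatou_iff hf.analyticAt hq he h).2 ?_⟩
  rw [residualInvariant_eq hf.analyticAt hq he, hh]

theorem IsFormalFatou.add_C_mul_X_pow (hf : IsParabolicGerm f k a) {h : PowerSeries ℂ}
    (hh : IsFormalFatou f k h) (c : ℂ) :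
    IsFormalFatou f k (h + PowerSeries.C c * PowerSeries.X ^ k) := by
  obtain ⟨q, hq, hq0, he⟩ := hf.exists_eq
  rw [isFormalFatou_iff hf.analyticAt hq he] at hh ⊢
  rw [fatouDiff_add, fatouDiff_C_mul, fatouDiff_X_pow_self hf.pos, mul_zero, add_zero, hh]

/-- The error in the Abel equation of a truncation of the formal Fatou coordinate. -/
def abelError (f : ℂ → ℂ) (k : ℕ) (ρ : ℂ) (h : PowerSeries ℂ) (n : ℕ) (x : ℂ) : ℂ :=
  ∑ i ∈ Finset.range n, PowerSeries.coeff i h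
    * (f x ^ ((i : ℤ) - (k : ℤ)) - x ^ ((i : ℤ) - (k : ℤ))) + ρ * Complex.log (f x / x) - 1

/-- Multiplied by x^k, the error has as its expansion the formal Abel equation with h truncated. It
fails only by `fatouDiff` of the tail of h; the tail has order k + N, so by `fatouDiff_mem` the
failure has order 2k + N. Dividing by x^k costs k orders, hence the working precision M = 2k + N. -/
theorem IsFormalFatou.abelError_isBigO (hf : IsParabolicGerm f k a) {h : PowerSeries ℂ}
    (hh : IsFormalFatou f k h) (N : ℕ) :
    abelError f k (residualInvariant f k) h (k + N) =O[𝓝[≠] 0] fun x => x ^ (k + N) := by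
  obtain ⟨q, hq, hq0, he⟩ := hf.exists_eq
  rw [isFormalFatou_iff hf.analyticAt hq he] at hh
  set ρ := residualInvariant f k
  set U : PowerSeries ℂ := 1 + PowerSeries.X ^ k * taylor q with hU
  set M := 2 * k + N with hM
  have hk := hf.pos
  have hE : HasExpAtZero M (fun x => x ^ k * q x) (PowerSeries.X ^ k * taylor q) :=
    (hasExpAtZero_id.pow isGauge_unit k).mul isGauge_unit (hasExpAtZero_taylor hq _)
  have hone : HasExpAtZero M (fun _ => 1) 1 := by simpa using hasExp_const (σ := Unit) (1 : ℂ)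
  have hUe : HasExpAtZero M (fun x => 1 + x ^ k * q x) U := HasExp.add hone hE
  have hinv : HasExpAtZero M (fun x => (1 + x ^ k * q x)⁻¹) U⁻¹ :=
    HasExp.inv isGauge_unit hUe (by omega) (by
      change PowerSeries.constantCoeff U ≠ 0
      rw [hU, constantCoeff_one_add_X_pow_mul hk]; exact one_ne_zero)
  have hlog : HasExpAtZero M (fun x => Complex.log (1 + x ^ k * q x)) (PowerSeries.logOf U) := by
    rw [PowerSeries.logOf_eq, hU, add_sub_cancel_left]
    refine HasExp.subst isGauge_unit hE ?_ (by omega) (hasExpAtZero_log M)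
    change PowerSeries.constantCoeff (PowerSeries.X ^ k * taylor q) = 0
    simp [hk.ne']
  have hF : HasExpAtZero M (fun x => ∑ i ∈ Finset.range (k + N), PowerSeries.coeff i h
        * (x ^ i * ((1 + x ^ k * q x)⁻¹ ^ k * (1 + x ^ k * q x) ^ i - 1))
        + ρ * (x ^ k * Complex.log (1 + x ^ k * q x)) - x ^ k)
      (∑ i ∈ Finset.range (k + N), PowerSeries.C (PowerSeries.coeff i h)
        * (PowerSeries.X ^ i * (U⁻¹ ^ k * U ^ i - 1))
        + PowerSeries.C ρ * (PowerSeries.X ^ k * PowerSeries.logOf U) - PowerSeries.X ^ k) := by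
    refine HasExp.sub isGauge_unit (HasExp.add (HasExp.sum fun i _ => ?_) ?_)
      (hasExpAtZero_id.pow isGauge_unit k)
    · refine HasExp.const_mul isGauge_unit ?_ _
      refine (hasExpAtZero_id.pow isGauge_unit i).mul isGauge_unit ?_
      exact HasExp.sub isGauge_unit
        ((hinv.pow isGauge_unit k).mul isGauge_unit (hUe.pow isGauge_unit i)) hone
    · exact ((hasExpAtZero_id.pow isGauge_unit k).mul isGauge_unit hlog).const_mul isGauge_unit _
  have hmem := HasExpAtZero.isBigO hF (by
    have h1 := fatouDiff_sub_sum_mem (k := k) (U := U) h (k + N)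
    have h2 : h - ∑ i ∈ Finset.range (k + N), PowerSeries.C (PowerSeries.coeff i h)
        * PowerSeries.X ^ i ∈ ordIdeal Unit (k + N) := by
      have := subst_sub_sum_mem (P := (PowerSeries.X : PowerSeries ℂ))
        (MvPowerSeries.constantCoeff_X _) h (k + N)
      rwa [PowerSeries.X_subst] at this
    have h3 := fatouDiff_mem (q := taylor q) hk h2
    rw [← hU] at h3
    set T := ∑ i ∈ Finset.range (k + N), PowerSeries.C (PowerSeries.coeff i h)
        * PowerSeries.X ^ i with hT
    have h4 : fatouDiff k U T = ∑ i ∈ Finset.range (k + N), PowerSeries.C (PowerSeries.coeff i h)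
        * (PowerSeries.X ^ i * (U⁻¹ ^ k * U ^ i - 1)) := by
      rw [hT]
      generalize Finset.range (k + N) = A
      induction A using Finset.induction_on with
      | empty => simpa using fatouDiff_C_mul (k := k) (U := U) 0 0
      | insert i A hi ih =>
        rw [Finset.sum_insert hi, Finset.sum_insert hi, fatouDiff_add, ih, fatouDiff_C_mul,
          fatouDiff_X_pow]
    rw [← h4]
    have h5 := fatouDiff_add (k := k) (U := U) (h - T) T
    rw [sub_add_cancel] at h5
    have h6 : k + N + k = M := by omega
    rw [h6] at h3
    convert (Ideal.neg_mem_iff _).2 h3 using 1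
    linear_combination hh - h5)
  have h7 := hmem.mul (isBigO_refl (fun x : ℂ => (x ^ k)⁻¹) (𝓝[≠] 0))
  have hne : ∀ᶠ x in 𝓝 (0 : ℂ), 1 + x ^ k * q x ≠ 0 := by
    have : ContinuousAt (fun x => 1 + x ^ k * q x) 0 := by
      have := hq.continuousAt
      fun_prop
    refine this.eventually_ne ?_
    simp [hk.ne']
  refine h7.congr' ?_ ?_
  · filter_upwards [self_mem_nhdsWithin, nhdsWithin_le_nhds he, nhdsWithin_le_nhds hne]
      with x hx hfx hux
    have hx : x ≠ 0 := hx
    rw [abelError, hfx, mul_div_cancel_left₀ _ hx, sub_mul, add_mul, Finset.sum_mul]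
    have hxk : x ^ k * (x ^ k)⁻¹ = 1 := mul_inv_cancel₀ (pow_ne_zero _ hx)
    congr 1
    · congr 1
      · refine Finset.sum_congr rfl fun i _ => ?_
        rw [mul_zpow, zpow_sub₀ hx, zpow_sub₀ hux]
        simp only [zpow_natCast]
        rw [div_eq_mul_inv, div_eq_mul_inv, inv_pow]
        ring
      · linear_combination (ρ * Complex.log (1 + x ^ k * q x)) * hxk
  · filter_upwards [self_mem_nhdsWithin] with x hx
    have hx : x ≠ 0 := hx
    have : M = k + (k + N) := by omega
    rw [this, pow_add x k]
    field_simp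

end Germ

/-! ### Power-log expansion of a solution of the Abel equation -/

section PowerLog

/-- The scale `m ^ (-1/k)`. -/
def rootScale (k m : ℕ) : ℂ := (((m : ℝ) ^ (-(1 : ℝ) / (k : ℝ)) : ℝ) : ℂ)

/-- The scale `m ^ (-1/k)`, `ρ (log m) / m`. -/
def powerLogScale (k : ℕ) (ρ : ℂ) (i : Fin 2) (m : ℕ) : ℂ :=
  if i = 0 then rootScale k m else ρ * ((Real.log m / m : ℝ) : ℂ)

/-- The gauge `m ^ (-1/(2k))` of the power-log scale. -/
def powerLogGauge (k m : ℕ) : ℝ := (m : ℝ) ^ (-(1 : ℝ) / (2 * k : ℝ))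

variable {k : ℕ} {ρ : ℂ}

theorem rootScale_pow_self (hk : 0 < k) {m : ℕ} : rootScale k m ^ k = (m : ℂ)⁻¹ := by
  rw [rootScale, ← Complex.ofReal_pow, ← Real.rpow_natCast, ← Real.rpow_mul (Nat.cast_nonneg m)]
  have : -(1 : ℝ) / k * k = -1 := by field_simp
  rw [this, Real.rpow_neg_one]
  simp

theorem norm_rootScale (k m : ℕ) : ‖rootScale k m‖ = (m : ℝ) ^ (-(1 : ℝ) / (k : ℝ)) := by
  rw [rootScale, Complex.norm_real, Real.norm_of_nonneg (by positivity)]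

theorem rootScale_eq_exp {m : ℕ} (hm : 0 < m) :
    rootScale k m = Complex.exp (-((Real.log m / k : ℝ) : ℂ)) := by
  rw [rootScale, Real.rpow_def_of_pos (by exact_mod_cast hm), Complex.ofReal_exp]
  congr 1
  push_cast
  ring

theorem norm_rootScale_eq_gauge_sq (k m : ℕ) : ‖rootScale k m‖ = powerLogGauge k m ^ 2 := by
  rw [norm_rootScale, powerLogGauge, ← Real.rpow_natCast, ← Real.rpow_mul (Nat.cast_nonneg m)]
  congr 1
  push_cast
  by_cases hk : (k : ℝ) = 0
  · simp [hk]
  · field_simp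

theorem tendsto_powerLogGauge (hk : 0 < k) : Tendsto (powerLogGauge k) atTop (𝓝 0) := by
  have h : (0 : ℝ) < 1 / (2 * k) := by positivity
  have := (tendsto_rpow_neg_atTop h).comp tendsto_natCast_atTop_atTop
  refine this.congr fun m => ?_
  simp [powerLogGauge, neg_div]

theorem isGauge_powerLog (hk : 0 < k) :
    IsGauge (σ := Fin 2) atTop (powerLogScale k ρ) (powerLogGauge k) where
  tendsto := tendsto_powerLogGauge hk
  isBigO i := by
    have hk' : (1 : ℝ) ≤ k := by exact_mod_cast hk
    unfold powerLogScale
    split_ifs with hi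
    · have : (fun m => rootScale k m) =O[atTop] fun m => powerLogGauge k m ^ 2 :=
        IsBigO.of_norm_left ((isBigO_refl _ _).congr_left
          fun m => (norm_rootScale_eq_gauge_sq k m).symm)
      refine this.trans ?_
      have h1 := (isBigO_refl (powerLogGauge k) atTop).mul
        ((tendsto_powerLogGauge hk).isBigO_one ℝ)
      simpa [pow_two] using h1
    · refine IsBigO.const_mul_left ?_ ρ
      refine IsBigO.of_norm_left ?_
      simp only [Complex.norm_real]
      refine IsBigO.norm_left ?_
      -- Half a power of m absorbs the logarithm, so (log m)/m = O(m^(-1/2)). The gauge exponent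
      -- 1/(2k) is at most 1/2, so the gauge dominates this scale for every k ≥ 1.
      have h1 := ((isLittleO_log_rpow_atTop (by norm_num : (0 : ℝ) < 1 / 2)).isBigO.comp_tendsto
        tendsto_natCast_atTop_atTop)
      have h2 : (fun m : ℕ => Real.log m / m) =O[atTop] fun m : ℕ => (m : ℝ) ^ (-(1 : ℝ) / 2) := by
        have h3 := h1.mul (isBigO_refl (fun m : ℕ => (m : ℝ)⁻¹) atTop)
        refine h3.congr' (Eventually.of_forall fun m => rfl) ?_
        filter_upwards [eventually_gt_atTop 0] with m hm
        have hm' : (0 : ℝ) < m := by exact_mod_cast hm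
        simp only [Function.comp]
        rw [← Real.rpow_neg_one, ← Real.rpow_add hm']
        norm_num
      refine h2.trans (IsBigO.of_bound 1 ?_)
      filter_upwards [eventually_gt_atTop 0] with m hm
      have hm' : (1 : ℝ) ≤ m := by exact_mod_cast hm
      rw [one_mul, Real.norm_of_nonneg (by positivity), powerLogGauge,
        Real.norm_of_nonneg (by positivity)]
      refine Real.rpow_le_rpow_of_exponent_le hm' ?_
      rw [neg_div, neg_div, neg_le_neg_iff]
      exact one_div_le_one_div_of_le (by norm_num) (by linarith)

/-- The part of the equation of the formal inverse that depends on the unknown, for numbers. -/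
def numericEquation (k : ℕ) (ρ : ℂ) (h : PowerSeries ℂ) (μ : ℂ) (n : ℕ) (z y : ℂ) : ℂ :=
  ∑ i ∈ Finset.range n, PowerSeries.coeff i h * z ^ i * y ^ ((i : ℤ) - (k : ℤ))
    + ρ * z ^ k * (μ + Complex.log (Complex.exp (-μ) * y))

variable {h : PowerSeries ℂ} {μ : ℂ} {Φ : MvPowerSeries (Fin 2) ℂ}

theorem hasStrictDerivAt_zpow_exp (μ : ℂ) (j : ℤ) :
    HasStrictDerivAt (fun y : ℂ => y ^ j) (j * Complex.exp μ ^ (j - 1)) (Complex.exp μ) :=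
  hasStrictDerivAt_zpow j _ (Or.inl (Complex.exp_ne_zero μ))

theorem isBigO_sub_comp_of_hasStrictDerivAt {ι : Type*} {l : Filter ι} {g : ℂ → ℂ} {g' c : ℂ}
    (hg : HasStrictDerivAt g g' c) {X Y : ι → ℂ} (hX : Tendsto X l (𝓝 c))
    (hY : Tendsto Y l (𝓝 c)) : (fun t => g (X t) - g (Y t)) =O[l] fun t => X t - Y t :=
  hg.hasStrictFDerivAt.isBigO_sub.comp_tendsto (hX.prodMk_nhds hY)

/-- As z → 0 the equation becomes h₀ y^(-k), all other terms carrying a positive power of z. Strict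
differentiability of y^(-k) at e^μ, with nonzero derivative, lets the difference of values control X
- Y; the other terms contribute o(X - Y). -/
theorem isBigO_sub_of_numericEquation {ι : Type*} {l : Filter ι} (hk : 0 < k)
    (h0 : PowerSeries.coeff 0 h ≠ 0) {n : ℕ} (hn : 0 < n) {z X Y : ι → ℂ}
    (hz : Tendsto z l (𝓝 0)) (hX : Tendsto X l (𝓝 (Complex.exp μ)))
    (hY : Tendsto Y l (𝓝 (Complex.exp μ))) :
    (fun t => X t - Y t) =O[l] fun t =>
      numericEquation k ρ h μ n (z t) (X t) - numericEquation k ρ h μ n (z t) (Y t) := by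
  have hXY : Tendsto (fun t => (X t, Y t)) l (𝓝 (Complex.exp μ, Complex.exp μ)) :=
    hX.prodMk_nhds hY
  have hi : ∀ j : ℤ, (fun t => X t ^ j - Y t ^ j) =O[l] fun t => X t - Y t := fun j =>
    isBigO_sub_comp_of_hasStrictDerivAt (hasStrictDerivAt_zpow_exp μ j) hX hY
  have hlog : (fun t => Complex.log (Complex.exp (-μ) * X t) - Complex.log (Complex.exp (-μ) * Y t))
      =O[l] fun t => X t - Y t := by
    have h1 : HasStrictDerivAt (fun y => Complex.exp (-μ) * y) (Complex.exp (-μ) * 1)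
        (Complex.exp μ) := (hasStrictDerivAt_id _).const_mul _
    have h2 : Complex.exp (-μ) * Complex.exp μ = 1 := by rw [← Complex.exp_add]; simp
    have h3 : HasStrictDerivAt (fun y => Complex.log (Complex.exp (-μ) * y)) _ (Complex.exp μ) :=
      h1.clog (by rw [h2]; simp)
    exact isBigO_sub_comp_of_hasStrictDerivAt h3 hX hY
  have hsmall : ∀ (j : ℕ) {e : ι → ℂ}, 0 < j → (e =O[l] fun t => X t - Y t) →
      (fun t => z t ^ j * e t) =o[l] fun t => X t - Y t := by
    intro j e hj he
    have h1 : (fun t => z t ^ j) =o[l] fun _ => (1 : ℂ) := by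
      rw [isLittleO_one_iff]
      simpa [hj.ne'] using hz.pow j
    simpa using h1.mul_isBigO he
  set c : ℂ := ((-(k : ℤ) : ℤ) : ℂ) * Complex.exp μ ^ (-(k : ℤ) - 1) with hc
  have hne : PowerSeries.coeff 0 h * c ≠ 0 := by
    refine mul_ne_zero h0 (mul_ne_zero ?_ (zpow_ne_zero _ (Complex.exp_ne_zero μ)))
    push_cast
    exact neg_ne_zero.2 (by exact_mod_cast hk.ne')
  have hstrict : (fun t => X t ^ (-(k : ℤ)) - Y t ^ (-(k : ℤ)) - c * (X t - Y t))
      =o[l] fun t => X t - Y t := by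
    have := (hasStrictDerivAt_zpow_exp μ (-(k : ℤ))).hasStrictFDerivAt.isLittleO.comp_tendsto hXY
    refine this.congr_left fun t => ?_
    simp [hc, mul_comm]
  obtain ⟨n, rfl⟩ := Nat.exists_eq_succ_of_ne_zero hn.ne'
  have hrest : (fun t => ∑ i ∈ Finset.range n, PowerSeries.coeff (i + 1) h * (z t ^ (i + 1) *
      (X t ^ (((i + 1 : ℕ) : ℤ) - (k : ℤ)) - Y t ^ (((i + 1 : ℕ) : ℤ) - (k : ℤ)))))
      =o[l] fun t => X t - Y t :=
    IsLittleO.fun_sum fun i _ => (hsmall (i + 1) (Nat.succ_pos i) (hi _)).const_mul_left _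
  have htot := ((hstrict.const_mul_left (PowerSeries.coeff 0 h)).add hrest).add
    ((hsmall k hk hlog).const_mul_left ρ)
  have htot' := htot.trans_isBigO (isBigO_self_const_mul hne (fun t => X t - Y t) l)
  have hfin := (isBigO_self_const_mul hne (fun t => X t - Y t) l).trans htot'.right_isBigO_add
  refine hfin.congr_right fun t => ?_
  rw [numericEquation, numericEquation, Finset.sum_range_succ', Finset.sum_range_succ']
  simp only [mul_sub, Finset.sum_sub_distrib, ← mul_assoc]
  simp only [Nat.cast_zero, zero_sub, pow_zero]
  ring

theorem IsFormalInverse.hasExp_numericEquation (hk : 0 < k) {n : ℕ} (hn : k ≤ n)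
    (hΦ : IsFormalInverse k ρ h μ Φ) {Y : ℕ → ℂ}
    (hY : HasExp atTop (powerLogScale k ρ) (powerLogGauge k) n Y Φ) :
    (fun m => numericEquation k ρ h μ n (rootScale k m) (Y m)
      - (1 / (k : ℂ)) * (ρ * ((Real.log m / m : ℝ) : ℂ)) - 1) =O[atTop]
      fun m => powerLogGauge k m ^ n := by
  obtain ⟨hc, he⟩ := hΦ
  have hg := isGauge_powerLog (ρ := ρ) hk
  have hn1 : 1 ≤ n := le_trans hk hn
  have hz : HasExp atTop (powerLogScale k ρ) (powerLogGauge k) n (rootScale k)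
      (MvPowerSeries.X 0 : MvPowerSeries (Fin 2) ℂ) := hasExp_X (0 : Fin 2)
  have hw : HasExp atTop (powerLogScale k ρ) (powerLogGauge k) n
      (fun m => ρ * ((Real.log m / m : ℝ) : ℂ))
      (MvPowerSeries.X 1 : MvPowerSeries (Fin 2) ℂ) := hasExp_X (1 : Fin 2)
  have hinv := hY.inv hg hn1 (by rw [hc]; exact Complex.exp_ne_zero μ)
  have hS := (hz.mul hg hY).subst hg (constantCoeff_X_mul 0 Φ) hn1
    (g := fun x => ∑ i ∈ Finset.range n, PowerSeries.coeff i h * x ^ i) (H := h)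
    (by simpa using isBigO_zero _ _)
  have hL := ((hY.const_mul hg (Complex.exp (-μ))).sub hg (hasExp_const 1)).subst hg
    (by rw [map_one]; exact constantCoeff_normalized hc) hn1 (hasExpAtZero_log n)
  rw [map_one] at hL
  have hA := ((((hinv.pow hg k).mul hg hS).add
    (((hz.pow hg k).const_mul hg ρ).mul hg ((hasExp_const μ).add hL))).sub hg
    (hw.const_mul hg (1 / (k : ℂ)))).sub hg (hasExp_const 1)
  have hO := hA.isBigO_of_mem hg (by rw [he, map_one, sub_self]; exact Ideal.zero_mem _)
  refine hO.congr' ?_ EventuallyEq.rfl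
  have hne : ∀ᶠ m in atTop, Y m ≠ 0 := (hY.tendsto hg hn1).eventually_ne (by
    rw [hc]; exact Complex.exp_ne_zero μ)
  filter_upwards [hne] with m hm
  rw [numericEquation, Finset.mul_sum]
  congr 3
  · refine Finset.sum_congr rfl fun i _ => ?_
    rw [zpow_sub₀ hm, mul_pow]
    simp only [zpow_natCast]
    rw [div_eq_mul_inv, inv_pow]
    ring
  · simp

/-- The rescaled sequence has the expansion given by the formal inverse. -/
theorem IsFormalInverse.hasExp_rescaled (hk : 0 < k) (h0 : PowerSeries.coeff 0 h ≠ 0)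
    (hΦ : IsFormalInverse k ρ h μ Φ) {x ℓ : ℕ → ℂ} (hℓ : ∀ m, Complex.exp (ℓ m) = x m)
    (hμ : Tendsto (fun m : ℕ => ℓ m + ((Real.log m / k : ℝ) : ℂ)) atTop (𝓝 μ))
    (hx : ∀ N : ℕ, (fun m : ℕ => ∑ i ∈ Finset.range (k + N),
        PowerSeries.coeff i h * x m ^ ((i : ℤ) - (k : ℤ)) + ρ * ℓ m - m) =O[atTop]
      fun m => x m ^ N) (n : ℕ) :
    HasExp atTop (powerLogScale k ρ) (powerLogGauge k) n (fun m => x m / rootScale k m) Φ := by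
  have hg := isGauge_powerLog (ρ := ρ) hk
  suffices H : ∀ N, HasExp atTop (powerLogScale k ρ) (powerLogGauge k) (k + N)
      (fun m => x m / rootScale k m) Φ from (H n).mono hg (Nat.le_add_left n k)
  intro N
  set n := k + N with hn
  have hn0 : 0 < n := by omega
  set X : ℕ → ℂ := fun m => x m / rootScale k m with hX
  have hXexp : ∀ᶠ m : ℕ in atTop, X m = Complex.exp (ℓ m + ((Real.log m / k : ℝ) : ℂ)) := by
    filter_upwards [eventually_gt_atTop 0] with m hm
    rw [hX]
    simp only
    rw [rootScale_eq_exp hm, ← hℓ, ← Complex.exp_sub, sub_neg_eq_add]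
  have hXt : Tendsto X atTop (𝓝 (Complex.exp μ)) :=
    ((Complex.continuous_exp.tendsto μ).comp hμ).congr' (hXexp.mono fun m hm => hm.symm)
  have hzt : Tendsto (rootScale k) atTop (𝓝 0) := by
    rw [tendsto_zero_iff_norm_tendsto_zero]
    simp only [norm_rootScale_eq_gauge_sq]
    simpa using (tendsto_powerLogGauge hk).pow 2
  -- The exponent tends to 0, so the principal logarithm recovers it. This replaces the branch ℓ by
  -- the logarithm series of the formal equation.
  have hlogX : ∀ᶠ m : ℕ in atTop, Complex.log (Complex.exp (-μ) * X m)
      = ℓ m + ((Real.log m / k : ℝ) : ℂ) - μ := by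
    have h1 : Tendsto (fun m : ℕ => ℓ m + ((Real.log m / k : ℝ) : ℂ) - μ) atTop (𝓝 0) := by
      simpa using hμ.sub_const μ
    have h2 : ∀ᶠ m : ℕ in atTop, ‖ℓ m + ((Real.log m / k : ℝ) : ℂ) - μ‖ < 1 :=
      (tendsto_zero_iff_norm_tendsto_zero.1 h1).eventually_lt_const one_pos
    filter_upwards [hXexp, h2] with m hm hm'
    rw [hm, ← Complex.exp_add, neg_add_eq_sub]
    have h3 := Complex.abs_im_le_norm (ℓ m + ((Real.log m / k : ℝ) : ℂ) - μ)
    have h4 := abs_lt.1 (h3.trans_lt hm')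
    exact Complex.log_exp (by linarith [Real.pi_gt_three]) (by linarith [Real.pi_gt_three])
  have hxz : x =O[atTop] fun m => rootScale k m := by
    have h1 := (hXt.isBigO_one ℂ).mul (isBigO_refl (rootScale k) atTop)
    refine h1.congr' ?_ (by simp)
    filter_upwards [eventually_gt_atTop 0] with m hm
    rw [hX]
    refine div_mul_cancel₀ _ ?_
    rw [rootScale_eq_exp hm]
    exact Complex.exp_ne_zero _
  -- The relation ψ(x_m) = m, truncated and multiplied by z^k = 1/m, is the numerical equation for
  -- the rescaled sequence X.
  have heX : (fun m => numericEquation k ρ h μ n (rootScale k m) (X m)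
      - (1 / (k : ℂ)) * (ρ * ((Real.log m / m : ℝ) : ℂ)) - 1) =O[atTop]
      fun m => powerLogGauge k m ^ n := by
    have h1 := (isBigO_refl (fun m => rootScale k m ^ k) atTop).mul ((hx N).trans (hxz.pow N))
    have h2 : (fun m => rootScale k m ^ k * rootScale k m ^ N) =O[atTop]
        fun m => powerLogGauge k m ^ n := by
      have h3 : (fun m => rootScale k m ^ n) =O[atTop]
          fun m => (powerLogGauge k m ^ n) ^ 2 := by
        refine IsBigO.of_norm_left ((isBigO_refl _ _).congr_left fun m => ?_)
        rw [norm_pow, norm_rootScale_eq_gauge_sq, ← pow_mul, ← pow_mul, mul_comm]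
      have h4 : (fun m => (powerLogGauge k m ^ n) ^ 2) =O[atTop]
          fun m => powerLogGauge k m ^ n := by
        simpa only [← pow_mul] using hg.isBigO_pow_of_le (by omega : n ≤ n * 2)
      simpa only [← pow_add, ← hn] using h3.trans h4
    refine (h1.trans h2).congr' ?_ EventuallyEq.rfl
    filter_upwards [hlogX, eventually_gt_atTop 0] with m hm hm0
    have hz0 : rootScale k m ≠ 0 := by
      rw [rootScale_eq_exp hm0]
      exact Complex.exp_ne_zero _
    have hm0' : (m : ℂ) ≠ 0 := by exact_mod_cast hm0.ne'
    have hk' : (k : ℂ) ≠ 0 := by exact_mod_cast hk.ne'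
    have hzk := rootScale_pow_self hk (m := m)
    have hsum : ∑ i ∈ Finset.range n, PowerSeries.coeff i h * rootScale k m ^ i
        * X m ^ ((i : ℤ) - (k : ℤ)) = rootScale k m ^ k * ∑ i ∈ Finset.range n,
        PowerSeries.coeff i h * x m ^ ((i : ℤ) - (k : ℤ)) := by
      rw [Finset.mul_sum]
      refine Finset.sum_congr rfl fun i _ => ?_
      rw [hX]
      simp only
      rw [div_zpow, zpow_sub₀ hz0]
      simp only [zpow_natCast]
      field_simp
    rw [numericEquation, hsum, hm, hzk]
    push_cast
    field_simp
    ring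
  -- The competitor Y is the truncated formal inverse evaluated on the scale; it solves the same
  -- equation to the same order.
  set Y : ℕ → ℂ := fun m => MvPolynomial.eval (fun i => powerLogScale k ρ i m)
    (MvPowerSeries.truncTotal n Φ) with hY
  have hYexp : HasExp atTop (powerLogScale k ρ) (powerLogGauge k) n Y Φ :=
    (hasExp_eval (MvPowerSeries.truncTotal n Φ)).congr (by simpa [hY] using isBigO_zero _ _)
      (by rw [← neg_sub]; exact Ideal.neg_mem_iff _ |>.2 (sub_truncTotal_mem _ _))
  have hYt : Tendsto Y atTop (𝓝 (Complex.exp μ)) := hΦ.1 ▸ hYexp.tendsto hg hn0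
  have hfin := (isBigO_sub_of_numericEquation (ρ := ρ) hk h0 hn0 hzt hXt hYt).trans
    ((heX.sub (hΦ.hasExp_numericEquation hk (by omega) hYexp)).congr_left fun m => by ring)
  exact hYexp.congr hfin (by simp)

end PowerLog

/-! ### Ordering the terms of the expansion by their true size -/

section PowerLogExpansion

variable {k : ℕ} {ρ : ℂ} {Φ : MvPowerSeries (Fin 2) ℂ}

/-- The polynomial of the terms of `Φ` of degree less than `n` in each variable. -/
def boxTrunc (n : ℕ) (Φ : MvPowerSeries (Fin 2) ℂ) : MvPolynomial (Fin 2) ℂ :=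
  ∑ q ∈ Finset.range n ×ˢ Finset.range n,
    MvPolynomial.monomial (Finsupp.single 0 q.1 + Finsupp.single 1 q.2) (coeff₂ q.1 q.2 Φ)

theorem sub_boxTrunc_mem (n : ℕ) (Φ : MvPowerSeries (Fin 2) ℂ) :
    Φ - (boxTrunc n Φ : MvPowerSeries (Fin 2) ℂ) ∈ ordIdeal (Fin 2) n := by
  rw [mem_ordIdeal_iff_coeff]
  intro d hd
  have hd2 : d = Finsupp.single 0 (d 0) + Finsupp.single 1 (d 1) := by
    ext i
    fin_cases i <;> simp
  have hdeg : d.degree = d 0 + d 1 := by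
    rw [Finsupp.degree_eq_sum, Fin.sum_univ_two]
  rw [map_sub, MvPolynomial.coeff_coe, sub_eq_zero, boxTrunc, MvPolynomial.coeff_sum]
  rw [Finset.sum_eq_single (d 0, d 1)]
  · rw [MvPolynomial.coeff_monomial, if_pos hd2.symm, coeff₂, ← hd2]
  · rintro ⟨i, j⟩ - hij
    rw [MvPolynomial.coeff_monomial, if_neg]
    rintro rfl
    simp at hij
  · intro hmem
    simp only [Finset.mem_product, Finset.mem_range] at hmem
    omega

theorem eval_boxTrunc (n m : ℕ) (Φ : MvPowerSeries (Fin 2) ℂ) :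
    MvPolynomial.eval (fun i => powerLogScale k ρ i m) (boxTrunc n Φ)
      = ∑ q ∈ Finset.range n ×ˢ Finset.range n, coeff₂ q.1 q.2 Φ * rootScale k m ^ q.1
        * (ρ * ((Real.log m / m : ℝ) : ℂ)) ^ q.2 := by
  rw [boxTrunc, map_sum]
  refine Finset.sum_congr rfl fun q _ => ?_
  rw [MvPolynomial.eval_monomial, Finsupp.prod_fintype _ _ (by simp), Fin.prod_univ_two]
  simp [powerLogScale, mul_assoc]

theorem norm_rootScale_pow_self (hk : 0 < k) (m : ℕ) : ‖rootScale k m‖ ^ k = (m : ℝ)⁻¹ := by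
  rw [← norm_pow, rootScale_pow_self hk]
  simp

theorem eventually_norm_rootScale_mul_log_pow_le (hk : 0 < k) (j : ℕ) :
    ∀ᶠ m : ℕ in atTop, ‖rootScale k m‖ * Real.log m ^ j ≤ 1 := by
  have h := (isLittleO_log_rpow_rpow_atTop (j : ℝ)
    (by positivity : (0 : ℝ) < 1 / k)).comp_tendsto tendsto_natCast_atTop_atTop
  filter_upwards [h.bound one_pos, eventually_gt_atTop 0] with m hm hm0
  have hm0' : (0 : ℝ) < m := by exact_mod_cast hm0
  simp only [Function.comp, Real.rpow_natCast, one_mul] at hm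
  have h1 : Real.log m ^ j ≤ (m : ℝ) ^ (1 / (k : ℝ)) :=
    (le_abs_self _).trans (hm.trans (by rw [Real.norm_of_nonneg (by positivity)]))
  rw [norm_rootScale]
  calc (m : ℝ) ^ (-(1 : ℝ) / k) * Real.log m ^ j
      ≤ (m : ℝ) ^ (-(1 : ℝ) / k) * (m : ℝ) ^ (1 / (k : ℝ)) := by gcongr
    _ = 1 := by rw [← Real.rpow_add hm0', neg_div, neg_add_cancel, Real.rpow_zero]

theorem norm_rootScale_pow_succ (k N m : ℕ) :
    ‖rootScale k m‖ ^ (N + 1) = (m : ℝ) ^ (-((N : ℝ) + 1) / (k : ℝ)) := by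
  rw [norm_rootScale, ← Real.rpow_natCast, ← Real.rpow_mul (Nat.cast_nonneg m)]
  congr 1
  push_cast
  ring

theorem eventually_one_le_log : ∀ᶠ m : ℕ in atTop, 1 ≤ Real.log m :=
  (Real.tendsto_log_atTop.comp tendsto_natCast_atTop_atTop).eventually_ge_atTop 1

/-- With s = m^(-1/k) the term has size s^(1+i+kj) (log m)^j. If i + kj = N, then j ≤ N/k. If i + kj
> N, one spare factor s absorbs all the logarithms. -/
theorem powerLog_term_isBigO (hk : 0 < k) {N i j : ℕ} (h : N ≤ i + k * j) (c : ℂ) :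
    (fun m : ℕ => c * rootScale k m ^ (1 + i) * (ρ * ((Real.log m / m : ℝ) : ℂ)) ^ j) =O[atTop]
      fun m : ℕ => (m : ℝ) ^ (-((N : ℝ) + 1) / (k : ℝ)) * Real.log m ^ (N / k) := by
  refine IsBigO.of_bound (‖c‖ * ‖ρ‖ ^ j) ?_
  have hle1 : ∀ᶠ m : ℕ in atTop, ‖rootScale k m‖ ≤ 1 := by
    simpa using eventually_norm_rootScale_mul_log_pow_le hk 0
  filter_upwards [eventually_one_le_log, eventually_norm_rootScale_mul_log_pow_le hk j, hle1]
    with m hL hs hs1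
  have hL0 : 0 ≤ Real.log m := by linarith
  rw [← norm_rootScale_pow_succ, norm_mul, norm_mul, norm_pow, norm_pow, norm_mul,
    Complex.norm_real, norm_mul, norm_div, norm_pow, norm_norm, norm_pow, Real.norm_of_nonneg hL0,
    Real.norm_of_nonneg (Nat.cast_nonneg m), div_eq_mul_inv, ← norm_rootScale_pow_self hk m]
  set s := ‖rootScale k m‖ with hsdef
  have hs0 : 0 ≤ s := norm_nonneg _
  have key : s ^ (1 + i + k * j) * Real.log m ^ j ≤ s ^ (N + 1) * Real.log m ^ (N / k) := by
    rcases h.eq_or_lt with h | h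
    · have hj : j ≤ N / k := by
        rw [Nat.le_div_iff_mul_le hk, mul_comm]
        omega
      have : 1 + i + k * j = N + 1 := by omega
      rw [this]
      gcongr
    · obtain ⟨e, he⟩ := Nat.exists_eq_add_of_lt h
      have : 1 + i + k * j = N + 1 + e + 1 := by omega
      calc s ^ (1 + i + k * j) * Real.log m ^ j
          = s ^ (N + 1) * s ^ e * (s * Real.log m ^ j) := by rw [this]; ring
        _ ≤ s ^ (N + 1) * 1 * 1 := by
          have : s ^ e ≤ 1 := pow_le_one₀ hs0 hs1
          gcongr
        _ ≤ s ^ (N + 1) * Real.log m ^ (N / k) := by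
          rw [mul_one, mul_one]
          exact le_mul_of_one_le_right (by positivity) (one_le_pow₀ hL)
  calc ‖c‖ * s ^ (1 + i) * (‖ρ‖ * (Real.log m * s ^ k)) ^ j
      = ‖c‖ * ‖ρ‖ ^ j * (s ^ (1 + i + k * j) * Real.log m ^ j) := by
        rw [pow_add s (1 + i), pow_mul]; ring
    _ ≤ ‖c‖ * ‖ρ‖ ^ j * (s ^ (N + 1) * Real.log m ^ (N / k)) := by gcongr

theorem hasPowerLogExpansion_of_hasExp (hk : 0 < k) {x : ℕ → ℂ}
    (hX : ∀ n, HasExp atTop (powerLogScale k ρ) (powerLogGauge k) n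
      (fun m => x m / rootScale k m) Φ) : HasPowerLogExpansion k ρ x Φ := by
  intro N
  have hg := isGauge_powerLog (ρ := ρ) hk
  -- The gauge is the square root of |z|, so order 2N in the gauge is |z|^N; the prefactor z of the
  -- series supplies the remaining power.
  set n := 2 * N with hn
  have h1 := (hX n).isBigO_sub_eval hg (sub_boxTrunc_mem n Φ)
  set A := (Finset.range N ×ˢ Finset.range N).filter (fun p => p.1 + k * p.2 < N) with hA
  have hAB : A ⊆ Finset.range n ×ˢ Finset.range n := by
    intro q hq
    simp only [hA, Finset.mem_filter, Finset.mem_product, Finset.mem_range] at hq ⊢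
    omega
  have h2 : (fun m => rootScale k m * (x m / rootScale k m
      - MvPolynomial.eval (fun i => powerLogScale k ρ i m) (boxTrunc n Φ))) =O[atTop]
      fun m : ℕ => (m : ℝ) ^ (-((N : ℝ) + 1) / (k : ℝ)) * Real.log m ^ (N / k) := by
    have h3 := (isBigO_refl (rootScale k) atTop).norm_right.mul h1
    refine h3.trans (IsBigO.of_bound 1 ?_)
    filter_upwards [eventually_one_le_log] with m hL
    rw [← norm_rootScale_pow_succ, hn, pow_mul, ← norm_rootScale_eq_gauge_sq, ← pow_succ', one_mul,
      norm_mul]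
    refine le_mul_of_one_le_right (norm_nonneg _) ?_
    rw [norm_pow]
    exact one_le_pow₀ (hL.trans (le_abs_self _))
  have h4 : (fun m => ∑ q ∈ (Finset.range n ×ˢ Finset.range n) \ A,
      coeff₂ q.1 q.2 Φ * rootScale k m ^ (1 + q.1) * (ρ * ((Real.log m / m : ℝ) : ℂ)) ^ q.2)
      =O[atTop]
      fun m : ℕ => (m : ℝ) ^ (-((N : ℝ) + 1) / (k : ℝ)) * Real.log m ^ (N / k) := by
    refine IsBigO.fun_sum fun q hq => powerLog_term_isBigO hk ?_ _
    by_contra hlt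
    simp only [hA, Finset.mem_sdiff, Finset.mem_filter, Finset.mem_product, Finset.mem_range,
      not_and] at hq
    have : q.2 ≤ k * q.2 := Nat.le_mul_of_pos_left _ hk
    exact hq.2 ⟨by omega, by omega⟩ (by omega)
  refine (h2.add h4).congr' ?_ EventuallyEq.rfl
  filter_upwards [eventually_gt_atTop 0] with m hm
  have hz0 : rootScale k m ≠ 0 := by
    rw [rootScale_eq_exp hm]
    exact Complex.exp_ne_zero _
  have h5 : powerLogSum k ρ Φ N m = ∑ q ∈ A,
      coeff₂ q.1 q.2 Φ * rootScale k m ^ (1 + q.1) * (ρ * ((Real.log m / m : ℝ) : ℂ)) ^ q.2 := rfl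
  have h6 := Finset.sum_sdiff hAB (f := fun q : ℕ × ℕ =>
      coeff₂ q.1 q.2 Φ * rootScale k m ^ (1 + q.1) * (ρ * ((Real.log m / m : ℝ) : ℂ)) ^ q.2)
  have h7 : rootScale k m * MvPolynomial.eval (fun i => powerLogScale k ρ i m) (boxTrunc n Φ)
      = ∑ q ∈ Finset.range n ×ˢ Finset.range n,
      coeff₂ q.1 q.2 Φ * rootScale k m ^ (1 + q.1) * (ρ * ((Real.log m / m : ℝ) : ℂ)) ^ q.2 := by
    rw [eval_boxTrunc, Finset.mul_sum]
    refine Finset.sum_congr rfl fun q _ => ?_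
    rw [pow_add, pow_one]
    ring
  rw [h5, mul_sub, h7, ← h6, mul_div_cancel₀ _ hz0]
  ring

end PowerLogExpansion

/-! ### Dynamics in a small disc -/

section Dynamics

variable {f : ℂ → ℂ} {k : ℕ} {a v : ℂ} {r : ℝ}

/-- The leading part `-1 / (k a x^k)` of the Fatou coordinate. -/
def approxCoord (k : ℕ) (a x : ℂ) : ℂ := -((k : ℂ) * a * x ^ k)⁻¹

/-- A disc of radius `r` around the origin on which the parabolic germ is close to the
translation `w ↦ w + 1` in the coordinate `w = -1 / (k a x^k)`. -/
structure AdaptedDisc (f : ℂ → ℂ) (k : ℕ) (a : ℂ) (r : ℝ) : Prop where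
  k_pos : 0 < k
  a_ne_zero : a ≠ 0
  r_pos : 0 < r
  differentiableAt : ∀ x ∈ Metric.ball (0 : ℂ) r, DifferentiableAt ℂ f x
  ne_zero : ∀ x ∈ Metric.ball (0 : ℂ) r, x ≠ 0 → f x ≠ 0
  abs_arg_lt : ∀ x ∈ Metric.ball (0 : ℂ) r, x ≠ 0 → |Complex.arg (f x / x)| < Real.pi / (2 * k)
  step : ∀ x ∈ Metric.ball (0 : ℂ) r, x ≠ 0 →
    ‖approxCoord k a (f x) - approxCoord k a x - 1‖ ≤ 1 / 4

/-- The lower bound of `‖w‖` on the disc of radius `r`. -/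
def coordBound (k : ℕ) (a : ℂ) (r : ℝ) : ℝ := (k * ‖a‖ * r ^ k)⁻¹

/-- The points whose orbits stay in the punctured disc of radius `r`. -/
def puncturedStableSet (f : ℂ → ℂ) (r : ℝ) : Set ℂ :=
  {x | ∀ n, f^[n] x ∈ Metric.ball (0 : ℂ) r ∧ f^[n] x ≠ 0}

theorem norm_approxCoord (k : ℕ) (a x : ℂ) : ‖approxCoord k a x‖ = (k * ‖a‖ * ‖x‖ ^ k)⁻¹ := by
  simp [approxCoord]

theorem norm_pow_eq (hk : 0 < k) (ha : a ≠ 0) (x : ℂ) :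
    ‖x‖ ^ k = (k * ‖a‖ * ‖approxCoord k a x‖)⁻¹ := by
  have h1 : (k : ℝ) ≠ 0 := by exact_mod_cast hk.ne'
  have h2 : ‖a‖ ≠ 0 := norm_ne_zero_iff.2 ha
  rw [norm_approxCoord]
  field_simp

theorem AdaptedDisc.coordBound_pos (hD : AdaptedDisc f k a r) : 0 < coordBound k a r := by
  have h1 : (0 : ℝ) < k := by exact_mod_cast hD.k_pos
  have h2 : 0 < ‖a‖ := norm_pos_iff.2 hD.a_ne_zero
  have h3 := hD.r_pos
  unfold coordBound
  positivity

theorem AdaptedDisc.coordBound_lt_iff (hD : AdaptedDisc f k a r) {x : ℂ} (hx : x ≠ 0) :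
    coordBound k a r < ‖approxCoord k a x‖ ↔ x ∈ Metric.ball (0 : ℂ) r := by
  have h1 : (0 : ℝ) < k := by exact_mod_cast hD.k_pos
  have h2 : 0 < ‖a‖ := norm_pos_iff.2 hD.a_ne_zero
  have h3 := hD.r_pos
  have h4 : 0 < ‖x‖ := norm_pos_iff.2 hx
  rw [norm_approxCoord, coordBound, inv_lt_inv₀ (by positivity) (by positivity),
    mul_lt_mul_iff_right₀ (by positivity), pow_lt_pow_iff_left₀ h4.le h3.le hD.k_pos.ne',
    mem_ball_zero_iff]

theorem AdaptedDisc.mem_puncturedStableSet (hD : AdaptedDisc f k a r) {x : ℂ}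
    (hx : x ∈ stableSet f r) (hx0 : x ≠ 0) : x ∈ puncturedStableSet f r := by
  intro n
  refine ⟨hx n, ?_⟩
  induction n with
  | zero => exact hx0
  | succ n ih =>
    rw [Function.iterate_succ_apply']
    exact hD.ne_zero _ (hx n) ih

theorem iterate_mem_puncturedStableSet {x : ℂ} (hx : x ∈ puncturedStableSet f r) (n : ℕ) :
    f^[n] x ∈ puncturedStableSet f r := fun m => by
  rw [← Function.iterate_add_apply]
  exact hx (m + n)

theorem AdaptedDisc.re_le_re_step (hD : AdaptedDisc f k a r) {x : ℂ}
    (hx : x ∈ Metric.ball (0 : ℂ) r) (hx0 : x ≠ 0) :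
    (approxCoord k a x).re + 3 / 4 ≤ (approxCoord k a (f x)).re := by
  have h1 := (Complex.abs_re_le_norm _).trans (hD.step x hx hx0)
  simp only [Complex.sub_re, Complex.one_re] at h1
  have := (abs_le.1 h1).1
  linarith

theorem AdaptedDisc.re_iterate (hD : AdaptedDisc f k a r) {x : ℂ}
    (hx : x ∈ puncturedStableSet f r) (n : ℕ) :
    (approxCoord k a x).re + 3 / 4 * n ≤ (approxCoord k a (f^[n] x)).re := by
  induction n with
  | zero => simp
  | succ n ih =>
    have := hD.re_le_re_step (hx n).1 (hx n).2
    rw [Function.iterate_succ_apply']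
    push_cast
    linarith

theorem AdaptedDisc.norm_iterate_sub (hD : AdaptedDisc f k a r) {x : ℂ}
    (hx : x ∈ puncturedStableSet f r) (n : ℕ) :
    ‖approxCoord k a (f^[n] x) - approxCoord k a x‖ ≤ 5 / 4 * n := by
  induction n with
  | zero => simp
  | succ n ih =>
    have h1 := hD.step _ (hx n).1 (hx n).2
    rw [← Function.iterate_succ_apply' f] at h1
    have h2 : approxCoord k a (f^[n + 1] x) - approxCoord k a x
        = (approxCoord k a (f^[n + 1] x) - approxCoord k a (f^[n] x) - 1)
          + (approxCoord k a (f^[n] x) - approxCoord k a x) + 1 := by ring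
    rw [h2]
    refine (norm_add₃_le).trans ?_
    rw [norm_one]
    push_cast
    linarith

/-- The constant in the lower bound of `‖w‖` along orbits that start in `re w ≥ -L`. -/
def escapeRate (k : ℕ) (a : ℂ) (r L : ℝ) : ℝ := (13 / 3 + 10 / 3 * L / coordBound k a r)⁻¹

theorem AdaptedDisc.escapeRate_pos (hD : AdaptedDisc f k a r) {L : ℝ} (hL : 0 ≤ L) :
    0 < escapeRate k a r L := by
  have := hD.coordBound_pos
  unfold escapeRate
  positivity

/-- Write A = ‖w_n‖ and C for `coordBound`. Three lower bounds hold for A: C, 3n/4 - L and ‖w‖ -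
5n/4. The last two give ‖w‖ + n ≤ A + 9n/4 ≤ 4A + 3L, and the first gives L ≤ (L/C) A. So growth is
linear and uniform even for orbits starting in the left half-plane, which have to pass around the
excluded disc. -/
theorem AdaptedDisc.escapeRate_mul_le (hD : AdaptedDisc f k a r) {L : ℝ} (hL : 0 ≤ L) {x : ℂ}
    (hx : x ∈ puncturedStableSet f r) (hxL : -L ≤ (approxCoord k a x).re) (n : ℕ) :
    escapeRate k a r L * (‖approxCoord k a x‖ + n) ≤ ‖approxCoord k a (f^[n] x)‖ := by
  have hC := hD.coordBound_pos
  set A := ‖approxCoord k a (f^[n] x)‖ with hA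
  have h1 : coordBound k a r ≤ A := ((hD.coordBound_lt_iff (hx n).2).2 (hx n).1).le
  have h2 : -L + 3 / 4 * n ≤ A := by
    have := hD.re_iterate hx n
    have := Complex.re_le_norm (approxCoord k a (f^[n] x))
    linarith
  have h3 : ‖approxCoord k a x‖ - 5 / 4 * n ≤ A := by
    have := hD.norm_iterate_sub hx n
    have := norm_sub_norm_le (approxCoord k a x) (approxCoord k a (f^[n] x))
    rw [norm_sub_rev] at this
    linarith
  have h4 : L ≤ L / coordBound k a r * A := by
    rw [div_mul_eq_mul_div, le_div_iff₀ hC]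
    exact mul_le_mul_of_nonneg_left h1 hL
  have hp : 0 < 13 / 3 + 10 / 3 * L / coordBound k a r := by positivity
  rw [escapeRate, inv_mul_le_iff₀ hp]
  have h5 : (13 / 3 + 10 / 3 * L / coordBound k a r) * A
      = 13 / 3 * A + 10 / 3 * (L / coordBound k a r * A) := by ring
  rw [h5]
  linarith

theorem tendsto_zero_of_tendsto_norm_approxCoord (hk : 0 < k) (ha : a ≠ 0) {ι : Type*}
    {l : Filter ι} {x : ι → ℂ} (h : Tendsto (fun t => ‖approxCoord k a (x t)‖) l atTop) :
    Tendsto x l (𝓝 0) := by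
  have h1 : (0 : ℝ) < k := by exact_mod_cast hk
  have h2 : 0 < ‖a‖ := norm_pos_iff.2 ha
  have h3 : Tendsto (fun t => ‖x t‖ ^ k) l (𝓝 0) := by
    simp only [norm_pow_eq hk ha]
    exact (Tendsto.const_mul_atTop (by positivity : 0 < (k : ℝ) * ‖a‖) h).inv_tendsto_atTop
  rw [tendsto_zero_iff_norm_tendsto_zero]
  have h4 := h3.rpow_const (p := (1 / k : ℝ)) (Or.inr (by positivity))
  rw [Real.zero_rpow (by positivity)] at h4
  refine h4.congr fun t => ?_
  rw [← Real.rpow_natCast, ← Real.rpow_mul (norm_nonneg _), mul_one_div_cancel h1.ne',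
    Real.rpow_one]

theorem AdaptedDisc.tendsto_re (hD : AdaptedDisc f k a r) {x : ℂ}
    (hx : x ∈ puncturedStableSet f r) :
    Tendsto (fun n => (approxCoord k a (f^[n] x)).re) atTop atTop := by
  refine tendsto_atTop_mono (hD.re_iterate hx) (tendsto_atTop_add_const_left _ _ ?_)
  exact Tendsto.const_mul_atTop (by norm_num) tendsto_natCast_atTop_atTop

theorem AdaptedDisc.tendsto_iterate (hD : AdaptedDisc f k a r) {x : ℂ}
    (hx : x ∈ puncturedStableSet f r) : Tendsto (fun n => f^[n] x) atTop (𝓝 0) :=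
  tendsto_zero_of_tendsto_norm_approxCoord hD.k_pos hD.a_ne_zero
    (tendsto_atTop_mono (fun _ => Complex.re_le_norm _) (hD.tendsto_re hx))

theorem tendsto_div_natCast_of_tendsto_sub {u : ℕ → ℂ} {c : ℂ}
    (h : Tendsto (fun n => u (n + 1) - u n) atTop (𝓝 c)) :
    Tendsto (fun n : ℕ => u n / n) atTop (𝓝 c) := by
  have h1 := h.cesaro_smul
  simp only [Finset.sum_range_sub] at h1
  have h2 : Tendsto (fun n : ℕ => (n : ℂ)⁻¹ * u 0) atTop (𝓝 0) := by
    simpa using tendsto_inv_atTop_nhds_zero_nat (𝕜 := ℂ) |>.mul_const (u 0)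
  have h3 := h1.add h2
  rw [add_zero] at h3
  refine h3.congr fun n => ?_
  rw [Complex.real_smul]
  push_cast
  ring

theorem approxCoord_mul (hv : a * v ^ k = -(‖a‖ : ℂ)) (t : ℂ) :
    approxCoord k a (v * t) = ((k * ‖a‖ : ℝ) : ℂ)⁻¹ * (t ^ k)⁻¹ := by
  rw [approxCoord, mul_pow]
  have : (k : ℂ) * a * (v ^ k * t ^ k) = -(((k * ‖a‖ : ℝ) : ℂ) * t ^ k) := by
    push_cast
    linear_combination (k : ℂ) * t ^ k * hv
  rw [this, inv_neg, neg_neg, mul_inv]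

theorem approxCoord_mul_eq_exp (hv : a * v ^ k = -(‖a‖ : ℂ)) {t : ℂ} (ht : t ≠ 0) :
    approxCoord k a (v * t) = ((k * ‖a‖ : ℝ) : ℂ)⁻¹ * Complex.exp (-(k * Complex.log t)) := by
  rw [approxCoord_mul hv, Complex.exp_neg, Complex.exp_nat_mul, Complex.exp_log ht]

theorem re_approxCoord_mul (hv : a * v ^ k = -(‖a‖ : ℂ)) {t : ℂ} (ht : t ≠ 0) :
    (approxCoord k a (v * t)).re
      = (k * ‖a‖ * ‖t‖ ^ k)⁻¹ * Real.cos (k * Complex.arg t) := by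
  rw [approxCoord_mul_eq_exp hv ht, ← Complex.ofReal_inv, Complex.re_ofReal_mul, Complex.exp_re]
  have h1 : (-(k * Complex.log t)).re = -(k * Real.log ‖t‖) := by simp [Complex.log_re]
  have h2 : (-(k * Complex.log t)).im = -(k * Complex.arg t) := by simp [Complex.log_im]
  rw [h1, h2, Real.cos_neg, Real.exp_neg, Real.exp_nat_mul, Real.exp_log (norm_pos_iff.2 ht),
    mul_inv _ (‖t‖ ^ k), mul_assoc]

end Dynamics

/-! ### Attracting petals -/

section Petal

variable {f : ℂ → ℂ} {k : ℕ} {a v : ℂ} {r : ℝ}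

/-- `v` is an attracting direction. -/
structure IsAttractingDirection (k : ℕ) (a v : ℂ) : Prop where
  norm_eq_one : ‖v‖ = 1
  attracting : a * v ^ k = -(‖a‖ : ℂ)

theorem IsAttractingDirection.ne_zero (hv : IsAttractingDirection k a v) : v ≠ 0 := by
  rintro rfl
  simpa using hv.norm_eq_one

/-- The attracting petal in the direction `v`. -/
def petal (k : ℕ) (a v : ℂ) (r : ℝ) : Set ℂ :=
  {x | x ≠ 0 ∧ |Complex.arg (x / v)| < Real.pi / (2 * k) ∧ coordBound k a r < (approxCoord k a x).re}

theorem pi_div_le (hk : 0 < k) : Real.pi / (2 * k) ≤ Real.pi / 2 := by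
  have h1 : (1 : ℝ) ≤ k := by exact_mod_cast hk
  exact div_le_div_of_nonneg_left Real.pi_pos.le (by norm_num) (by linarith)

theorem AdaptedDisc.mem_ball_of_coordBound_lt_re (hD : AdaptedDisc f k a r) {x : ℂ} (hx0 : x ≠ 0)
    (hx : coordBound k a r < (approxCoord k a x).re) : x ∈ Metric.ball (0 : ℂ) r :=
  (hD.coordBound_lt_iff hx0).1 (hx.trans_le (Complex.re_le_norm _))

theorem arg_mul_of_abs_lt (hk : 0 < k) {t p : ℂ} (ht : t ≠ 0) (hp : p ≠ 0)
    (hta : |Complex.arg t| < Real.pi / (2 * k)) (hpa : |Complex.arg p| < Real.pi / (2 * k)) :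
    Complex.arg (t * p) = Complex.arg t + Complex.arg p := by
  have h1 := pi_div_le hk
  have h2 := abs_lt.1 hta
  have h3 := abs_lt.1 hpa
  exact Complex.arg_mul ht hp ⟨by linarith, by linarith⟩

/-- The arguments of x/v and p add up to an angle below π/k in modulus. If it were at least π/(2k),
then k times it would have modulus in [π/2, π] and Re w ≤ 0, against the hypothesis. A moderate
rotation that keeps Re w large therefore cannot lead into a neighbouring petal. -/
theorem AdaptedDisc.mul_mem_petal (hD : AdaptedDisc f k a r) (hv : IsAttractingDirection k a v)
    {x p : ℂ} (hx0 : x ≠ 0) (hx : |Complex.arg (x / v)| < Real.pi / (2 * k)) (hp0 : p ≠ 0)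
    (hp : |Complex.arg p| < Real.pi / (2 * k))
    (hre : coordBound k a r < (approxCoord k a (x * p)).re) : x * p ∈ petal k a v r := by
  have hk : (0 : ℝ) < k := by exact_mod_cast hD.k_pos
  have hv0 := hv.ne_zero
  set t := x / v with ht
  have ht0 : t ≠ 0 := div_ne_zero hx0 hv0
  have hxt : x * p = v * (t * p) := by rw [ht]; field_simp
  have harg := arg_mul_of_abs_lt hD.k_pos ht0 hp0 hx hp
  refine ⟨mul_ne_zero hx0 hp0, ?_, hre⟩
  rw [hxt, mul_div_cancel_left₀ _ hv0]
  rw [hxt, re_approxCoord_mul hv.attracting (mul_ne_zero ht0 hp0)] at hre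
  set θ := Complex.arg (t * p) with hθ
  have h1 : |θ| < Real.pi / k := by
    rw [harg]
    refine (abs_add_le _ _).trans_lt ((add_lt_add hx hp).trans_le (le_of_eq ?_))
    field_simp
    norm_num
  have hcos : 0 < Real.cos (k * θ) := by
    have h2 : 0 ≤ (k * ‖a‖ * ‖t * p‖ ^ k)⁻¹ := by positivity
    by_contra hneg
    have := mul_nonpos_of_nonneg_of_nonpos h2 (not_lt.1 hneg)
    linarith [hD.coordBound_pos]
  by_contra hge
  have h3 : Real.pi / 2 ≤ k * |θ| := by
    have := mul_le_mul_of_nonneg_left (not_lt.1 hge) hk.le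
    calc Real.pi / 2 = k * (Real.pi / (2 * k)) := by field_simp
      _ ≤ _ := this
  have h4 : k * |θ| ≤ Real.pi := by
    have := mul_le_mul_of_nonneg_left h1.le hk.le
    rwa [mul_div_cancel₀ _ hk.ne'] at this
  have h5 := Real.cos_nonpos_of_pi_div_two_le_of_le h3 (by linarith [Real.pi_pos])
  rw [← abs_of_pos hk, ← abs_mul, Real.cos_abs] at h5
  linarith

theorem AdaptedDisc.petal_subset_ball (hD : AdaptedDisc f k a r) :
    petal k a v r ⊆ Metric.ball (0 : ℂ) r := fun _ hx =>
  hD.mem_ball_of_coordBound_lt_re hx.1 hx.2.2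

theorem AdaptedDisc.mapsTo_petal (hD : AdaptedDisc f k a r) (hv : IsAttractingDirection k a v) :
    Set.MapsTo f (petal k a v r) (petal k a v r) := by
  intro x hx
  have hb := hD.petal_subset_ball hx
  have hfx := hD.ne_zero x hb hx.1
  have h1 : f x = x * (f x / x) := by rw [mul_div_cancel₀ _ hx.1]
  rw [h1]
  refine hD.mul_mem_petal hv hx.1 hx.2.1 (div_ne_zero hfx hx.1) (hD.abs_arg_lt x hb hx.1) ?_
  rw [← h1]
  have := hD.re_le_re_step hb hx.1
  linarith [hx.2.2]

theorem AdaptedDisc.petal_subset_puncturedStableSet (hD : AdaptedDisc f k a r)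
    (hv : IsAttractingDirection k a v) : petal k a v r ⊆ puncturedStableSet f r := fun _ hx n =>
  have h := (hD.mapsTo_petal hv).iterate n hx
  ⟨hD.petal_subset_ball h, h.1⟩

theorem continuousAt_approxCoord (hk : 0 < k) (ha : a ≠ 0) {x : ℂ} (hx : x ≠ 0) :
    ContinuousAt (approxCoord k a) x := by
  have : (k : ℂ) * a * x ^ k ≠ 0 :=
    mul_ne_zero (mul_ne_zero (by exact_mod_cast hk.ne') ha) (pow_ne_zero _ hx)
  unfold approxCoord
  fun_prop (disch := assumption)

theorem mem_slitPlane_of_abs_arg_lt (hk : 0 < k) {t : ℂ} (ht : t ≠ 0)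
    (h : |Complex.arg t| < Real.pi / (2 * k)) : t ∈ Complex.slitPlane := by
  rw [Complex.mem_slitPlane_iff_arg]
  refine ⟨fun he => ?_, ht⟩
  rw [he, abs_of_pos Real.pi_pos] at h
  linarith [pi_div_le hk, Real.pi_pos]

theorem AdaptedDisc.isOpen_petal (hD : AdaptedDisc f k a r) (hv : IsAttractingDirection k a v) :
    IsOpen (petal k a v r) := by
  rw [isOpen_iff_mem_nhds]
  intro x hx
  have h1 : ContinuousAt (fun y => |Complex.arg (y / v)|) x := by
    have h2 : ContinuousAt Complex.arg (x / v) := Complex.continuousAt_arg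
      (mem_slitPlane_of_abs_arg_lt hD.k_pos (div_ne_zero hx.1 hv.ne_zero) hx.2.1)
    exact (ContinuousAt.comp (f := fun y => y / v) h2 (by fun_prop)).abs
  have h3 : ContinuousAt (fun y => (approxCoord k a y).re) x :=
    Complex.continuous_re.continuousAt.comp
      (continuousAt_approxCoord hD.k_pos hD.a_ne_zero hx.1)
  filter_upwards [isOpen_ne.mem_nhds hx.1, h1.eventually_lt continuousAt_const hx.2.1,
    continuousAt_const.eventually_lt h3 hx.2.2] with y hy1 hy2 hy3
  exact ⟨hy1, hy2, hy3⟩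

/-- The inverse of the coordinate `w` on the petal. -/
def petalParam (k : ℕ) (a v ζ : ℂ) : ℂ :=
  v * Complex.exp (-(Complex.log (((k * ‖a‖ : ℝ) : ℂ) * ζ) / k))

/-- On the half-plane the principal logarithm has imaginary part within π/2, so the principal k-th
root takes values with |arg| < π/(2k), the range in which x ↦ w is injective. Connectedness of the
petal and the choice of v for a given point both use this chart. -/
theorem AdaptedDisc.petal_eq_image (hD : AdaptedDisc f k a r) (hv : IsAttractingDirection k a v) :
    petal k a v r = petalParam k a v '' {ζ : ℂ | coordBound k a r < ζ.re} := by
  have hk : (0 : ℝ) < k := by exact_mod_cast hD.k_pos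
  have hk' : (k : ℂ) ≠ 0 := by exact_mod_cast hD.k_pos.ne'
  have ha : 0 < ‖a‖ := norm_pos_iff.2 hD.a_ne_zero
  have hka : 0 < k * ‖a‖ := by positivity
  have hka' : ((k * ‖a‖ : ℝ) : ℂ) ≠ 0 := by exact_mod_cast hka.ne'
  have hv0 := hv.ne_zero
  have hC := hD.coordBound_pos
  ext x
  constructor
  · intro hx
    refine ⟨approxCoord k a x, hx.2.2, ?_⟩
    have ht0 : x / v ≠ 0 := div_ne_zero hx.1 hv0
    have hxt : x = v * (x / v) := by field_simp
    have h1 := approxCoord_mul_eq_exp hv.attracting ht0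
    rw [← hxt] at h1
    have h2 : (-(k * Complex.log (x / v))).im = -(k * Complex.arg (x / v)) := by
      simp [Complex.log_im]
    have h3 : |k * Complex.arg (x / v)| < Real.pi / 2 := by
      rw [abs_mul, abs_of_pos hk]
      have := mul_lt_mul_of_pos_left hx.2.1 hk
      calc _ < _ := this
        _ = Real.pi / 2 := by field_simp
    have h4 := abs_lt.1 h3
    rw [petalParam, h1, mul_inv_cancel_left₀ hka', Complex.log_exp (by rw [h2]; linarith)
      (by rw [h2]; linarith [Real.pi_pos])]
    rw [neg_div, neg_neg, mul_div_cancel_left₀ _ hk', Complex.exp_log ht0, ← hxt]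
  · rintro ⟨ζ, hζ, rfl⟩
    have hζ : coordBound k a r < ζ.re := hζ
    have hζ0 : ((k * ‖a‖ : ℝ) : ℂ) * ζ ≠ 0 := by
      refine mul_ne_zero hka' ?_
      rintro rfl
      simp at hζ
      linarith
    set lam := Complex.log (((k * ‖a‖ : ℝ) : ℂ) * ζ) with hlam
    set t := Complex.exp (-(lam / k)) with ht
    have ht0 : t ≠ 0 := Complex.exp_ne_zero _
    have harg : |lam.im| < Real.pi / 2 := by
      rw [hlam, Complex.log_im, Complex.arg_real_mul _ hka, Complex.abs_arg_lt_pi_div_two_iff]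
      exact Or.inl (by linarith)
    have him : (-(lam / k)).im = -(lam.im / k) := by simp
    have hlt : |lam.im / k| < Real.pi / (2 * k) := by
      rw [abs_div, abs_of_pos hk]
      calc |lam.im| / k < Real.pi / 2 / k := by gcongr
        _ = _ := by field_simp
    have hle := pi_div_le hD.k_pos
    have hlogt : Complex.log t = -(lam / k) := by
      have := abs_lt.1 hlt
      refine Complex.log_exp ?_ ?_ <;> rw [him] <;> linarith [Real.pi_pos]
    have hw : approxCoord k a (v * t) = ζ := by
      rw [approxCoord_mul_eq_exp hv.attracting ht0, hlogt, mul_neg, neg_neg,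
        mul_div_cancel₀ _ hk', hlam, Complex.exp_log hζ0, inv_mul_cancel_left₀ hka']
    refine ⟨mul_ne_zero hv0 ht0, ?_, ?_⟩
    · rw [petalParam, mul_div_cancel_left₀ _ hv0, ← hlam, ← ht, ← Complex.log_im, hlogt, him,
        abs_neg]
      exact hlt
    · rw [petalParam, ← hlam, ← ht, hw]
      exact hζ

theorem AdaptedDisc.isPreconnected_petal (hD : AdaptedDisc f k a r)
    (hv : IsAttractingDirection k a v) : IsPreconnected (petal k a v r) := by
  have hk : (0 : ℝ) < k := by exact_mod_cast hD.k_pos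
  have ha : 0 < ‖a‖ := norm_pos_iff.2 hD.a_ne_zero
  rw [hD.petal_eq_image hv]
  refine (convex_halfSpace_re_gt _).isPreconnected.image _ ?_
  intro ζ hζ
  have hζ : coordBound k a r < ζ.re := hζ
  have : ((k * ‖a‖ : ℝ) : ℂ) * ζ ∈ Complex.slitPlane := by
    left
    rw [Complex.re_ofReal_mul]
    have := hD.coordBound_pos
    exact mul_pos (by positivity) (by linarith)
  refine ContinuousAt.continuousWithinAt ?_
  have h1 : ContinuousAt (fun ζ : ℂ => Complex.log (((k * ‖a‖ : ℝ) : ℂ) * ζ)) ζ :=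
    ContinuousAt.clog (by fun_prop) this
  unfold petalParam
  fun_prop

theorem AdaptedDisc.exists_sector_subset_petal (hD : AdaptedDisc f k a r)
    (hv : IsAttractingDirection k a v) : ∃ ε > 0, ∃ δ > 0, sector v ε δ ⊆ petal k a v r := by
  have hk : (0 : ℝ) < k := by exact_mod_cast hD.k_pos
  have ha : 0 < ‖a‖ := norm_pos_iff.2 hD.a_ne_zero
  have hv0 := hv.ne_zero
  have hC := hD.coordBound_pos
  obtain ⟨ε, hε, hεC⟩ : ∃ ε > 0, ε ^ k * (2 * (k * ‖a‖) * coordBound k a r) ≤ 1 := by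
    have h1 : 0 < 2 * (k * ‖a‖) * coordBound k a r := by positivity
    refine ⟨min 1 (2 * (k * ‖a‖) * coordBound k a r)⁻¹, by positivity, ?_⟩
    rw [← le_div_iff₀ h1, one_div]
    exact (pow_le_of_le_one (by positivity) (min_le_left _ _) hD.k_pos.ne').trans (min_le_right _ _)
  -- With half-opening π/(3k) the cosine of k times the angle exceeds cos(π/3) = 1/2, while ε was
  -- chosen so that ‖w‖ is more than twice `coordBound`.
  refine ⟨ε, hε, Real.pi / (3 * k), by positivity, ?_⟩
  rintro x ⟨hx0, hxε, hxδ⟩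
  have hx0' : x ≠ 0 := norm_pos_iff.1 hx0
  refine ⟨hx0', hxδ.trans_le ?_, ?_⟩
  · gcongr
    norm_num
  · have ht0 : x / v ≠ 0 := div_ne_zero hx0' hv0
    have hxt : x = v * (x / v) := by field_simp
    have h1 := re_approxCoord_mul hv.attracting ht0
    rw [← hxt, norm_div, hv.norm_eq_one, div_one] at h1
    rw [h1]
    have h2 : 1 / 2 < Real.cos (k * Complex.arg (x / v)) := by
      rw [← Real.cos_pi_div_three, ← Real.cos_abs (k * _)]
      refine Real.cos_lt_cos_of_nonneg_of_le_pi (abs_nonneg _) (by linarith [Real.pi_pos]) ?_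
      rw [abs_mul, abs_of_pos hk]
      calc _ < k * (Real.pi / (3 * k)) := by gcongr
        _ = _ := by field_simp
    have h3 : ‖x‖ ^ k < ε ^ k := pow_lt_pow_left₀ hxε (norm_nonneg _) hD.k_pos.ne'
    have h4 : ‖x‖ ^ k * (2 * (k * ‖a‖) * coordBound k a r) ≤ 1 :=
      (mul_le_mul_of_nonneg_right h3.le (by positivity)).trans hεC
    have h5 : 0 < k * ‖a‖ * ‖x‖ ^ k := by positivity
    rw [← div_eq_inv_mul, lt_div_iff₀ h5]
    nlinarith

/-- The direction is v = x / y, where y is the principal root with y^k ‖a‖ = -a x^k. This identity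
gives both |y| = |x| and the attracting condition. -/
theorem AdaptedDisc.exists_mem_petal (hD : AdaptedDisc f k a r) {x : ℂ} (hx0 : x ≠ 0)
    (hx : coordBound k a r < (approxCoord k a x).re) :
    ∃ v, IsAttractingDirection k a v ∧ x ∈ petal k a v r := by
  have hk : (0 : ℝ) < k := by exact_mod_cast hD.k_pos
  have hk' : (k : ℂ) ≠ 0 := by exact_mod_cast hD.k_pos.ne'
  have ha : 0 < ‖a‖ := norm_pos_iff.2 hD.a_ne_zero
  have ha' : (‖a‖ : ℂ) ≠ 0 := by exact_mod_cast ha.ne'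
  have hka : 0 < k * ‖a‖ := by positivity
  have hka' : ((k * ‖a‖ : ℝ) : ℂ) ≠ 0 := by exact_mod_cast hka.ne'
  set ζ := approxCoord k a x with hζ
  have hζ0 : ((k * ‖a‖ : ℝ) : ℂ) * ζ ≠ 0 := by
    refine mul_ne_zero hka' fun h => ?_
    rw [h, Complex.zero_re] at hx
    linarith [hD.coordBound_pos]
  set y := Complex.exp (-(Complex.log (((k * ‖a‖ : ℝ) : ℂ) * ζ) / k)) with hy
  have hy0 : y ≠ 0 := Complex.exp_ne_zero _
  have hyk : y ^ k = (((k * ‖a‖ : ℝ) : ℂ) * ζ)⁻¹ := by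
    rw [hy, ← Complex.exp_nat_mul, mul_neg, mul_div_cancel₀ _ hk', Complex.exp_neg,
      Complex.exp_log hζ0]
  have hyk' : y ^ k * ‖a‖ = -(a * x ^ k) := by
    have hxk : x ^ k ≠ 0 := pow_ne_zero _ hx0
    have := hD.a_ne_zero
    rw [hyk, hζ, approxCoord]
    push_cast
    field_simp
  set v := x / y with hvdef
  have hxv : x = v * y := by rw [hvdef]; field_simp
  have hyn : ‖y‖ ^ k = ‖x‖ ^ k := by
    have := congrArg norm hyk'
    rw [norm_mul, norm_neg, norm_mul, norm_pow, norm_pow, Complex.norm_real, norm_norm,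
      mul_comm] at this
    exact mul_left_cancel₀ ha.ne' this
  have hyn' : ‖y‖ = ‖x‖ := (pow_left_inj₀ (norm_nonneg _) (norm_nonneg _) hD.k_pos.ne').1 hyn
  have hv : IsAttractingDirection k a v := by
    refine ⟨?_, ?_⟩
    · rw [hvdef, norm_div, hyn', div_self (norm_ne_zero_iff.2 hx0)]
    · rw [hvdef, div_pow]
      field_simp
      linear_combination hyk'
  refine ⟨v, hv, ?_⟩
  rw [hD.petal_eq_image hv]
  exact ⟨ζ, hx, by rw [petalParam, ← hy, ← hxv]⟩

theorem arg_approxCoord (hv : IsAttractingDirection k a v) (hk : 0 < k) (ha : a ≠ 0) {x : ℂ}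
    (hx0 : x ≠ 0) (hx : |Complex.arg (x / v)| < Real.pi / (2 * k)) :
    Complex.arg (approxCoord k a x) = -(k * Complex.arg (x / v)) := by
  have hk' : (0 : ℝ) < k := by exact_mod_cast hk
  have ha' : 0 < ‖a‖ := norm_pos_iff.2 ha
  have ht0 : x / v ≠ 0 := div_ne_zero hx0 hv.ne_zero
  have hxt : x = v * (x / v) := by
    have := hv.ne_zero
    field_simp
  have h1 := approxCoord_mul_eq_exp hv.attracting ht0
  rw [← hxt] at h1
  have h2 : (-(k * Complex.log (x / v))).im = -(k * Complex.arg (x / v)) := by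
    simp [Complex.log_im]
  have h3 : |k * Complex.arg (x / v)| < Real.pi / 2 := by
    rw [abs_mul, abs_of_pos hk']
    calc _ < k * (Real.pi / (2 * k)) := by gcongr
      _ = Real.pi / 2 := by field_simp
  have h4 := abs_lt.1 h3
  rw [h1, ← Complex.ofReal_inv, Complex.arg_real_mul _ (by positivity), ← h2, ← Complex.log_im,
    Complex.log_exp (by rw [h2]; linarith) (by rw [h2]; linarith [Real.pi_pos])]

/-- Orbits in the petal tend to `0` in the direction `v`. -/
theorem tendsto_direction_of_eventually_abs_arg_lt (hv : IsAttractingDirection k a v) (hk : 0 < k)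
    (ha : a ≠ 0) {x : ℕ → ℂ} (hx0 : ∀ᶠ n in atTop, x n ≠ 0)
    (hx : ∀ᶠ n in atTop, |Complex.arg (x n / v)| < Real.pi / (2 * k))
    (hw : Tendsto (fun n : ℕ => approxCoord k a (x n) / n) atTop (𝓝 1)) :
    Tendsto (fun n => x n / (‖x n‖ : ℂ)) atTop (𝓝 v) := by
  have hk' : (k : ℝ) ≠ 0 := by exact_mod_cast hk.ne'
  have h1 : Tendsto (fun n : ℕ => Complex.arg (approxCoord k a (x n) / n)) atTop (𝓝 0) := by
    have := (Complex.continuousAt_arg Complex.one_mem_slitPlane).tendsto.comp hw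
    rwa [Complex.arg_one] at this
  have h2 : Tendsto (fun n : ℕ => Complex.arg (x n / v)) atTop (𝓝 0) := by
    have h3 := h1.const_mul (-(k : ℝ)⁻¹)
    rw [mul_zero] at h3
    refine h3.congr' ?_
    filter_upwards [hx0, hx, eventually_gt_atTop 0] with n hn0 hn hnpos
    have : approxCoord k a (x n) / n = ((n : ℝ)⁻¹ : ℝ) * approxCoord k a (x n) := by
      push_cast
      ring
    rw [this, Complex.arg_real_mul _ (by positivity), arg_approxCoord hv hk ha hn0 hn]
    field_simp
  have h4 : Tendsto (fun n : ℕ => v * Complex.exp (Complex.arg (x n / v) * Complex.I)) atTop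
      (𝓝 v) := by
    have : Continuous fun s : ℝ => v * Complex.exp (s * Complex.I) := by fun_prop
    simpa [Function.comp_def] using (this.tendsto 0).comp h2
  refine h4.congr' ?_
  filter_upwards [hx0] with n hn
  have h5 := Complex.norm_mul_exp_arg_mul_I (x n / v)
  rw [norm_div, hv.norm_eq_one, div_one] at h5
  have h6 : (‖x n‖ : ℂ) ≠ 0 := by exact_mod_cast norm_ne_zero_iff.2 hn
  have hv0 := hv.ne_zero
  rw [eq_div_iff hv0] at h5
  rw [eq_div_iff h6]
  linear_combination h5

end Petal

/-! ### The basin of a petal and the sectorial Fatou coordinate -/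

section Basin

variable {f : ℂ → ℂ} {k : ℕ} {a v : ℂ} {r L : ℝ}

/-- The points with `re w > -L` whose orbits stay in the punctured disc of radius `r` and reach the
petal in the direction `v`. -/
def basin (f : ℂ → ℂ) (k : ℕ) (a v : ℂ) (r L : ℝ) : Set ℂ :=
  {x | x ∈ puncturedStableSet f r ∧ (∃ n, f^[n] x ∈ petal k a v r) ∧ -L < (approxCoord k a x).re}

theorem AdaptedDisc.differentiableAt_iterate (hD : AdaptedDisc f k a r) {x : ℂ} (n : ℕ)
    (hx : ∀ j < n, f^[j] x ∈ Metric.ball (0 : ℂ) r) : DifferentiableAt ℂ f^[n] x := by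
  induction n with
  | zero => exact differentiableAt_id
  | succ n ih =>
    rw [Function.iterate_succ']
    exact (hD.differentiableAt _ (hx n (Nat.lt_succ_self n))).comp x
      (ih fun j hj => hx j (hj.trans (Nat.lt_succ_self n)))

theorem AdaptedDisc.iterate_mem_petal (hD : AdaptedDisc f k a r)
    (hv : IsAttractingDirection k a v) {x : ℂ} {n m : ℕ} (hx : f^[n] x ∈ petal k a v r)
    (hnm : n ≤ m) : f^[m] x ∈ petal k a v r := by
  obtain ⟨j, rfl⟩ := Nat.exists_eq_add_of_le' hnm
  rw [Function.iterate_add_apply]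
  exact (hD.mapsTo_petal hv).iterate j hx

theorem AdaptedDisc.mem_puncturedStableSet_of_le (hD : AdaptedDisc f k a r)
    (hv : IsAttractingDirection k a v) {x : ℂ} {n : ℕ}
    (hx : ∀ j < n, f^[j] x ∈ Metric.ball (0 : ℂ) r ∧ f^[j] x ≠ 0)
    (hn : f^[n] x ∈ petal k a v r) : x ∈ puncturedStableSet f r := by
  intro m
  rcases lt_or_ge m n with h | h
  · exact hx m h
  · have := hD.iterate_mem_petal hv hn h
    exact ⟨hD.petal_subset_ball this, this.1⟩

/-- Once an orbit has entered the invariant petal nothing more has to be checked, so membership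
amounts locally to finitely many open conditions. -/
theorem AdaptedDisc.isOpen_basin (hD : AdaptedDisc f k a r) (hv : IsAttractingDirection k a v) :
    IsOpen (basin f k a v r L) := by
  rw [isOpen_iff_mem_nhds]
  rintro x ⟨hx, ⟨n, hn⟩, hL⟩
  have hc : ∀ j, ContinuousAt f^[j] x := fun j =>
    (hD.differentiableAt_iterate j fun i _ => (hx i).1).continuousAt
  have h1 : ∀ᶠ y in 𝓝 x, ∀ j ∈ Finset.range n,
      f^[j] y ∈ Metric.ball (0 : ℂ) r ∧ f^[j] y ≠ 0 := by
    rw [eventually_all_finset]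
    intro j _
    exact ((hc j).eventually (Metric.isOpen_ball.mem_nhds (hx j).1)).and
      ((hc j).eventually_ne (hx j).2)
  have h2 := (hc n).eventually ((hD.isOpen_petal hv).mem_nhds hn)
  have h3 : ContinuousAt (fun y => (approxCoord k a y).re) x :=
    Complex.continuous_re.continuousAt.comp
      (continuousAt_approxCoord hD.k_pos hD.a_ne_zero (hx 0).2)
  filter_upwards [h1, h2, continuousAt_const.eventually_lt h3 hL] with y hy1 hy2 hy3
  exact ⟨hD.mem_puncturedStableSet_of_le hv (fun j hj => hy1 j (Finset.mem_range.2 hj)) hy2,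
    ⟨n, hy2⟩, hy3⟩

theorem AdaptedDisc.mapsTo_basin (hD : AdaptedDisc f k a r) (hv : IsAttractingDirection k a v) :
    Set.MapsTo f (basin f k a v r L) (basin f k a v r L) := by
  rintro x ⟨hx, ⟨n, hn⟩, hL⟩
  refine ⟨iterate_mem_puncturedStableSet hx 1, ⟨n, ?_⟩, ?_⟩
  · rw [← Function.iterate_succ_apply]
    exact hD.iterate_mem_petal hv hn (Nat.le_succ n)
  · have := hD.re_le_re_step (hx 0).1 (hx 0).2
    simp only [Function.iterate_zero, id] at this
    linarith

theorem AdaptedDisc.petal_subset_basin (hD : AdaptedDisc f k a r)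
    (hv : IsAttractingDirection k a v) (hL : 0 ≤ L) : petal k a v r ⊆ basin f k a v r L :=
  fun x hx => ⟨hD.petal_subset_puncturedStableSet hv hx, ⟨0, hx⟩, by
    have := hD.coordBound_pos
    linarith [hx.2.2]⟩

/-! ### The branch of the logarithm on the basin -/

/-- The branch of the logarithm obtained by pulling back `n` times the branch on the petal. -/
def logPullback (f : ℂ → ℂ) (v : ℂ) (n : ℕ) (x : ℂ) : ℂ :=
  Complex.log (f^[n] x / v) + Complex.log v
    - ∑ j ∈ Finset.range n, Complex.log (f^[j + 1] x / f^[j] x)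

/-- The branch of the logarithm on the basin. -/
def basinLog (f : ℂ → ℂ) (v x : ℂ) : ℂ := limUnder atTop fun n => logPullback f v n x

/-- In the petal the arguments of x/v and f(x)/x are both below π/2 in modulus, so principal
logarithms add. The sequence of pullbacks is thus eventually constant, and the limit in `basinLog`
is attained. -/
theorem AdaptedDisc.logPullback_succ (hD : AdaptedDisc f k a r)
    (hv : IsAttractingDirection k a v) {x : ℂ} {n : ℕ} (hn : f^[n] x ∈ petal k a v r) :
    logPullback f v (n + 1) x = logPullback f v n x := by
  rw [logPullback, logPullback, Finset.sum_range_succ]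
  have hb := hD.petal_subset_ball hn
  have h1 : f^[n + 1] x / v = (f^[n] x / v) * (f^[n + 1] x / f^[n] x) := by
    have := hn.1
    field_simp
  have h2 : f^[n + 1] x = f (f^[n] x) := Function.iterate_succ_apply' f n x
  have hle := pi_div_le hD.k_pos
  have h3 := abs_lt.1 hn.2.1
  have h4 := abs_lt.1 (hD.abs_arg_lt _ hb hn.1)
  rw [← h2] at h4
  rw [h1, Complex.log_mul (div_ne_zero hn.1 hv.ne_zero)
    (div_ne_zero (by rw [h2]; exact hD.ne_zero _ hb hn.1) hn.1) ⟨by linarith, by linarith⟩]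
  ring

theorem AdaptedDisc.basinLog_eq (hD : AdaptedDisc f k a r) (hv : IsAttractingDirection k a v)
    {x : ℂ} {n : ℕ} (hn : f^[n] x ∈ petal k a v r) : basinLog f v x = logPullback f v n x := by
  refine Tendsto.limUnder_eq (tendsto_const_nhds.congr' ?_)
  filter_upwards [eventually_ge_atTop n] with m hm
  induction m, hm using Nat.le_induction with
  | base => rfl
  | succ m hm ih => rw [hD.logPullback_succ hv (hD.iterate_mem_petal hv hn hm), ih]

theorem AdaptedDisc.exp_basinLog (hD : AdaptedDisc f k a r) (hv : IsAttractingDirection k a v)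
    {x : ℂ} (hx : x ∈ basin f k a v r L) : Complex.exp (basinLog f v x) = x := by
  obtain ⟨hxs, ⟨n, hn⟩, -⟩ := hx
  rw [hD.basinLog_eq hv hn, logPullback, Complex.exp_sub, Complex.exp_add,
    Complex.exp_log (div_ne_zero hn.1 hv.ne_zero), Complex.exp_log hv.ne_zero, Complex.exp_sum,
    Finset.prod_congr rfl fun j _ => Complex.exp_log (div_ne_zero (hxs (j + 1)).2 (hxs j).2),
    div_mul_cancel₀ _ hv.ne_zero]
  have : ∏ j ∈ Finset.range n, f^[j + 1] x / f^[j] x = f^[n] x / x := by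
    clear hn
    induction n with
    | zero => simpa using (div_self (hxs 0).2).symm
    | succ n ih =>
      have := (hxs n).2
      rw [Finset.prod_range_succ, ih]
      field_simp
  have h0 : x ≠ 0 := (hxs 0).2
  have := hn.1
  rw [‹∏ j ∈ Finset.range n, f^[j + 1] x / f^[j] x = f^[n] x / x›]
  field_simp

theorem AdaptedDisc.basinLog_apply (hD : AdaptedDisc f k a r) (hv : IsAttractingDirection k a v)
    {x : ℂ} (hx : x ∈ basin f k a v r L) :
    basinLog f v (f x) = basinLog f v x + Complex.log (f x / x) := by
  obtain ⟨hxs, ⟨n, hn⟩, -⟩ := hx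
  have hn1 := hD.iterate_mem_petal hv hn (Nat.le_succ n)
  rw [hD.basinLog_eq hv (n := n) (x := f x) (by rwa [← Function.iterate_succ_apply]),
    hD.basinLog_eq hv hn1, logPullback, logPullback, Finset.sum_range_succ']
  simp only [Function.iterate_succ_apply, Function.iterate_zero, id]
  ring

theorem AdaptedDisc.log_div_differentiableAt (hD : AdaptedDisc f k a r) {x : ℂ}
    (hx : x ∈ Metric.ball (0 : ℂ) r) (hx0 : x ≠ 0) :
    DifferentiableAt ℂ (fun y => Complex.log (f y / y)) x :=
  ((hD.differentiableAt x hx).div differentiableAt_id hx0).clog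
    (mem_slitPlane_of_abs_arg_lt hD.k_pos (div_ne_zero (hD.ne_zero x hx hx0) hx0)
      (hD.abs_arg_lt x hx hx0))

theorem AdaptedDisc.basinLog_differentiableAt (hD : AdaptedDisc f k a r)
    (hv : IsAttractingDirection k a v) {x : ℂ} (hx : x ∈ basin f k a v r L) :
    DifferentiableAt ℂ (basinLog f v) x := by
  obtain ⟨hxs, ⟨n, hn⟩, -⟩ := hx
  have hd : ∀ j, DifferentiableAt ℂ f^[j] x := fun j =>
    hD.differentiableAt_iterate j fun i _ => (hxs i).1
  have h1 : basinLog f v =ᶠ[𝓝 x] logPullback f v n := by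
    filter_upwards [(hd n).continuousAt.eventually ((hD.isOpen_petal hv).mem_nhds hn)] with y hy
    exact hD.basinLog_eq hv hy
  refine DifferentiableAt.congr_of_eventuallyEq ?_ h1
  unfold logPullback
  refine DifferentiableAt.sub (DifferentiableAt.add_const _ ?_) ?_
  · exact ((hd n).div_const v).clog
      (mem_slitPlane_of_abs_arg_lt hD.k_pos (div_ne_zero hn.1 hv.ne_zero) hn.2.1)
  · refine DifferentiableAt.fun_sum fun j _ => ?_
    have := (hD.log_div_differentiableAt (hxs j).1 (hxs j).2).comp x (hd j)
    refine this.congr_of_eventuallyEq (Eventually.of_forall fun y => ?_)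
    simp only [Function.comp, Function.iterate_succ_apply']

/-! ### Bounds along the orbits -/

theorem AdaptedDisc.norm_iterate_pow_le (hD : AdaptedDisc f k a r) (hL : 0 ≤ L) {x : ℂ}
    (hx : x ∈ basin f k a v r L) (n : ℕ) :
    ‖f^[n] x‖ ^ k ≤ (k * ‖a‖ * (escapeRate k a r L * (‖approxCoord k a x‖ + n)))⁻¹ := by
  have hk : (0 : ℝ) < k := by exact_mod_cast hD.k_pos
  have ha : 0 < ‖a‖ := norm_pos_iff.2 hD.a_ne_zero
  have he := hD.escapeRate_pos hL
  have hw : 0 < ‖approxCoord k a x‖ :=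
    hD.coordBound_pos.trans ((hD.coordBound_lt_iff (hx.1 0).2).2 (hx.1 0).1)
  rw [norm_pow_eq hD.k_pos hD.a_ne_zero]
  have := hD.escapeRate_mul_le hL hx.1 hx.2.2.le n
  gcongr

/-- A summable majorant of `‖f^[n] x‖ ^ (k + k)` on the basin. -/
def orbitMajorant (k : ℕ) (a : ℂ) (r L : ℝ) (n : ℕ) : ℝ :=
  ((k * ‖a‖ * (escapeRate k a r L * (coordBound k a r + n)))⁻¹) ^ 2

/-- The exponent 2k produces a majorant of size n^(-2) independent of x. This is why `basinFatou`
truncates at k + k terms, where the Abel error is O(x^(2k)). -/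
theorem AdaptedDisc.norm_iterate_pow_le_majorant (hD : AdaptedDisc f k a r) (hL : 0 ≤ L) {x : ℂ}
    (hx : x ∈ basin f k a v r L) (n : ℕ) :
    ‖f^[n] x‖ ^ (k + k) ≤ orbitMajorant k a r L n := by
  have hk : (0 : ℝ) < k := by exact_mod_cast hD.k_pos
  have ha : 0 < ‖a‖ := norm_pos_iff.2 hD.a_ne_zero
  have he := hD.escapeRate_pos hL
  have hC := hD.coordBound_pos
  have hw := ((hD.coordBound_lt_iff (hx.1 0).2).2 (hx.1 0).1).le
  simp only [Function.iterate_zero, id] at hw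
  rw [← two_mul, mul_comm 2 k, pow_mul, orbitMajorant]
  refine pow_le_pow_left₀ (by positivity) ((hD.norm_iterate_pow_le hL hx n).trans ?_) 2
  gcongr

theorem AdaptedDisc.summable_orbitMajorant (hD : AdaptedDisc f k a r) :
    Summable (orbitMajorant k a r L) := by
  have hC := hD.coordBound_pos
  have h1 : Summable fun n : ℕ => 1 / |(n : ℝ) + coordBound k a r| ^ (2 : ℝ) :=
    (Real.summable_one_div_nat_add_rpow _ 2).2 (by norm_num)
  have h2 := h1.mul_left (((k * ‖a‖ * escapeRate k a r L)⁻¹) ^ 2)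
  refine h2.congr fun n => ?_
  rw [abs_of_pos (by positivity), orbitMajorant, Real.rpow_two, one_div, ← inv_pow, ← mul_pow,
    ← mul_inv]
  ring

theorem AdaptedDisc.norm_iterate_le (hD : AdaptedDisc f k a r) (hL : 0 ≤ L) {x : ℂ}
    (hx : x ∈ basin f k a v r L) (n : ℕ) :
    ‖f^[n] x‖ ≤ (1 + (escapeRate k a r L)⁻¹) * ‖x‖ := by
  have hk : (0 : ℝ) < k := by exact_mod_cast hD.k_pos
  have ha : 0 < ‖a‖ := norm_pos_iff.2 hD.a_ne_zero
  have he := hD.escapeRate_pos hL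
  have hw : 0 < ‖approxCoord k a x‖ :=
    hD.coordBound_pos.trans ((hD.coordBound_lt_iff (hx.1 0).2).2 (hx.1 0).1)
  refine (pow_le_pow_iff_left₀ (norm_nonneg _) (by positivity) hD.k_pos.ne').1 ?_
  calc ‖f^[n] x‖ ^ k
      ≤ (k * ‖a‖ * (escapeRate k a r L * (‖approxCoord k a x‖ + n)))⁻¹ :=
        hD.norm_iterate_pow_le hL hx n
    _ ≤ (k * ‖a‖ * (escapeRate k a r L * (‖approxCoord k a x‖ + 0)))⁻¹ := by
        gcongr
        positivity
    _ = (escapeRate k a r L)⁻¹ * ‖x‖ ^ k := by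
        rw [norm_pow_eq hD.k_pos hD.a_ne_zero x, ← mul_inv]
        ring
    -- The crude bound c ≤ (1 + c)^k avoids extracting a k-th root of the constant.
    _ ≤ (1 + (escapeRate k a r L)⁻¹) ^ k * ‖x‖ ^ k := by
        gcongr
        refine le_trans ?_ (le_self_pow₀ (by linarith [inv_pos.2 he]) hD.k_pos.ne')
        linarith
    _ = _ := by rw [mul_pow]

/-! ### The sectorial Fatou coordinate -/

variable {ρ : ℂ} {h : PowerSeries ℂ}

/-- The sectorial Fatou coordinate on the basin, up to a constant. -/
def basinFatou (f : ℂ → ℂ) (k : ℕ) (v ρ : ℂ) (h : PowerSeries ℂ) (x : ℂ) : ℂ :=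
  truncation k ρ h (basinLog f v) (k + k) x + ∑' n, abelError f k ρ h (k + k) (f^[n] x)

theorem AdaptedDisc.truncation_apply (hD : AdaptedDisc f k a r)
    (hv : IsAttractingDirection k a v) {x : ℂ} (hx : x ∈ basin f k a v r L) (n : ℕ) :
    truncation k ρ h (basinLog f v) n (f x)
      = truncation k ρ h (basinLog f v) n x + 1 + abelError f k ρ h n x := by
  rw [truncation, truncation, abelError, hD.basinLog_apply hv hx]
  simp only [mul_sub, Finset.sum_sub_distrib]
  ring

theorem AdaptedDisc.zpow_differentiableAt {x : ℂ} (hx0 : x ≠ 0) (j : ℤ) :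
    DifferentiableAt ℂ (fun y : ℂ => y ^ j) x :=
  (differentiableAt_zpow).2 (Or.inl hx0)

theorem AdaptedDisc.abelError_differentiableAt (hD : AdaptedDisc f k a r) {x : ℂ}
    (hx : x ∈ Metric.ball (0 : ℂ) r) (hx0 : x ≠ 0) (n : ℕ) :
    DifferentiableAt ℂ (abelError f k ρ h n) x := by
  unfold abelError
  refine ((DifferentiableAt.fun_sum fun i _ => ?_).add
    ((hD.log_div_differentiableAt hx hx0).const_mul ρ)).sub_const 1
  refine (DifferentiableAt.sub ?_ (zpow_differentiableAt hx0 _)).const_mul _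
  have := zpow_differentiableAt (hD.ne_zero x hx hx0) ((i : ℤ) - (k : ℤ))
  exact this.comp x (hD.differentiableAt x hx)

theorem AdaptedDisc.truncation_differentiableAt (hD : AdaptedDisc f k a r)
    (hv : IsAttractingDirection k a v) {x : ℂ} (hx : x ∈ basin f k a v r L) (n : ℕ) :
    DifferentiableAt ℂ (truncation k ρ h (basinLog f v) n) x := by
  unfold truncation
  refine (DifferentiableAt.fun_sum fun i _ => ?_).add
    ((hD.basinLog_differentiableAt hv hx).const_mul ρ)
  exact (zpow_differentiableAt (hx.1 0).2 _).const_mul _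

variable {M : ℝ}

theorem AdaptedDisc.norm_abelError_iterate_le (hD : AdaptedDisc f k a r) (hL : 0 ≤ L) (hM : 0 ≤ M)
    (hE : ∀ x ∈ Metric.ball (0 : ℂ) r, x ≠ 0 → ‖abelError f k ρ h (k + k) x‖ ≤ M * ‖x‖ ^ (k + k))
    {x : ℂ} (hx : x ∈ basin f k a v r L) (n : ℕ) :
    ‖abelError f k ρ h (k + k) (f^[n] x)‖ ≤ M * orbitMajorant k a r L n :=
  (hE _ (hx.1 n).1 (hx.1 n).2).trans
    (mul_le_mul_of_nonneg_left (hD.norm_iterate_pow_le_majorant hL hx n) hM)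

theorem AdaptedDisc.summable_abelError (hD : AdaptedDisc f k a r) (hL : 0 ≤ L) (hM : 0 ≤ M)
    (hE : ∀ x ∈ Metric.ball (0 : ℂ) r, x ≠ 0 → ‖abelError f k ρ h (k + k) x‖ ≤ M * ‖x‖ ^ (k + k))
    {x : ℂ} (hx : x ∈ basin f k a v r L) :
    Summable fun n => abelError f k ρ h (k + k) (f^[n] x) :=
  Summable.of_norm_bounded (hD.summable_orbitMajorant.mul_left M)
    (hD.norm_abelError_iterate_le hL hM hE hx)

theorem AdaptedDisc.basinFatou_differentiableOn (hD : AdaptedDisc f k a r)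
    (hv : IsAttractingDirection k a v) (hL : 0 ≤ L) (hM : 0 ≤ M)
    (hE : ∀ x ∈ Metric.ball (0 : ℂ) r, x ≠ 0 → ‖abelError f k ρ h (k + k) x‖ ≤ M * ‖x‖ ^ (k + k)) :
    DifferentiableOn ℂ (basinFatou f k v ρ h) (basin f k a v r L) := by
  refine DifferentiableOn.add
    (fun x hx => (hD.truncation_differentiableAt hv hx _).differentiableWithinAt) ?_
  refine Complex.differentiableOn_tsum_of_summable_norm
    (hD.summable_orbitMajorant (L := L) |>.mul_left M) (fun n x hx => ?_) (hD.isOpen_basin hv)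
    fun n x hx => hD.norm_abelError_iterate_le hL hM hE hx n
  exact ((hD.abelError_differentiableAt (hx.1 n).1 (hx.1 n).2 _).comp x
    (hD.differentiableAt_iterate n fun j _ => (hx.1 j).1)).differentiableWithinAt

theorem AdaptedDisc.basinFatou_apply (hD : AdaptedDisc f k a r)
    (hv : IsAttractingDirection k a v) (hL : 0 ≤ L) (hM : 0 ≤ M)
    (hE : ∀ x ∈ Metric.ball (0 : ℂ) r, x ≠ 0 → ‖abelError f k ρ h (k + k) x‖ ≤ M * ‖x‖ ^ (k + k))
    {x : ℂ} (hx : x ∈ basin f k a v r L) :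
    basinFatou f k v ρ h (f x) = basinFatou f k v ρ h x + 1 := by
  have h1 := (hD.summable_abelError hL hM hE hx).tsum_eq_zero_add
  rw [basinFatou, basinFatou, h1, hD.truncation_apply hv hx]
  simp only [Function.iterate_succ_apply, Function.iterate_zero, id]
  ring

theorem truncation_add (k : ℕ) (ρ : ℂ) (h : PowerSeries ℂ) (ℓ : ℂ → ℂ) (n m : ℕ) (x : ℂ) :
    truncation k ρ h ℓ (k + n + m) x = truncation k ρ h ℓ (k + n) x
      + ∑ j ∈ Finset.range m, PowerSeries.coeff (k + n + j) h * x ^ (n + j) := by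
  rw [truncation, truncation, Finset.sum_range_add]
  have : ∀ j ∈ Finset.range m, PowerSeries.coeff (k + n + j) h
      * x ^ (((k + n + j : ℕ) : ℤ) - (k : ℤ)) = PowerSeries.coeff (k + n + j) h * x ^ (n + j) := by
    intro j _
    have : ((k + n + j : ℕ) : ℤ) - (k : ℤ) = ((n + j : ℕ) : ℤ) := by push_cast; ring
    rw [this, zpow_natCast]
  rw [Finset.sum_congr rfl this]
  ring

theorem norm_tsum_abelError_le (hD : AdaptedDisc f k a r) (hL : 0 ≤ L) (hM : 0 ≤ M)
    (hE : ∀ x ∈ Metric.ball (0 : ℂ) r, x ≠ 0 → ‖abelError f k ρ h (k + k) x‖ ≤ M * ‖x‖ ^ (k + k))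
    {x : ℂ} (hx : x ∈ basin f k a v r L) :
    ‖∑' n, abelError f k ρ h (k + k) (f^[n] x)‖ ≤ ∑' n, M * orbitMajorant k a r L n :=
  tsum_of_norm_bounded (hD.summable_orbitMajorant.mul_left M).hasSum
    (hD.norm_abelError_iterate_le hL hM hE hx)

theorem AdaptedDisc.basinFatou_bounded (hD : AdaptedDisc f k a r) (hL : 0 ≤ L) (hM : 0 ≤ M)
    (hE : ∀ x ∈ Metric.ball (0 : ℂ) r, x ≠ 0 → ‖abelError f k ρ h (k + k) x‖ ≤ M * ‖x‖ ^ (k + k)) :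
    ∃ B : ℝ, ∀ x ∈ basin f k a v r L,
      ‖basinFatou f k v ρ h x - truncation k ρ h (basinLog f v) k x‖ ≤ B := by
  refine ⟨∑ j ∈ Finset.range k, ‖PowerSeries.coeff (k + j) h‖ * r ^ j
    + ∑' n, M * orbitMajorant k a r L n, fun x hx => ?_⟩
  have h1 := truncation_add k ρ h (basinLog f v) 0 k x
  simp only [zero_add, add_zero] at h1
  rw [basinFatou, h1]
  have h2 : ∀ A B C : ℂ, A + B + C - A = B + C := fun A B C => by ring
  rw [h2]
  refine (norm_add_le _ _).trans (add_le_add ?_ (norm_tsum_abelError_le hD hL hM hE hx))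
  refine norm_sum_le_of_le _ fun j _ => ?_
  rw [norm_mul, norm_pow]
  have h3 := (mem_ball_zero_iff.1 (hx.1 0).1).le
  simp only [Function.iterate_zero, id] at h3
  gcongr

/-- The extra terms p of the longer truncation vanish at 0, so their increments along an orbit
tending to 0 telescope to -p(x). This exactly offsets the change of the truncation. -/
theorem AdaptedDisc.basinFatou_eq (hD : AdaptedDisc f k a r) (hv : IsAttractingDirection k a v)
    (hL : 0 ≤ L) (hM : 0 ≤ M)
    (hE : ∀ x ∈ Metric.ball (0 : ℂ) r, x ≠ 0 → ‖abelError f k ρ h (k + k) x‖ ≤ M * ‖x‖ ^ (k + k))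
    {x : ℂ} (hx : x ∈ basin f k a v r L) {N : ℕ}
    (hs : Summable fun n => abelError f k ρ h (k + k + N) (f^[n] x)) :
    basinFatou f k v ρ h x = truncation k ρ h (basinLog f v) (k + k + N) x
      + ∑' n, abelError f k ρ h (k + k + N) (f^[n] x) := by
  set p : ℂ → ℂ := fun y => ∑ j ∈ Finset.range N, PowerSeries.coeff (k + k + j) h * y ^ (k + j)
    with hp
  have hs0 := hD.summable_abelError hL hM hE hx
  have hmem : ∀ n, f^[n] x ∈ basin f k a v r L := fun n => (hD.mapsTo_basin hv).iterate n hx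
  have hstep : ∀ n, abelError f k ρ h (k + k + N) (f^[n] x)
      - abelError f k ρ h (k + k) (f^[n] x) = p (f^[n + 1] x) - p (f^[n] x) := by
    intro n
    have h1 := hD.truncation_apply (ρ := ρ) (h := h) hv (hmem n) (k + k + N)
    have h2 := hD.truncation_apply (ρ := ρ) (h := h) hv (hmem n) (k + k)
    rw [← Function.iterate_succ_apply' f] at h1 h2
    rw [truncation_add k ρ h _ k N, truncation_add k ρ h _ k N] at h1
    simp only [hp]
    linear_combination -h1 + h2
  have hlim : Tendsto (fun m => p (f^[m] x) - p x) atTop (𝓝 (-p x)) := by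
    have hp0 : p 0 = 0 := Finset.sum_eq_zero fun j _ => by
      rw [zero_pow (by have := hD.k_pos; omega), mul_zero]
    have hpc : Continuous p := by fun_prop
    have := ((hpc.tendsto 0).comp (hD.tendsto_iterate hx.1)).sub_const (p x)
    rwa [hp0, zero_sub] at this
  have hsum := (hs.hasSum.sub hs0.hasSum).tendsto_sum_nat
  have hpart : ∀ m, ∑ n ∈ Finset.range m, (abelError f k ρ h (k + k + N) (f^[n] x)
      - abelError f k ρ h (k + k) (f^[n] x)) = p (f^[m] x) - p x := by
    intro m
    rw [Finset.sum_congr rfl fun n _ => hstep n,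
      Finset.sum_range_sub (fun n => p (f^[n] x))]
    rfl
  have huniq := tendsto_nhds_unique (hsum.congr hpart) hlim
  rw [basinFatou, truncation_add k ρ h _ k N]
  simp only [hp] at huniq ⊢
  linear_combination -huniq

/-- Rewritten with the truncation at k + k + N, the n-th error is bounded by a constant times |f^n
x|^(2k) |f^n x|^N. The first factor is summable uniformly in x and the second is O(|x|^N). The k
terms between the truncations at k + N and k + k + N are O(x^N) as well. -/
theorem AdaptedDisc.basinFatou_isBigO (hD : AdaptedDisc f k a r)
    (hv : IsAttractingDirection k a v) (hL : 0 ≤ L) (hM : 0 ≤ M)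
    (hE : ∀ x ∈ Metric.ball (0 : ℂ) r, x ≠ 0 → ‖abelError f k ρ h (k + k) x‖ ≤ M * ‖x‖ ^ (k + k))
    (hE' : ∀ N, abelError f k ρ h (k + N) =O[𝓝[≠] 0] fun x => x ^ (k + N)) (N : ℕ) :
    (fun x => basinFatou f k v ρ h x - truncation k ρ h (basinLog f v) (k + N) x)
      =O[𝓝[basin f k a v r L] 0] fun x => x ^ N := by
  obtain ⟨M', hM', hB⟩ := (hE' (k + N)).exists_nonneg
  rw [← add_assoc] at hB
  obtain ⟨ε, hε, hεB⟩ := Metric.eventually_nhds_iff_ball.1 (eventually_nhdsWithin_iff.1 hB.bound)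
  set κ := 1 + (escapeRate k a r L)⁻¹ with hκ
  have hκ0 : 0 < κ := by
    have := inv_pos.2 (hD.escapeRate_pos hL)
    linarith
  set S := ∑' n, orbitMajorant k a r L n with hS
  have hmain : (fun x => basinFatou f k v ρ h x
      - truncation k ρ h (basinLog f v) (k + k + N) x)
      =O[𝓝[basin f k a v r L] 0] fun x => x ^ N := by
    refine IsBigO.of_bound (M' * κ ^ N * S) ?_
    have hball : ∀ᶠ x in 𝓝[basin f k a v r L] (0 : ℂ), ‖x‖ < ε / κ :=
      nhdsWithin_le_nhds (by
        filter_upwards [Metric.ball_mem_nhds (0 : ℂ) (div_pos hε hκ0)] with x hx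
        simpa using hx)
    filter_upwards [self_mem_nhdsWithin, hball] with x hx hxε
    have hbound : ∀ n, ‖abelError f k ρ h (k + k + N) (f^[n] x)‖
        ≤ M' * κ ^ N * ‖x‖ ^ N * orbitMajorant k a r L n := by
      intro n
      have h1 := hD.norm_iterate_le hL hx n
      have h2 : ‖f^[n] x‖ < ε := by
        refine h1.trans_lt ?_
        rw [lt_div_iff₀ hκ0] at hxε
        linarith
      have h3 := hεB _ (by simpa using h2) (hx.1 n).2
      rw [norm_pow, pow_add ‖f^[n] x‖ (k + k) N] at h3
      have h4 := hD.norm_iterate_pow_le_majorant hL hx n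
      have h6 : 0 ≤ orbitMajorant k a r L n := sq_nonneg _
      have h5 : ‖f^[n] x‖ ^ N ≤ κ ^ N * ‖x‖ ^ N := by
        rw [← mul_pow]
        exact pow_le_pow_left₀ (norm_nonneg _) h1 N
      calc _ ≤ M' * (‖f^[n] x‖ ^ (k + k) * ‖f^[n] x‖ ^ N) := h3
        _ ≤ M' * (orbitMajorant k a r L n * (κ ^ N * ‖x‖ ^ N)) := by gcongr
        _ = _ := by ring
    have hsm := (hD.summable_orbitMajorant (L := L)).mul_left (M' * κ ^ N * ‖x‖ ^ N)
    have hs : Summable fun n => abelError f k ρ h (k + k + N) (f^[n] x) :=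
      Summable.of_norm_bounded hsm hbound
    rw [hD.basinFatou_eq hv hL hM hE hx hs, add_sub_cancel_left]
    refine (tsum_of_norm_bounded hsm.hasSum hbound).trans (le_of_eq ?_)
    rw [tsum_mul_left, norm_pow]
    ring
  have hpoly : (fun x : ℂ => ∑ j ∈ Finset.range k, PowerSeries.coeff (k + N + j) h * x ^ (N + j))
      =O[𝓝[basin f k a v r L] 0] fun x => x ^ N := by
    refine IsBigO.fun_sum fun j _ => IsBigO.const_mul_left ?_ _
    have h1 : (fun x : ℂ => x ^ j) =O[𝓝[basin f k a v r L] 0] fun _ => (1 : ℂ) :=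
      (((continuous_pow j).tendsto (0 : ℂ)).mono_left nhdsWithin_le_nhds).isBigO_one ℂ
    simpa [pow_add] using (isBigO_refl (fun x : ℂ => x ^ N) _).mul h1
  refine (hmain.add hpoly).congr' ?_ EventuallyEq.rfl
  filter_upwards [self_mem_nhdsWithin] with x hx
  have h1 := truncation_add k ρ h (basinLog f v) N k x
  have h2 : k + N + k = k + k + N := by ring
  rw [h2] at h1
  rw [h1]
  ring

end Basin

/-! ### Neighbouring orbits -/

section Neighbour

variable {f : ℂ → ℂ} {k : ℕ} {a v : ℂ} {r₀ r s₀ η K Q : ℝ}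

/-- The constants that control the distance of neighbouring orbits in an adapted disc. -/
structure ControlledDisc (f : ℂ → ℂ) (k : ℕ) (a : ℂ) (r₀ s₀ η K Q : ℝ) : Prop
    extends AdaptedDisc f k a r₀ where
  s_le : s₀ ≤ 1 / 2
  η_pos : 0 < η
  K_nonneg : 0 ≤ K
  Q_nonneg : 0 ≤ Q
  abs_arg_one_add_lt : ∀ s : ℂ, ‖s‖ ≤ s₀ → |Complex.arg (1 + s)| < Real.pi / (2 * k)
  norm_le : ∀ s : ℂ, ‖s‖ ≤ s₀ → ‖s‖ ≤ 2 * ‖((1 + s) ^ k)⁻¹ - 1‖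
  le_norm : ∀ s : ℂ, ‖s‖ ≤ s₀ → ‖((1 + s) ^ k)⁻¹ - 1‖ ≤ 2 * k * ‖s‖
  norm_ratio_le : ∀ s p p' : ℂ, ‖s‖ < η → ‖p - 1‖ < η → ‖p' - 1‖ < η →
    ‖(1 + s) * p / p' - 1‖ ≤ s₀
  norm_div_sub_one_lt : ∀ x ∈ Metric.ball (0 : ℂ) r₀, x ≠ 0 → ‖f x / x - 1‖ < η
  norm_div_sub_one_le : ∀ x ∈ Metric.ball (0 : ℂ) r₀, x ≠ 0 → ‖f x / x - 1‖ ≤ Q * ‖x‖ ^ k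
  lipschitz : ∀ x ∈ Metric.ball (0 : ℂ) r₀, x ≠ 0 → ∀ y ∈ Metric.ball (0 : ℂ) r₀, y ≠ 0 →
    ‖(approxCoord k a (f y) - approxCoord k a y) - (approxCoord k a (f x) - approxCoord k a x)‖
      ≤ K * ‖y - x‖

/-- Since 2 Re w grows by more than 1 per step, its integer parts ν_j are distinct integers, and
‖x_j‖^(k+1) = O(|ν_j + 1/2|^(-1-1/k)). Summing over all of ℤ bounds the sum independently of the
starting point, including orbits that begin far to the left. -/
theorem AdaptedDisc.exists_sum_bound (hD : AdaptedDisc f k a r₀) :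
    ∃ S : ℝ, 0 ≤ S ∧ ∀ x ∈ puncturedStableSet f r₀, ∀ n : ℕ,
      ∑ j ∈ Finset.range n, ‖f^[j] x‖ ^ (k + 1) ≤ S := by
  have hk : (0 : ℝ) < k := by exact_mod_cast hD.k_pos
  have ha : 0 < ‖a‖ := norm_pos_iff.2 hD.a_ne_zero
  have hC := hD.coordBound_pos
  set p : ℝ := 1 + 1 / k with hp
  set E : ℝ := (2 + 1 / coordBound k a r₀) / (k * ‖a‖) with hE
  have hE0 : 0 < E := by positivity
  -- The shift by 1/2 keeps the denominator nonzero at every integer.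
  set b : ℤ → ℝ := fun n => E ^ p * (1 / |(n : ℝ) + 1 / 2| ^ p) with hb
  have hbs : Summable b := ((Real.summable_one_div_int_add_rpow (1 / 2) p).2 (by
    rw [hp]; linarith [one_div_pos.2 hk])).mul_left _
  have hb0 : ∀ n, 0 ≤ b n := fun n => by positivity
  refine ⟨∑' n, b n, tsum_nonneg hb0, fun x hx n => ?_⟩
  set ν : ℕ → ℤ := fun j => ⌊2 * (approxCoord k a (f^[j] x)).re⌋ with hν
  have hmono : StrictMono ν := by
    refine strictMono_nat_of_lt_succ fun j => ?_
    have h1 := hD.re_le_re_step (hx j).1 (hx j).2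
    rw [← Function.iterate_succ_apply' f] at h1
    have h2 : 2 * (approxCoord k a (f^[j] x)).re + 1 ≤ 2 * (approxCoord k a (f^[j + 1] x)).re := by
      linarith
    have h3 := Int.floor_le_floor h2
    rw [Int.floor_add_one] at h3
    exact Int.lt_iff_add_one_le.2 h3
  have hterm : ∀ j, ‖f^[j] x‖ ^ (k + 1) ≤ b (ν j) := by
    intro j
    set w := approxCoord k a (f^[j] x) with hw
    have hwC : coordBound k a r₀ < ‖w‖ := (hD.coordBound_lt_iff (hx j).2).2 (hx j).1
    have hw0 : 0 < ‖w‖ := hC.trans hwC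
    have h1 : |(ν j : ℝ) + 1 / 2| ≤ (2 + 1 / coordBound k a r₀) * ‖w‖ := by
      have h2 := Int.floor_le (2 * w.re)
      have h3 := Int.lt_floor_add_one (2 * w.re)
      have h4 := abs_le.1 (Complex.abs_re_le_norm w)
      have h5 : 1 ≤ 1 / coordBound k a r₀ * ‖w‖ := by
        rw [one_div_mul_eq_div, le_div_iff₀ hC]
        linarith
      rw [abs_le, add_mul]
      constructor <;> linarith
    have h6 : 0 < |(ν j : ℝ) + 1 / 2| := by
      rw [abs_pos]
      intro h0
      have : ((2 * ν j + 1 : ℤ) : ℝ) = 0 := by push_cast; linarith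
      have h7 : 2 * ν j + 1 = 0 := by exact_mod_cast this
      omega
    have h8 : ‖f^[j] x‖ ^ k ≤ E / |(ν j : ℝ) + 1 / 2| := by
      rw [norm_pow_eq hD.k_pos hD.a_ne_zero, ← hw, hE, div_div, inv_eq_one_div,
        div_le_div_iff₀ (by positivity) (by positivity), one_mul]
      calc k * ‖a‖ * |(ν j : ℝ) + 1 / 2|
          ≤ k * ‖a‖ * ((2 + 1 / coordBound k a r₀) * ‖w‖) := by gcongr
        _ = _ := by ring
    have h9 : ‖f^[j] x‖ ^ (k + 1) = (‖f^[j] x‖ ^ k) ^ p := by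
      rw [← Real.rpow_natCast, ← Real.rpow_natCast, ← Real.rpow_mul (norm_nonneg _)]
      congr 1
      rw [hp]
      push_cast
      field_simp
    rw [h9]
    refine (Real.rpow_le_rpow (by positivity) h8 (by positivity)).trans (le_of_eq ?_)
    rw [Real.div_rpow hE0.le (abs_nonneg _), hb]
    simp only
    rw [mul_one_div]
  calc ∑ j ∈ Finset.range n, ‖f^[j] x‖ ^ (k + 1)
      ≤ ∑ j ∈ Finset.range n, b (ν j) := Finset.sum_le_sum fun j _ => hterm j
    _ = ∑ i ∈ (Finset.range n).image ν, b i :=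
        (Finset.sum_image fun i _ j _ h => hmono.injective h).symm
    _ ≤ ∑' n, b n := hbs.sum_le_tsum _ fun i _ => hb0 i

theorem approxCoord_mul_one_add (k : ℕ) (a x s : ℂ) :
    approxCoord k a (x * (1 + s)) = approxCoord k a x * ((1 + s) ^ k)⁻¹ := by
  rw [approxCoord, approxCoord, mul_pow, ← mul_assoc, mul_inv, neg_mul]

theorem norm_approxCoord_mul_one_add_sub (k : ℕ) (a x s : ℂ) :
    ‖approxCoord k a (x * (1 + s)) - approxCoord k a x‖
      = ‖approxCoord k a x‖ * ‖((1 + s) ^ k)⁻¹ - 1‖ := by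
  rw [approxCoord_mul_one_add, ← norm_mul, mul_sub, mul_one]

theorem norm_pow_mul_norm_approxCoord (hk : 0 < k) (ha : a ≠ 0) {x : ℂ} (hx : x ≠ 0) :
    ‖x‖ ^ k * ‖approxCoord k a x‖ = (k * ‖a‖)⁻¹ := by
  have h1 : (k : ℝ) ≠ 0 := by exact_mod_cast hk.ne'
  have h2 : ‖a‖ ≠ 0 := norm_ne_zero_iff.2 ha
  have h3 : ‖x‖ ^ k ≠ 0 := pow_ne_zero _ (norm_ne_zero_iff.2 hx)
  rw [norm_approxCoord]
  field_simp

theorem ControlledDisc.norm_le_of_norm_sub (hD : ControlledDisc f k a r₀ s₀ η K Q) {x s : ℂ}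
    (hx : x ≠ 0) (hs : ‖s‖ ≤ s₀) {D : ℝ}
    (h : ‖approxCoord k a (x * (1 + s)) - approxCoord k a x‖ ≤ D) :
    ‖s‖ ≤ 2 * (k * ‖a‖) * ‖x‖ ^ k * D := by
  have hk : (0 : ℝ) < k := by exact_mod_cast hD.k_pos
  have ha : 0 < ‖a‖ := norm_pos_iff.2 hD.a_ne_zero
  have h1 := norm_pow_mul_norm_approxCoord hD.k_pos hD.a_ne_zero hx
  rw [norm_approxCoord_mul_one_add_sub] at h
  have h2 := hD.norm_le s hs
  have h3 := mul_le_mul_of_nonneg_left h (by positivity : 0 ≤ 2 * (k * ‖a‖) * ‖x‖ ^ k)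
  refine h2.trans (le_trans (le_of_eq ?_) h3)
  have h4 : k * ‖a‖ * (‖x‖ ^ k * ‖approxCoord k a x‖) = 1 := by
    rw [h1]; exact mul_inv_cancel₀ (by positivity)
  linear_combination (-2 * ‖((1 + s) ^ k)⁻¹ - 1‖) * h4

theorem one_add_ne_zero_of_norm_le {s : ℂ} (hs : ‖s‖ ≤ 1 / 2) : 1 + s ≠ 0 := by
  intro h
  have : s = -1 := by linear_combination h
  rw [this, norm_neg, norm_one] at hs
  norm_num at hs

/-- Orbits of neighbouring points stay close to each other. -/
theorem ControlledDisc.exists_iterate_eq (hD : ControlledDisc f k a r₀ s₀ η K Q) (hr : r ≤ r₀ / 2)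
    {D₀ S : ℝ} (hD₀ : 0 ≤ D₀)
    (hS : ∀ x ∈ puncturedStableSet f r₀, ∀ n : ℕ,
      ∑ j ∈ Finset.range n, ‖f^[j] x‖ ^ (k + 1) ≤ S)
    (hrη : 2 * (k * ‖a‖) * r ^ k * (D₀ * Real.exp (2 * (k * ‖a‖) * K * S)) < η)
    {x : ℂ} (hx : x ∈ puncturedStableSet f r) {s : ℂ} (hs : ‖s‖ ≤ s₀)
    (hxs : ‖approxCoord k a (x * (1 + s)) - approxCoord k a x‖ ≤ D₀) (n : ℕ) :
    ∃ s', f^[n] (x * (1 + s)) = f^[n] x * (1 + s') ∧ ‖s'‖ ≤ s₀ ∧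
      ‖approxCoord k a (f^[n] x * (1 + s')) - approxCoord k a (f^[n] x)‖
        ≤ D₀ * Real.exp (2 * (k * ‖a‖) * K * ∑ j ∈ Finset.range n, ‖f^[j] x‖ ^ (k + 1)) := by
  have hk : (0 : ℝ) < k := by exact_mod_cast hD.k_pos
  have ha : 0 < ‖a‖ := norm_pos_iff.2 hD.a_ne_zero
  have hr₀ := hD.r_pos
  have hK := hD.K_nonneg
  have hx₀ : x ∈ puncturedStableSet f r₀ := fun n =>
    ⟨Metric.ball_subset_ball (by linarith) (hx n).1, (hx n).2⟩
  induction n with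
  | zero => exact ⟨s, rfl, hs, by simpa using hxs⟩
  | succ n ih =>
    obtain ⟨s', he, hs', hΔ⟩ := ih
    set X := f^[n] x with hX
    set B := D₀ * Real.exp (2 * (k * ‖a‖) * K * ∑ j ∈ Finset.range n, ‖f^[j] x‖ ^ (k + 1)) with hB
    have hB0 : 0 ≤ B := by positivity
    have hX0 : X ≠ 0 := (hx n).2
    have hXr : ‖X‖ < r := mem_ball_zero_iff.1 (hx n).1
    have hr0 : 0 ≤ r := (norm_nonneg _).trans hXr.le
    have h1s := one_add_ne_zero_of_norm_le (hs'.trans hD.s_le)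
    have hY0 : X * (1 + s') ≠ 0 := mul_ne_zero hX0 h1s
    have hYb : X * (1 + s') ∈ Metric.ball (0 : ℂ) r₀ := by
      rw [mem_ball_zero_iff, norm_mul]
      have h2 : ‖1 + s'‖ ≤ 3 / 2 := by
        refine (norm_add_le _ _).trans ?_
        rw [norm_one]
        linarith [hs'.trans hD.s_le]
      calc ‖X‖ * ‖1 + s'‖ ≤ r * (3 / 2) := by gcongr
        _ < r₀ := by linarith
    have hsle := hD.norm_le_of_norm_sub hX0 hs' hΔ
    -- Here r is small enough: the distance in w is at most D₀ times the Grönwall factor, so the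
    -- relative distance s' is that times O(r^k), hence below η. `norm_ratio_le` then returns the
    -- bound s₀ for the next relative distance.
    have hsη : ‖s'‖ < η := by
      refine (hsle.trans ?_).trans_lt hrη
      rw [hB]
      gcongr 2 * (k * ‖a‖) * ?_ ^ k * (D₀ * Real.exp (2 * (k * ‖a‖) * K * ?_))
      exact hS x hx₀ n
    have hXb : X ∈ Metric.ball (0 : ℂ) r₀ := (hx₀ n).1
    set s'' := (1 + s') * (f (X * (1 + s')) / (X * (1 + s'))) / (f X / X) - 1 with hs''
    have hfX := hD.ne_zero X hXb hX0
    have hnext : f (X * (1 + s')) = f X * (1 + s'') := by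
      rw [hs'']
      field_simp
      ring
    refine ⟨s'', ?_, ?_, ?_⟩
    · rw [Function.iterate_succ_apply', Function.iterate_succ_apply', he, hnext]
    · exact hD.norm_ratio_le _ _ _ hsη (hD.norm_div_sub_one_lt _ hYb hY0)
        (hD.norm_div_sub_one_lt _ hXb hX0)
    · rw [Function.iterate_succ_apply', ← hX, ← hnext, Finset.sum_range_succ,
        mul_add (2 * (k * ‖a‖) * K), Real.exp_add, ← mul_assoc, ← hB, ← hX]
      have hlip := hD.lipschitz X hXb hX0 _ hYb hY0
      have h3 : approxCoord k a (f (X * (1 + s'))) - approxCoord k a (f X)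
          = (approxCoord k a (X * (1 + s')) - approxCoord k a X)
          + ((approxCoord k a (f (X * (1 + s'))) - approxCoord k a (X * (1 + s')))
            - (approxCoord k a (f X) - approxCoord k a X)) := by ring
      have h4 : X * (1 + s') - X = X * s' := by ring
      rw [h4, norm_mul] at hlip
      rw [h3]
      -- Discrete Grönwall step: the distance in w is multiplied by at most 1 plus a constant times
      -- ‖X‖^(k+1), which the exponential absorbs.
      calc _ ≤ B + K * (‖X‖ * (2 * (k * ‖a‖) * ‖X‖ ^ k * B)) := by
            refine (norm_add_le _ _).trans (add_le_add hΔ (hlip.trans ?_))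
            gcongr
        _ = B * (2 * (k * ‖a‖) * K * ‖X‖ ^ (k + 1) + 1) := by ring
        _ ≤ B * Real.exp (2 * (k * ‖a‖) * K * ‖X‖ ^ (k + 1)) := by
            gcongr
            exact Real.add_one_le_exp _

/-- The segment between a point of an orbit and its image lies in the basin. -/
theorem ControlledDisc.segment_subset_basin (hD : ControlledDisc f k a r₀ s₀ η K Q)
    (hr : r ≤ r₀ / 2) {S : ℝ}
    (hS : ∀ x ∈ puncturedStableSet f r₀, ∀ n : ℕ,
      ∑ j ∈ Finset.range n, ‖f^[j] x‖ ^ (k + 1) ≤ S)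
    (hrη : 2 * (k * ‖a‖) * r ^ k
      * ((2 * k * Q * (k * ‖a‖)⁻¹) * Real.exp (2 * (k * ‖a‖) * K * S)) < η)
    (hv : IsAttractingDirection k a v) {x : ℂ} (hx : x ∈ puncturedStableSet f r) {N : ℕ}
    (hN : f^[N] x ∈ petal k a v r₀) {L : ℝ}
    (hL : -L + 2 * k * Q * (k * ‖a‖)⁻¹ < (approxCoord k a x).re) :
    segment ℝ x (f x) ⊆ basin f k a v r₀ L := by
  have hk : (0 : ℝ) < k := by exact_mod_cast hD.k_pos
  have ha : 0 < ‖a‖ := norm_pos_iff.2 hD.a_ne_zero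
  have hr₀ := hD.r_pos
  have hQ := hD.Q_nonneg
  -- D₀ bounds the distance in w from x to every point of the segment: it is ‖w‖ · 2k · Q‖x‖^k,
  -- simplified by ‖x‖^k ‖w‖ = (k‖a‖)⁻¹.
  set D₀ := 2 * k * Q * (k * ‖a‖)⁻¹ with hD₀
  have hD₀0 : 0 ≤ D₀ := by positivity
  have hx₀ : x ∈ puncturedStableSet f r₀ := fun n =>
    ⟨Metric.ball_subset_ball (by linarith) (hx n).1, (hx n).2⟩
  have hx0 : x ≠ 0 := (hx 0).2
  have hxb : x ∈ Metric.ball (0 : ℂ) r₀ := (hx₀ 0).1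
  intro y hy
  rw [segment_eq_image'] at hy
  obtain ⟨t, ht, rfl⟩ := hy
  set s : ℂ := t * (f x / x - 1) with hs
  have hys : x + t • (f x - x) = x * (1 + s) := by
    rw [hs, Complex.real_smul]
    field_simp
  have hsn : ‖s‖ ≤ ‖f x / x - 1‖ := by
    rw [hs, norm_mul, Complex.norm_real, Real.norm_of_nonneg ht.1]
    exact mul_le_of_le_one_left (norm_nonneg _) ht.2
  have hsη : ‖s‖ < η := hsn.trans_lt (hD.norm_div_sub_one_lt x hxb hx0)
  have hss : ‖s‖ ≤ s₀ := by
    -- With p = p' = 1 the ratio estimate says that η-small perturbations are s₀-small.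
    have := hD.norm_ratio_le s 1 1 hsη (by simpa using hD.η_pos) (by simpa using hD.η_pos)
    simpa using this
  have hΔ : ‖approxCoord k a (x * (1 + s)) - approxCoord k a x‖ ≤ D₀ := by
    rw [norm_approxCoord_mul_one_add_sub]
    have h1 := hD.le_norm s hss
    have h2 := hsn.trans (hD.norm_div_sub_one_le x hxb hx0)
    have h3 := norm_pow_mul_norm_approxCoord hD.k_pos hD.a_ne_zero hx0
    calc _ ≤ ‖approxCoord k a x‖ * (2 * k * (Q * ‖x‖ ^ k)) := by
          gcongr
          exact h1.trans (by gcongr)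
      _ = 2 * k * Q * (‖x‖ ^ k * ‖approxCoord k a x‖) := by ring
      _ = D₀ := by rw [h3]
  change x + t • (f x - x) ∈ _
  rw [hys]
  have hiter := hD.exists_iterate_eq hr hD₀0 hS hrη hx hss hΔ
  have hstable : x * (1 + s) ∈ puncturedStableSet f r₀ := by
    intro n
    obtain ⟨s', he, hs', -⟩ := hiter n
    have h1s := one_add_ne_zero_of_norm_le (hs'.trans hD.s_le)
    rw [he]
    refine ⟨?_, mul_ne_zero (hx n).2 h1s⟩
    have hXr : ‖f^[n] x‖ < r := mem_ball_zero_iff.1 (hx n).1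
    have hr0 : 0 ≤ r := (norm_nonneg _).trans hXr.le
    rw [mem_ball_zero_iff, norm_mul]
    have h2 : ‖1 + s'‖ ≤ 3 / 2 := by
      refine (norm_add_le _ _).trans ?_
      rw [norm_one]
      linarith [hs'.trans hD.s_le]
    calc ‖f^[n] x‖ * ‖1 + s'‖ ≤ r * (3 / 2) := by gcongr
      _ < r₀ := by linarith
  refine ⟨hstable, ?_, ?_⟩
  -- At a time when Re w along the orbit of x exceeds `coordBound` by more than the total drift D,
  -- the neighbouring orbit has Re w above `coordBound` too, and `AdaptedDisc.mul_mem_petal` places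
  -- it in the same petal.
  · set D := D₀ * Real.exp (2 * (k * ‖a‖) * K * S) with hDdef
    have h1 := (hD.tendsto_re hx₀).eventually_gt_atTop (coordBound k a r₀ + D)
    obtain ⟨n, hn, hnN⟩ := (h1.and (eventually_ge_atTop N)).exists
    refine ⟨n, ?_⟩
    obtain ⟨s', he, hs', hΔ'⟩ := hiter n
    rw [he]
    have hpx := hD.iterate_mem_petal hv hN hnN
    refine hD.mul_mem_petal hv (hx n).2 hpx.2.1
      (one_add_ne_zero_of_norm_le (hs'.trans hD.s_le)) (hD.abs_arg_one_add_lt s' hs') ?_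
    have h2 : ‖approxCoord k a (f^[n] x * (1 + s')) - approxCoord k a (f^[n] x)‖ ≤ D := by
      refine hΔ'.trans ?_
      have := hD.K_nonneg
      rw [hDdef]
      gcongr
      exact hS x hx₀ n
    have h3 := (abs_le.1 ((Complex.abs_re_le_norm _).trans h2)).1
    rw [Complex.sub_re] at h3
    linarith
  · have h3 := (abs_le.1 ((Complex.abs_re_le_norm _).trans hΔ)).1
    rw [Complex.sub_re] at h3
    linarith

/-- From time N on the orbit is in the connected petal. Earlier points are reached by walking
backwards along the segments joining consecutive iterates; the condition on L persists along the
orbit because Re w increases. -/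
theorem ControlledDisc.iterate_mem_component (hD : ControlledDisc f k a r₀ s₀ η K Q)
    (hr : r ≤ r₀ / 2) {S : ℝ}
    (hS : ∀ x ∈ puncturedStableSet f r₀, ∀ n : ℕ,
      ∑ j ∈ Finset.range n, ‖f^[j] x‖ ^ (k + 1) ≤ S)
    (hrη : 2 * (k * ‖a‖) * r ^ k
      * ((2 * k * Q * (k * ‖a‖)⁻¹) * Real.exp (2 * (k * ‖a‖) * K * S)) < η)
    (hv : IsAttractingDirection k a v) {x : ℂ} (hx : x ∈ puncturedStableSet f r) {N : ℕ}
    (hN : f^[N] x ∈ petal k a v r₀) {L : ℝ} (hL0 : 0 ≤ L)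
    (hL : -L + 2 * k * Q * (k * ‖a‖)⁻¹ < (approxCoord k a x).re) (m : ℕ) :
    f^[m] x ∈ connectedComponentIn (basin f k a v r₀ L) (f^[N] x) := by
  have hr₀ := hD.r_pos
  have hx₀ : x ∈ puncturedStableSet f r₀ := fun n =>
    ⟨Metric.ball_subset_ball (by linarith) (hx n).1, (hx n).2⟩
  have hlarge : ∀ m, N ≤ m → f^[m] x ∈ connectedComponentIn (basin f k a v r₀ L) (f^[N] x) :=
    fun m hm => (hD.isPreconnected_petal hv).subset_connectedComponentIn hN
      (hD.petal_subset_basin hv hL0) (hD.iterate_mem_petal hv hN hm)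
  have hsmall : ∀ j, f^[N - j] x ∈ connectedComponentIn (basin f k a v r₀ L) (f^[N] x) := by
    intro j
    induction j with
    | zero => exact hlarge N le_rfl
    | succ j ih =>
      rcases Nat.lt_or_ge j N with hj | hj
      · have h1 : N - j = N - (j + 1) + 1 := by omega
        set i := N - (j + 1) with hi
        rw [h1, Function.iterate_succ_apply'] at ih
        have hxi : f^[i] x ∈ puncturedStableSet f r := iterate_mem_puncturedStableSet hx i
        have hNi : f^[N] (f^[i] x) ∈ petal k a v r₀ := by
          rw [← Function.iterate_add_apply]
          exact hD.iterate_mem_petal hv hN (Nat.le_add_right N i)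
        have hLi : -L + 2 * k * Q * (k * ‖a‖)⁻¹ < (approxCoord k a (f^[i] x)).re := by
          have := hD.re_iterate hx₀ i
          have h2 : (0 : ℝ) ≤ 3 / 4 * i := by positivity
          linarith
        have hseg := hD.segment_subset_basin hr hS hrη hv hxi hNi hLi
        rw [connectedComponentIn_eq ih]
        exact (convex_segment (f^[i] x) (f (f^[i] x))).isPreconnected.subset_connectedComponentIn
          (right_mem_segment ℝ _ _) hseg (left_mem_segment ℝ _ _)
      · have h1 : N - (j + 1) = N - j := by omega
        rw [h1]
        exact ih
  rcases le_total N m with h | h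
  · exact hlarge m h
  · have := hsmall (N - m)
    rwa [Nat.sub_sub_self h] at this

end Neighbour

/-! ### Existence of controlled discs -/

section Existence

variable {f : ℂ → ℂ} {k : ℕ} {a : ℂ}

theorem eventually_abs_arg_lt {u : ℂ → ℂ} {x₀ : ℂ} (hu : ContinuousAt u x₀) (h1 : u x₀ = 1) {δ : ℝ}
    (hδ : 0 < δ) : ∀ᶠ x in 𝓝 x₀, |Complex.arg (u x)| < δ := by
  have h2 : ContinuousAt (fun x => |Complex.arg (u x)|) x₀ := by
    refine (ContinuousAt.comp (g := Complex.arg) ?_ hu).abs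
    rw [h1]
    exact Complex.continuousAt_arg Complex.one_mem_slitPlane
  exact h2.eventually_lt_const (by simpa [h1] using hδ)

theorem hasDerivAt_one_add_pow_inv (k : ℕ) :
    HasDerivAt (fun s : ℂ => ((1 + s) ^ k)⁻¹) (-(k : ℂ)) 0 := by
  have h1 : HasDerivAt (fun s : ℂ => (1 + s) ^ k) ((k : ℂ) * (1 + 0) ^ (k - 1) * 1) 0 :=
    ((hasDerivAt_id (0 : ℂ)).const_add 1).pow k
  have h2 := h1.fun_inv (by simp)
  simpa using h2

/-- The derivative of (1 + s)^(-k) at 0 is -k. With a relative error of one half, the increment lies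
between (k/2)‖s‖ and (3k/2)‖s‖, and k ≥ 1 gives the stated constants. -/
theorem exists_perturbation_radius (hk : 0 < k) : ∃ s₀ : ℝ, 0 < s₀ ∧ s₀ ≤ 1 / 2 ∧
    ∀ s : ℂ, ‖s‖ ≤ s₀ → |Complex.arg (1 + s)| < Real.pi / (2 * k) ∧
      ‖s‖ ≤ 2 * ‖((1 + s) ^ k)⁻¹ - 1‖ ∧ ‖((1 + s) ^ k)⁻¹ - 1‖ ≤ 2 * k * ‖s‖ := by
  have hk0 : (0 : ℝ) < k := by exact_mod_cast hk
  have hk1 : (1 : ℝ) ≤ k := by exact_mod_cast hk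
  have h1 : ∀ᶠ s : ℂ in 𝓝 0, |Complex.arg (1 + s)| < Real.pi / (2 * k) :=
    eventually_abs_arg_lt (by fun_prop) (by simp) (by positivity)
  have h2 := (hasDerivAt_one_add_pow_inv k).isLittleO.def (half_pos hk0)
  obtain ⟨ε, hε, h⟩ := Metric.eventually_nhds_iff_ball.1 (h1.and h2)
  refine ⟨min (ε / 2) (1 / 2), by positivity, min_le_right _ _, fun s hs => ?_⟩
  obtain ⟨h3, h4⟩ := h s (mem_ball_zero_iff.2 (by linarith [hs.trans (min_le_left _ _)]))
  simp only [add_zero, one_pow, inv_one, sub_zero, smul_eq_mul, mul_neg, sub_neg_eq_add] at h4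
  set d := ((1 + s) ^ k)⁻¹ - 1
  have h5 : ‖s * (k : ℂ)‖ = k * ‖s‖ := by rw [norm_mul, Complex.norm_natCast, mul_comm]
  have h6 : ‖s * (k : ℂ)‖ - ‖d‖ ≤ ‖d + s * k‖ := by
    have := norm_sub_le (d + s * k) d
    rw [add_sub_cancel_left] at this
    linarith
  have h7 : ‖d‖ - ‖s * (k : ℂ)‖ ≤ ‖d + s * k‖ := by
    have := norm_sub_le (d + s * k) (s * k)
    rw [add_sub_cancel_right] at this
    linarith
  have h8 : ‖s‖ ≤ k * ‖s‖ := le_mul_of_one_le_left (norm_nonneg _) hk1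
  refine ⟨h3, ?_, ?_⟩ <;> nlinarith

theorem exists_ratio_radius {s₀ : ℝ} (hs₀ : 0 < s₀) : ∃ η : ℝ, 0 < η ∧ ∀ s p p' : ℂ,
    ‖s‖ < η → ‖p - 1‖ < η → ‖p' - 1‖ < η → ‖(1 + s) * p / p' - 1‖ ≤ s₀ := by
  have h1 : ContinuousAt (fun t : ℂ × ℂ × ℂ => (1 + t.1) * t.2.1 / t.2.2 - 1) (0, 1, 1) := by
    fun_prop (disch := simp)
  obtain ⟨η, hη, h⟩ := Metric.continuousAt_iff.1 h1 s₀ hs₀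
  refine ⟨η, hη, fun s p p' hs hp hp' => ?_⟩
  have := @h (s, p, p') (by
    rw [Prod.dist_eq, Prod.dist_eq, dist_eq_norm, dist_eq_norm, dist_eq_norm, sub_zero]
    exact max_lt hs (max_lt hp hp'))
  simpa [dist_eq_norm] using this.le

/-- The displacement `w(f x) - w(x)` in the coordinate `w = -1 / (k a x^k)`,
for `f x = x (1 + x^k q x)`. -/
def displacement (k : ℕ) (a : ℂ) (q : ℂ → ℂ) (x : ℂ) : ℂ :=
  ((k : ℂ) * a)⁻¹ * (q x * (∑ j ∈ Finset.range k, (1 + x ^ k * q x) ^ j)) / (1 + x ^ k * q x) ^ k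

theorem displacement_zero (hk : 0 < k) (ha : a ≠ 0) {q : ℂ → ℂ} (hq : q 0 = a) :
    displacement k a q 0 = 1 := by
  have : (k : ℂ) ≠ 0 := by exact_mod_cast hk.ne'
  simp [displacement, hq, hk.ne']
  field_simp

theorem analyticAt_displacement (hk : 0 < k) (a : ℂ) {q : ℂ → ℂ} (hq : AnalyticAt ℂ q 0) :
    AnalyticAt ℂ (displacement k a q) 0 := by
  have hu : AnalyticAt ℂ (fun x => 1 + x ^ k * q x) 0 := by fun_prop
  unfold displacement
  refine AnalyticAt.div ?_ (hu.pow k) (by simp [hk.ne'])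
  refine analyticAt_const.mul (hq.mul ?_)
  exact Finset.analyticAt_fun_sum _ fun j _ => hu.pow j

/-- The geometric sum extracts u - 1 = x^k q(x) from u^k - 1, and this cancels the pole x^(-k). The
displacement is thus analytic at 0, where it takes the value 1; both the step estimate and the
Lipschitz estimate of a controlled disc come from here. -/
theorem approxCoord_sub_eq_displacement (hk : 0 < k) (ha : a ≠ 0) {q : ℂ → ℂ} {x : ℂ} (hx : x ≠ 0)
    (hu : 1 + x ^ k * q x ≠ 0) :
    approxCoord k a (x * (1 + x ^ k * q x)) - approxCoord k a x = displacement k a q x := by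
  have h0 : (k : ℂ) ≠ 0 := by exact_mod_cast hk.ne'
  have h1 := mul_geom_sum (1 + x ^ k * q x) k
  rw [approxCoord_mul_one_add, displacement, approxCoord]
  set u := 1 + x ^ k * q x with hu'
  have h2 : u - 1 = x ^ k * q x := by rw [hu']; ring
  rw [h2] at h1
  field_simp
  linear_combination -h1

/-- The extra property P lets the bound on the Abel error hold on the same disc. -/
theorem IsParabolicGerm.exists_controlledDisc (hf : IsParabolicGerm f k a) {P : ℂ → Prop}
    (hP : ∀ᶠ x in 𝓝 0, P x) : ∃ r₀ s₀ η K Q : ℝ, ControlledDisc f k a r₀ s₀ η K Q ∧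
      ∀ x ∈ Metric.ball (0 : ℂ) r₀, P x := by
  have hk := hf.pos
  have ha := hf.ne_zero
  obtain ⟨q, hq, hqa, hfq⟩ := hf.exists_eq
  obtain ⟨s₀, hs₀, hs₀', hs⟩ := exists_perturbation_radius hk
  obtain ⟨η, hη, hηs⟩ := exists_ratio_radius hs₀
  have hg := analyticAt_displacement hk a hq
  obtain ⟨K, t, ht, hK⟩ := (hg.contDiffAt (n := 1)).exists_lipschitzOnWith
  have hqc := hq.continuousAt
  have hu : ContinuousAt (fun x => 1 + x ^ k * q x) 0 := by fun_prop
  have hu0 : 1 + (0 : ℂ) ^ k * q 0 = 1 := by simp [hk.ne']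
  have e1 : ∀ᶠ x in 𝓝 (0 : ℂ), 1 + x ^ k * q x ≠ 0 := hu.eventually_ne (by simp [hk.ne'])
  have e2 := eventually_abs_arg_lt hu hu0 (δ := Real.pi / (2 * k)) (by positivity)
  have e3 : ∀ᶠ x in 𝓝 (0 : ℂ), ‖1 + x ^ k * q x - 1‖ < η :=
    (hu.sub continuousAt_const).norm.eventually_lt_const (by simpa [hk.ne'] using hη)
  have e4 : ∀ᶠ x in 𝓝 (0 : ℂ), ‖q x‖ < ‖a‖ + 1 :=
    hqc.norm.eventually_lt_const (by simp [hqa])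
  have e5 : ∀ᶠ x in 𝓝 (0 : ℂ), ‖displacement k a q x - 1‖ < 1 / 4 :=
    (hg.continuousAt.sub continuousAt_const).norm.eventually_lt_const
      (by simp [displacement_zero hk ha hqa])
  have e6 := hf.analyticAt.eventually_analyticAt
  obtain ⟨r₀, hr₀, h⟩ := Metric.eventually_nhds_iff_ball.1
    (((hfq.and e1).and (e2.and e3)).and ((e4.and e5).and ((e6.and ht).and hP)))
  have hdiv : ∀ x ∈ Metric.ball (0 : ℂ) r₀, x ≠ 0 → f x / x = 1 + x ^ k * q x := by
    intro x hx hx0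
    rw [(h x hx).1.1.1]
    field_simp
  have hdisp : ∀ x ∈ Metric.ball (0 : ℂ) r₀, x ≠ 0 →
      approxCoord k a (f x) - approxCoord k a x = displacement k a q x := by
    intro x hx hx0
    rw [(h x hx).1.1.1, approxCoord_sub_eq_displacement hk ha hx0 (h x hx).1.1.2]
  refine ⟨r₀, s₀, η, K, ‖a‖ + 1,
    { k_pos := hk
      a_ne_zero := ha
      r_pos := hr₀
      differentiableAt := fun x hx => (h x hx).2.2.1.1.differentiableAt
      ne_zero := fun x hx hx0 => by
        rw [(h x hx).1.1.1]
        exact mul_ne_zero hx0 (h x hx).1.1.2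
      abs_arg_lt := fun x hx hx0 => by
        rw [hdiv x hx hx0]
        exact (h x hx).1.2.1
      step := fun x hx hx0 => by
        rw [hdisp x hx hx0]
        exact (h x hx).2.1.2.le
      s_le := hs₀'
      η_pos := hη
      K_nonneg := K.2
      Q_nonneg := by positivity
      abs_arg_one_add_lt := fun s hs' => (hs s hs').1
      norm_le := fun s hs' => (hs s hs').2.1
      le_norm := fun s hs' => (hs s hs').2.2
      norm_ratio_le := hηs
      norm_div_sub_one_lt := fun x hx hx0 => by
        rw [hdiv x hx hx0]
        exact (h x hx).1.2.2
      norm_div_sub_one_le := fun x hx hx0 => by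
        rw [hdiv x hx hx0, add_sub_cancel_left, norm_mul, norm_pow, mul_comm]
        gcongr
        exact (h x hx).2.1.1.le
      lipschitz := fun x hx hx0 y hy hy0 => by
        rw [hdisp x hx hx0, hdisp y hy hy0, ← dist_eq_norm, ← dist_eq_norm]
        exact hK.dist_le_mul y (h y hy).2.2.1.2 x (h x hx).2.2.1.2 },
    fun x hx => (h x hx).2.2.2⟩

theorem IsParabolicGerm.tendsto_displacement (hf : IsParabolicGerm f k a) :
    Tendsto (fun x => approxCoord k a (f x) - approxCoord k a x) (𝓝[≠] 0) (𝓝 1) := by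
  have hk := hf.pos
  have ha := hf.ne_zero
  obtain ⟨q, hq, hqa, hfq⟩ := hf.exists_eq
  have hqc := hq.continuousAt
  have hu : ContinuousAt (fun x => 1 + x ^ k * q x) 0 := by fun_prop
  have e1 : ∀ᶠ x in 𝓝 (0 : ℂ), 1 + x ^ k * q x ≠ 0 := hu.eventually_ne (by simp [hk.ne'])
  have hg := (analyticAt_displacement hk a hq).continuousAt.tendsto
  rw [displacement_zero hk ha hqa] at hg
  refine (hg.mono_left nhdsWithin_le_nhds).congr' ?_
  filter_upwards [hfq.filter_mono nhdsWithin_le_nhds, e1.filter_mono nhdsWithin_le_nhds,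
    self_mem_nhdsWithin] with x hx hx1 hx0
  rw [hx, approxCoord_sub_eq_displacement hk ha hx0 hx1]

/-- In the coordinate `w = -1 / (k a x^k)` the orbits that tend to the origin grow like `m`. -/
theorem IsParabolicGerm.tendsto_approxCoord_div (hf : IsParabolicGerm f k a) {x : ℂ}
    (h : Tendsto (fun m => f^[m] x) atTop (𝓝[≠] 0)) :
    Tendsto (fun m : ℕ => approxCoord k a (f^[m] x) / m) atTop (𝓝 1) := by
  refine tendsto_div_natCast_of_tendsto_sub ?_
  have := hf.tendsto_displacement.comp h
  refine this.congr fun m => ?_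
  simp only [Function.comp_apply, ← Function.iterate_succ_apply' f]

/-- The left-hand side carries the factor r^k and tends to 0 with r. There is no circularity,
because S can be determined on the disc of radius r₀ before r is chosen. -/
theorem ControlledDisc.exists_radius {r₀ s₀ η K Q : ℝ} (hD : ControlledDisc f k a r₀ s₀ η K Q)
    (S : ℝ) : ∃ R : ℝ, 0 < R ∧ R ≤ r₀ / 2 ∧ ∀ r : ℝ, 0 < r → r ≤ R →
      2 * (k * ‖a‖) * r ^ k
        * ((2 * k * Q * (k * ‖a‖)⁻¹) * Real.exp (2 * (k * ‖a‖) * K * S)) < η := by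
  have h1 : ContinuousAt (fun r : ℝ => 2 * (k * ‖a‖) * r ^ k
        * ((2 * k * Q * (k * ‖a‖)⁻¹) * Real.exp (2 * (k * ‖a‖) * K * S))) 0 := by fun_prop
  have h2 := h1.eventually_lt_const (u := η) (by simpa [hD.k_pos.ne'] using hD.η_pos)
  obtain ⟨ε, hε, h⟩ := Metric.eventually_nhds_iff_ball.1 h2
  have := hD.r_pos
  refine ⟨min (ε / 2) (r₀ / 2), by positivity, min_le_right _ _, fun r hr hrR => h r ?_⟩
  rw [mem_ball_zero_iff, Real.norm_of_nonneg hr.le]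
  linarith [hrR.trans (min_le_left _ _)]

end Existence

/-! ### Existence of the sectorial Fatou coordinate of an orbit -/

section Existence

variable {f : ℂ → ℂ} {k : ℕ} {a v : ℂ} {r L : ℝ}

/-- The connected petal lies in a single component of the basin. The image of that component under f
is connected, lies in the basin and contains the point f p of the petal, so it stays in the
component. The sector and the limiting direction come from the petal. -/
theorem AdaptedDisc.isAttractingDomain (hf : IsParabolicGerm f k a) (hD : AdaptedDisc f k a r)
    (hv : IsAttractingDirection k a v) (hL : 0 ≤ L) {p : ℂ} (hp : p ∈ petal k a v r) :
    IsAttractingDomain f k a v (connectedComponentIn (basin f k a v r L) p) := by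
  have hpb := hD.petal_subset_basin hv hL
  have hsub := connectedComponentIn_subset (basin f k a v r L) p
  have hpet : petal k a v r ⊆ connectedComponentIn (basin f k a v r L) p :=
    (hD.isPreconnected_petal hv).subset_connectedComponentIn hp hpb
  have hdiff : DifferentiableOn ℂ f (connectedComponentIn (basin f k a v r L) p) := fun x hx =>
    (hD.differentiableAt x ((hsub hx).1 0).1).differentiableWithinAt
  refine
    { norm_eq_one := hv.norm_eq_one
      attracting := hv.attracting
      isOpen := (hD.isOpen_basin hv).connectedComponentIn
      isConnected := isConnected_connectedComponentIn_iff.2 (hpb hp)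
      zero_notMem := fun h => ((hsub h).1 0).2 rfl
      differentiableOn := hdiff
      mapsTo := ?_
      sector_subset := ?_
      tendsto_zero := fun x hx => hD.tendsto_iterate (hsub hx).1
      tendsto_direction := fun x hx => ?_ }
  · intro x hx
    have hfp := hpet (hD.mapsTo_petal hv hp)
    rw [connectedComponentIn_eq hfp]
    refine (isPreconnected_connectedComponentIn.image f
      hdiff.continuousOn).subset_connectedComponentIn
      (Set.mem_image_of_mem f (mem_connectedComponentIn (hpb hp))) ?_ (Set.mem_image_of_mem f hx)
    rintro _ ⟨y, hy, rfl⟩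
    exact hD.mapsTo_basin hv (hsub hy)
  · obtain ⟨ε, hε, δ, hδ, h⟩ := hD.exists_sector_subset_petal hv
    exact ⟨ε, hε, δ, hδ, h.trans hpet⟩
  · obtain ⟨hxs, ⟨n, hn⟩, -⟩ := hsub hx
    refine tendsto_direction_of_eventually_abs_arg_lt hv hD.k_pos hD.a_ne_zero
      (Eventually.of_forall fun m => (hxs m).2) ?_ (hf.tendsto_approxCoord_div ?_)
    · filter_upwards [eventually_ge_atTop n] with m hm
      exact (hD.iterate_mem_petal hv hn hm).2.1
    · exact tendsto_nhdsWithin_iff.2 ⟨hD.tendsto_iterate hxs,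
        Eventually.of_forall fun m => (hxs m).2⟩

theorem truncation_add_C_mul_X_pow (k : ℕ) (ρ : ℂ) (h : PowerSeries ℂ) (c : ℂ) (ℓ : ℂ → ℂ) (n : ℕ)
    (x : ℂ) : truncation k ρ (h + PowerSeries.C c * PowerSeries.X ^ k) ℓ n x
      = truncation k ρ h ℓ n x + if k < n then c else 0 := by
  rw [truncation, truncation]
  simp only [map_add, PowerSeries.coeff_C_mul, PowerSeries.coeff_X_pow, add_mul,
    Finset.sum_add_distrib, mul_ite, mul_one, mul_zero, ite_mul, zero_mul, Finset.sum_ite_eq',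
    Finset.mem_range, sub_self, zpow_zero]
  ring

theorem IsParabolicGerm.exists_isOrbitFatou (hf : IsParabolicGerm f k a) :
    ∃ R : ℝ, 0 < R ∧ ∀ r : ℝ, 0 < r → r ≤ R → ∀ x₀ ∈ stableSet f r, x₀ ≠ 0 →
      ∃ (v : ℂ) (W : Set ℂ) (ℓ ψ : ℂ → ℂ) (h : PowerSeries ℂ), IsOrbitFatou f k a x₀ v W ℓ ψ h := by
  obtain ⟨h, hh⟩ := hf.exists_isFormalFatou
  set ρ := residualInvariant f k
  have hE' := hh.abelError_isBigO hf
  obtain ⟨M, hM, hB⟩ := (hE' k).exists_nonneg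
  obtain ⟨r₀, s₀, η, K, Q, hD, hE⟩ :=
    hf.exists_controlledDisc (eventually_nhdsWithin_iff.1 hB.bound)
  have hE : ∀ x ∈ Metric.ball (0 : ℂ) r₀, x ≠ 0 →
      ‖abelError f k ρ h (k + k) x‖ ≤ M * ‖x‖ ^ (k + k) := fun x hx hx0 => by
    simpa only [norm_pow] using hE x hx hx0
  obtain ⟨S, -, hS⟩ := hD.exists_sum_bound
  obtain ⟨R, hR, hRr, hRη⟩ := hD.exists_radius S
  refine ⟨R, hR, fun r hr hrR x₀ hx₀ hx0 => ?_⟩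
  have hr₀ := hD.r_pos
  have hss : r ≤ r₀ / 2 := hrR.trans hRr
  have hball : Metric.ball (0 : ℂ) r ⊆ Metric.ball 0 r₀ := Metric.ball_subset_ball (by linarith)
  have hxs₀ := hD.mem_puncturedStableSet (fun n => hball (hx₀ n)) hx0
  have hxs : x₀ ∈ puncturedStableSet f r := fun n => ⟨hx₀ n, (hxs₀ n).2⟩
  obtain ⟨N, hN⟩ := ((hD.tendsto_re hxs₀).eventually_gt_atTop (coordBound k a r₀)).exists
  obtain ⟨v, hv, hNp⟩ := hD.exists_mem_petal (hxs N).2 hN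
  set D := 2 * k * Q * (k * ‖a‖)⁻¹ with hDdef
  have hD0 : 0 ≤ D := by
    have := hD.Q_nonneg
    positivity
  -- Of the constants that delimit the basin only L depends on x₀, so R stays uniform. The margin D
  -- leaves room for the segments between consecutive iterates.
  set L := |(approxCoord k a x₀).re| + D + 1 with hLdef
  have hL0 : 0 ≤ L := by positivity
  have hL : -L + D < (approxCoord k a x₀).re := by
    have := neg_abs_le (approxCoord k a x₀).re
    linarith
  have hmem := hD.iterate_mem_component hss hS (hRη r hr hrR) hv hxs hNp hL0 hL
  have hsub := connectedComponentIn_subset (basin f k a v r₀ L) (f^[N] x₀)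
  set W := connectedComponentIn (basin f k a v r₀ L) (f^[N] x₀)
  -- The constant normalising ψ at x₀ enters the formal coordinate as a multiple of X^k, the
  -- constant term of x^(-k) h, which does not affect the Abel equation.
  set c := -basinFatou f k v ρ h x₀ with hc
  have hψ := hD.basinFatou_differentiableOn (h := h) (ρ := ρ) hv hL0 hM hE
  refine ⟨v, W, basinLog f v, fun x => basinFatou f k v ρ h x + c,
    h + PowerSeries.C c * PowerSeries.X ^ k,
    { domain := hD.isAttractingDomain hf hv hL0 hNp
      orbit_mem := hmem
      log_branch := ⟨fun x hx =>
        (hD.basinLog_differentiableAt hv (hsub hx)).continuousAt.continuousWithinAt,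
        fun x hx => hD.exp_basinLog hv (hsub hx)⟩
      formal := hh.add_C_mul_X_pow hf c
      sectorial :=
        { differentiableOn := (hψ.mono hsub).add_const c
          abel := fun x hx => by rw [hD.basinFatou_apply hv hL0 hM hE (hsub hx)]; ring
          bounded := ?_ }
      normalized := by rw [hc]; ring
      asymptotic := fun n => ?_ }⟩
  · obtain ⟨B, hB⟩ := hD.basinFatou_bounded (h := h) (ρ := ρ) (v := v) hL0 hM hE
    refine ⟨B + ‖c‖, fun x hx => ?_⟩
    rw [truncation_add_C_mul_X_pow, if_neg (lt_irrefl k), add_zero, add_sub_right_comm]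
    exact (norm_add_le _ _).trans (add_le_add_left (hB x (hsub hx)) _)
  · have h1 := (hD.basinFatou_isBigO hv hL0 hM hE hE' n).mono (nhdsWithin_mono 0 hsub)
    simp only [truncation_add_C_mul_X_pow]
    -- At order 0 the truncation stops before the constant term, so c appears only in the bounded
    -- error.
    rcases Nat.eq_zero_or_pos n with rfl | hn
    · simp only [add_zero, lt_irrefl, if_false, pow_zero] at h1 ⊢
      refine (h1.add (isBigO_const_const c one_ne_zero _)).congr_left fun x => ?_
      ring
    · refine h1.congr_left fun x => ?_
      rw [if_pos (by omega)]
      ring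

end Existence

/-! ### The asymptotic expansion of an orbit -/

section Expansion

variable {f : ℂ → ℂ} {k : ℕ} {a v x₀ : ℂ} {W : Set ℂ} {ℓ ψ : ℂ → ℂ} {h : PowerSeries ℂ}

/-- A branch of the logarithm on a domain that contains a sector agrees with a translate of the
principal branch in a narrower sector. -/
theorem IsLogBranch.exists_eq_add_log_div (hℓ : IsLogBranch W ℓ) (hv : ‖v‖ = 1) {ε δ : ℝ}
    (hW : sector v ε δ ⊆ W) : ∃ c, Complex.exp c = v ∧
      ∀ x ∈ sector v ε (min δ 1), ℓ x = c + Complex.log (x / v) := by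
  have hv0 : v ≠ 0 := by
    rintro rfl
    simp at hv
  -- In the coordinate ζ = log(x/v) the sector becomes a convex set; the cut at 1 < π keeps the
  -- principal logarithm inverse to exp. On it ℓ(v e^ζ) - ζ is continuous with constant exponential,
  -- hence constant, since exp is a covering map.
  set T : Set ℂ := {ζ | Real.exp ζ.re < ε} ∩ {ζ | |ζ.im| < min δ 1} with hT
  have hmaps : ∀ ζ ∈ T, v * Complex.exp ζ ∈ W := by
    rintro ζ ⟨h1, h2⟩
    have h2 : |ζ.im| < min δ 1 := h2
    have h3 := abs_lt.1 (h2.trans_le (min_le_right _ _))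
    have hpi := Real.pi_gt_three
    have hn : ‖v * Complex.exp ζ‖ = Real.exp ζ.re := by
      rw [norm_mul, hv, one_mul, Complex.norm_exp]
    refine hW ⟨by rw [hn]; positivity, by rwa [hn], ?_⟩
    rw [mul_div_cancel_left₀ _ hv0, ← Complex.log_im,
      Complex.log_exp (by linarith) (by linarith)]
    exact h2.trans_le (min_le_left _ _)
  have hlog : ∀ x ∈ sector v ε (min δ 1), Complex.log (x / v) ∈ T ∧
      v * Complex.exp (Complex.log (x / v)) = x := by
    rintro x ⟨h1, h2, h3⟩
    have hx0 : x / v ≠ 0 := div_ne_zero (norm_pos_iff.1 h1) hv0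
    refine ⟨⟨?_, ?_⟩, ?_⟩
    · change Real.exp (Complex.log (x / v)).re < ε
      rw [Complex.log_re, Real.exp_log (norm_pos_iff.2 hx0), norm_div, hv, div_one]
      exact h2
    · change |(Complex.log (x / v)).im| < _
      rwa [Complex.log_im]
    · rw [Complex.exp_log hx0, mul_div_cancel₀ _ hv0]
  have hconv : Convex ℝ T := by
    refine Convex.inter ?_ ?_
    · rcases le_or_gt ε 0 with hε | hε
      · convert convex_empty (𝕜 := ℝ) (E := ℂ) using 1
        ext ζ
        simpa using hε.trans (Real.exp_pos _).le
      · convert convex_halfSpace_re_lt (Real.log ε) using 1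
        ext ζ
        exact (Real.lt_log_iff_exp_lt hε).symm
    · have := (convex_halfSpace_im_gt (-min δ 1)).inter (convex_halfSpace_im_lt (min δ 1))
      convert this using 1
      ext ζ
      exact abs_lt (a := ζ.im)
  have hcont : ContinuousOn (fun ζ => ℓ (v * Complex.exp ζ) - ζ) T :=
    (hℓ.1.comp (by fun_prop) hmaps).sub continuousOn_id
  have hexp : ∀ ζ ∈ T, Complex.exp (ℓ (v * Complex.exp ζ) - ζ) = v := fun ζ hζ => by
    rw [Complex.exp_sub, hℓ.2 _ (hmaps ζ hζ), mul_div_cancel_right₀ _ (Complex.exp_ne_zero _)]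
  rcases T.eq_empty_or_nonempty with hTe | ⟨ζ₀, hζ₀⟩
  · refine ⟨Complex.log v, Complex.exp_log hv0, fun x hx => ?_⟩
    have := (hlog x hx).1
    rw [hTe] at this
    exact this.elim
  · refine ⟨ℓ (v * Complex.exp ζ₀) - ζ₀, hexp ζ₀ hζ₀, fun x hx => ?_⟩
    obtain ⟨h1, h2⟩ := hlog x hx
    have := Complex.isCoveringMap_exp.constOn_of_comp hconv.isPreconnected hcont
      (fun ζ hζ ζ' hζ' => Subtype.ext ((hexp ζ hζ).trans (hexp ζ' hζ').symm)) h1 hζ₀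
    simp only [h2] at this
    rw [← this]
    ring

theorem IsOrbitFatou.tendsto_punctured (H : IsOrbitFatou f k a x₀ v W ℓ ψ h) :
    Tendsto (fun m => f^[m] x₀) atTop (𝓝[≠] 0) :=
  tendsto_nhdsWithin_iff.2 ⟨H.domain.tendsto_zero x₀ (H.orbit_mem 0), Eventually.of_forall fun m =>
    ne_of_mem_of_not_mem (H.orbit_mem m) H.domain.zero_notMem⟩

theorem IsOrbitFatou.iterate_ne_zero (H : IsOrbitFatou f k a x₀ v W ℓ ψ h) (m : ℕ) :
    f^[m] x₀ ≠ 0 :=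
  ne_of_mem_of_not_mem (H.orbit_mem m) H.domain.zero_notMem

theorem IsOrbitFatou.tendsto_arg (H : IsOrbitFatou f k a x₀ v W ℓ ψ h) :
    Tendsto (fun m => Complex.arg (f^[m] x₀ / v)) atTop (𝓝 0) := by
  have hv0 : v ≠ 0 := by
    rintro rfl
    simpa using H.domain.norm_eq_one
  have h1 := (H.domain.tendsto_direction x₀ (H.orbit_mem 0)).div_const v
  rw [div_self hv0] at h1
  have h2 := (Complex.continuousAt_arg Complex.one_mem_slitPlane).tendsto.comp h1
  rw [Complex.arg_one] at h2
  refine h2.congr fun m => ?_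
  have h3 : f^[m] x₀ / (‖f^[m] x₀‖ : ℂ) / v = ((‖f^[m] x₀‖⁻¹ : ℝ) : ℂ) * (f^[m] x₀ / v) := by
    push_cast
    ring
  rw [Function.comp_apply, h3, Complex.arg_real_mul _
    (inv_pos.2 (norm_pos_iff.2 (H.iterate_ne_zero m)))]

/-- The norms of a sequence with `w ∼ m` satisfy `log |x| = -(1/k) log m + const + o(1)`. -/
theorem tendsto_log_norm_add (hk : 0 < k) (ha : a ≠ 0) {x : ℕ → ℂ} (hx : ∀ m, x m ≠ 0)
    (hw : Tendsto (fun m : ℕ => approxCoord k a (x m) / m) atTop (𝓝 1)) :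
    Tendsto (fun m : ℕ => Real.log ‖x m‖ + Real.log m / k) atTop
      (𝓝 (-(Real.log (k * ‖a‖) / k))) := by
  have hk' : (0 : ℝ) < k := by exact_mod_cast hk
  have ha' : 0 < ‖a‖ := norm_pos_iff.2 ha
  have h1 := hw.norm
  rw [norm_one] at h1
  have h2 := (Real.continuousAt_log one_ne_zero).tendsto.comp h1
  rw [Real.log_one] at h2
  have h3 := (h2.const_add (Real.log (k * ‖a‖))).div_const (k : ℝ) |>.neg
  rw [add_zero] at h3
  refine h3.congr' ?_
  filter_upwards [eventually_gt_atTop 0] with m hm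
  have hm' : (0 : ℝ) < m := by exact_mod_cast hm
  have hxm : 0 < ‖x m‖ := norm_pos_iff.2 (hx m)
  rw [Function.comp_apply, norm_div, norm_approxCoord, Complex.norm_natCast,
    Real.log_div (by positivity) hm'.ne', Real.log_inv,
    Real.log_mul (x := k * ‖a‖) (by positivity) (by positivity), Real.log_pow]
  field_simp
  ring

theorem IsOrbitFatou.tendsto_approxCoord_div (hf : IsParabolicGerm f k a)
    (H : IsOrbitFatou f k a x₀ v W ℓ ψ h) :
    Tendsto (fun m : ℕ => approxCoord k a (f^[m] x₀) / m) atTop (𝓝 1) :=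
  hf.tendsto_approxCoord_div H.tendsto_punctured

/-- Near the direction v, ℓ is c plus the principal logarithm of x/v, with e^c = v. Its real part is
controlled by w(x_m)/m → 1, and arg(x_m/v) → 0. The value of e^(-kμ) is v^(-k) k‖a‖, turned into -ak
by the attracting condition. -/
theorem IsOrbitFatou.exists_tendsto_log (hf : IsParabolicGerm f k a)
    (H : IsOrbitFatou f k a x₀ v W ℓ ψ h) : ∃ μ : ℂ,
      Tendsto (fun m : ℕ => ℓ (f^[m] x₀) + ((Real.log m / k : ℝ) : ℂ)) atTop (𝓝 μ) ∧
      Complex.exp (-(k : ℂ) * μ) = -a * k := by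
  have hk := hf.pos
  have hk' : (0 : ℝ) < k := by exact_mod_cast hk
  have ha' : 0 < ‖a‖ := norm_pos_iff.2 hf.ne_zero
  obtain ⟨ε, hε, δ, hδ, hS⟩ := H.domain.sector_subset
  obtain ⟨c, hc, hℓ⟩ := H.log_branch.exists_eq_add_log_div H.domain.norm_eq_one hS
  have harg := H.tendsto_arg
  have hnorm := tendsto_log_norm_add hk hf.ne_zero H.iterate_ne_zero (H.tendsto_approxCoord_div hf)
  have hmem : ∀ᶠ m in atTop, f^[m] x₀ ∈ sector v ε (min δ 1) := by
    have h1 := (tendsto_nhdsWithin_iff.1 H.tendsto_punctured).1.norm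
    rw [norm_zero] at h1
    have h2 := harg.abs
    rw [abs_zero] at h2
    filter_upwards [h1.eventually_lt_const hε, h2.eventually_lt_const (lt_min hδ one_pos)]
      with m hm1 hm2
    exact ⟨norm_pos_iff.2 (H.iterate_ne_zero m), hm1, hm2⟩
  refine ⟨c + ((-(Real.log (k * ‖a‖) / k) : ℝ) : ℂ), ?_, ?_⟩
  · have h1 := (((Complex.continuous_ofReal.tendsto _).comp hnorm).const_add c).add
      (((Complex.continuous_ofReal.tendsto _).comp harg).mul_const Complex.I)
    rw [Complex.ofReal_zero, zero_mul, add_zero] at h1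
    refine h1.congr' ?_
    filter_upwards [hmem] with m hm
    rw [hℓ _ hm, Complex.log, norm_div, H.domain.norm_eq_one, div_one]
    simp only [Function.comp_apply]
    push_cast
    ring
  · have h1 : -(k : ℂ) * (c + ((-(Real.log (k * ‖a‖) / k) : ℝ) : ℂ))
        = -(k * c) + ((Real.log (k * ‖a‖) : ℝ) : ℂ) := by
      have : (k : ℂ) ≠ 0 := by exact_mod_cast hk.ne'
      push_cast
      field_simp
      ring
    rw [h1, Complex.exp_add, Complex.exp_neg, Complex.exp_nat_mul, hc, ← Complex.ofReal_exp,
      Real.exp_log (by positivity)]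
    have hvk : v ^ k ≠ 0 := by
      intro h0
      have := H.domain.attracting
      rw [h0, mul_zero, eq_comm, neg_eq_zero] at this
      exact ha'.ne' (by exact_mod_cast this)
    push_cast
    field_simp
    linear_combination (k : ℂ) * H.domain.attracting

theorem IsOrbitFatou.apply_iterate (H : IsOrbitFatou f k a x₀ v W ℓ ψ h) (m : ℕ) :
    ψ (f^[m] x₀) = m := by
  induction m with
  | zero => simpa using H.normalized
  | succ m ih =>
    rw [Function.iterate_succ_apply', H.sectorial.abel _ (H.orbit_mem m), ih]
    push_cast
    ring

theorem IsOrbitFatou.truncation_isBigO (H : IsOrbitFatou f k a x₀ v W ℓ ψ h) (N : ℕ) :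
    (fun m : ℕ => truncation k (residualInvariant f k) h ℓ (k + N) (f^[m] x₀) - m)
      =O[atTop] fun m => (f^[m] x₀) ^ N := by
  have h1 : Tendsto (fun m => f^[m] x₀) atTop (𝓝[W] 0) := tendsto_nhdsWithin_iff.2
    ⟨H.domain.tendsto_zero x₀ (H.orbit_mem 0), Eventually.of_forall H.orbit_mem⟩
  refine ((H.asymptotic N).comp_tendsto h1).neg_left.congr_left fun m => ?_
  rw [Function.comp_apply, H.apply_iterate]
  ring

theorem IsOrbitFatou.tendsto_inv_pow_div (hf : IsParabolicGerm f k a)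
    (H : IsOrbitFatou f k a x₀ v W ℓ ψ h) :
    Tendsto (fun m : ℕ => ((f^[m] x₀) ^ k)⁻¹ / m) atTop (𝓝 (-(k * a))) := by
  have hka : (k : ℂ) * a ≠ 0 := mul_ne_zero (by exact_mod_cast hf.pos.ne') hf.ne_zero
  have h1 := (H.tendsto_approxCoord_div hf).const_mul (-(k * a))
  rw [mul_one] at h1
  refine h1.congr fun m => ?_
  rw [approxCoord, mul_inv, ← mul_div_assoc, neg_mul_neg, mul_inv_cancel_left₀ hka]

/-- Divide ψ(x_m) = m by m: among the terms of the truncation only h₀ x_m^(-k)/m survives, and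
x_m^(-k)/m → -ka. -/
theorem IsOrbitFatou.coeff_zero (hf : IsParabolicGerm f k a)
    (H : IsOrbitFatou f k a x₀ v W ℓ ψ h) : -a * k * PowerSeries.coeff 0 h = 1 := by
  have hk := hf.pos
  set ρ := residualInvariant f k
  obtain ⟨μ, hμ, -⟩ := H.exists_tendsto_log hf
  have hinv : Tendsto (fun m : ℕ => (m : ℂ)⁻¹) atTop (𝓝 0) := tendsto_inv_atTop_nhds_zero_nat
  have hlog : Tendsto (fun m : ℕ => ℓ (f^[m] x₀) / m) atTop (𝓝 0) := by
    have h1 := hμ.mul hinv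
    rw [mul_zero] at h1
    have h2 : Tendsto (fun m : ℕ => ((Real.log m / m : ℝ) : ℂ) / k) atTop (𝓝 0) := by
      have h3 : Tendsto (fun m : ℕ => Real.log m / m) atTop (𝓝 0) :=
        (Real.isLittleO_log_id_atTop.tendsto_div_nhds_zero).comp tendsto_natCast_atTop_atTop
      have h4 := ((Complex.continuous_ofReal.tendsto _).comp h3).div_const (k : ℂ)
      simpa using h4
    have h5 := h1.sub h2
    rw [sub_zero] at h5
    refine h5.congr fun m => ?_
    push_cast
    ring
  have hterm : ∀ i ∈ Finset.range k, Tendsto (fun m : ℕ => PowerSeries.coeff i h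
      * (f^[m] x₀) ^ ((i : ℤ) - (k : ℤ)) / m) atTop
      (𝓝 (if i = 0 then -(k * a) * PowerSeries.coeff 0 h else 0)) := by
    intro i _
    have h1 := (((tendsto_nhdsWithin_iff.1 H.tendsto_punctured).1.pow i).mul
      (H.tendsto_inv_pow_div hf)).const_mul (PowerSeries.coeff i h)
    have h2 : PowerSeries.coeff i h * (0 ^ i * -(k * a))
        = if i = 0 then -(k * a) * PowerSeries.coeff 0 h else 0 := by
      split_ifs with hi
      · subst hi
        ring
      · rw [zero_pow hi]
        ring
    rw [h2] at h1
    refine h1.congr fun m => ?_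
    rw [zpow_sub₀ (H.iterate_ne_zero m), zpow_natCast, zpow_natCast]
    ring
  have hsum := (tendsto_finsetSum _ hterm).add (hlog.const_mul ρ)
  rw [mul_zero, add_zero, Finset.sum_ite_eq', if_pos (Finset.mem_range.2 hk)] at hsum
  have hO := (H.truncation_isBigO 0).mul (isBigO_refl (fun m : ℕ => (m : ℂ)⁻¹) atTop)
  have hlim : Tendsto (fun m : ℕ => (truncation k ρ h ℓ (k + 0) (f^[m] x₀) - m) * (m : ℂ)⁻¹) atTop
      (𝓝 0) := by
    refine hO.trans_tendsto ?_
    simpa using hinv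
  have h1 : Tendsto (fun m : ℕ => truncation k ρ h ℓ k (f^[m] x₀) / m) atTop (𝓝 1) := by
    have := hlim.add_const 1
    rw [zero_add] at this
    refine this.congr' ?_
    filter_upwards [eventually_gt_atTop 0] with m hm
    have : (m : ℂ) ≠ 0 := by exact_mod_cast hm.ne'
    rw [add_zero]
    field_simp
    ring
  have h2 := tendsto_nhds_unique (hsum.congr fun m => ?_) h1
  · linear_combination h2
  · rw [truncation, add_div, Finset.sum_div, mul_div_assoc]

theorem IsOrbitFatou.exists_expansion (hf : IsParabolicGerm f k a)
    (H : IsOrbitFatou f k a x₀ v W ℓ ψ h) : ∃ μ : ℂ,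
      Tendsto (fun m : ℕ => ℓ (f^[m] x₀) + ((Real.log m / k : ℝ) : ℂ)) atTop (𝓝 μ) ∧
      Complex.exp (-(k : ℂ) * μ) = -a * k ∧
      ∃ Φ : MvPowerSeries (Fin 2) ℂ, IsFormalInverse k (residualInvariant f k) h μ Φ ∧
        (∀ Φ' : MvPowerSeries (Fin 2) ℂ, IsFormalInverse k (residualInvariant f k) h μ Φ' →
          Φ' = Φ) ∧
        HasPowerLogExpansion k (residualInvariant f k) (fun m => f^[m] x₀) Φ := by
  obtain ⟨μ, hμ, hexp⟩ := H.exists_tendsto_log hf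
  have h0 : Complex.exp (-(k : ℂ) * μ) * PowerSeries.coeff 0 h = 1 := by
    rw [hexp, H.coeff_zero hf]
  obtain ⟨Φ, hΦ⟩ := exists_isFormalInverse (ρ := residualInvariant f k) hf.pos h0
  exact ⟨μ, hμ, hexp, Φ, hΦ, fun Φ' hΦ' => hΦ.unique hf.pos h0 hΦ',
    hasPowerLogExpansion_of_hasExp hf.pos fun n => hΦ.hasExp_rescaled hf.pos
      (right_ne_zero_of_mul_eq_one h0) (fun m => H.log_branch.2 _ (H.orbit_mem m)) hμ
      H.truncation_isBigO n⟩

/-- The argument is bounded whichever way the orbit turns, so log x_m + (log m)/k is bounded;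
dividing by log m leaves -1/k. -/
theorem tendsto_neg_log_div_log (hk : 0 < k) (ha : a ≠ 0) {x : ℕ → ℂ} (hx : ∀ m, x m ≠ 0)
    (hw : Tendsto (fun m : ℕ => approxCoord k a (x m) / m) atTop (𝓝 1)) :
    Tendsto (fun m : ℕ => -((Real.log m : ℝ) : ℂ) / Complex.log (x m)) atTop (𝓝 (k : ℂ)) := by
  have hk' : (k : ℂ) ≠ 0 := by exact_mod_cast hk.ne'
  have hlog : Tendsto (fun m : ℕ => Real.log m) atTop atTop :=
    Real.tendsto_log_atTop.comp tendsto_natCast_atTop_atTop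
  have h1 : (fun m : ℕ => Complex.log (x m) + ((Real.log m / k : ℝ) : ℂ)) =O[atTop]
      fun _ => (1 : ℝ) := by
    have h2 := ((Complex.continuous_ofReal.tendsto _).comp
      (tendsto_log_norm_add hk ha hx hw)).isBigO_one ℝ
    have h3 : (fun m : ℕ => (Complex.arg (x m) : ℂ) * Complex.I) =O[atTop] fun _ => (1 : ℝ) := by
      refine IsBigO.of_bound Real.pi (Eventually.of_forall fun m => ?_)
      simpa using Complex.abs_arg_le_pi (x m)
    refine (h2.add h3).congr_left fun m => ?_
    rw [Complex.log, Function.comp_apply]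
    push_cast
    ring
  have h4 : Tendsto (fun m : ℕ => (Complex.log (x m) + ((Real.log m / k : ℝ) : ℂ))
      * ((Real.log m)⁻¹ : ℝ)) atTop (𝓝 0) := by
    have h5 := h1.mul (isBigO_refl (fun m : ℕ => (((Real.log m)⁻¹ : ℝ) : ℂ)) atTop).norm_right
    refine h5.trans_tendsto ?_
    have h6 := hlog.inv_tendsto_atTop.norm
    rw [norm_zero] at h6
    simpa only [one_mul, Complex.norm_real, Pi.inv_apply] using h6
  have h7 : Tendsto (fun m : ℕ => -(Complex.log (x m) / (Real.log m : ℝ))) atTop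
      (𝓝 (k : ℂ)⁻¹) := by
    have h8 := (h4.sub_const ((k : ℂ)⁻¹)).neg
    rw [zero_sub, neg_neg] at h8
    refine h8.congr' ?_
    filter_upwards [hlog.eventually_gt_atTop 0] with m hm
    have : ((Real.log m : ℝ) : ℂ) ≠ 0 := by exact_mod_cast hm.ne'
    rw [Complex.ofReal_inv, Complex.ofReal_div, Complex.ofReal_natCast]
    field_simp
    ring
  have h9 := h7.inv₀ (inv_ne_zero hk')
  rw [inv_inv] at h9
  refine h9.congr fun m => ?_
  rw [inv_neg, inv_div, neg_div]

end Expansion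

end ParabolicGerm

end

/-! ### Assembly of the main theorem -/

theorem mainTheorem9 (f : ℂ → ℂ) (k : ℕ) (a : ℂ) (hf : ParabolicGerm.IsParabolicGerm f k a) :
    ∃ R : ℝ, 0 < R ∧ ∀ r : ℝ, 0 < r → r ≤ R →
      ∀ x₀ ∈ ParabolicGerm.stableSet f r, x₀ ≠ 0 →
        (∃ (v : ℂ) (W : Set ℂ) (ℓ ψ : ℂ → ℂ) (h : PowerSeries ℂ),
          ParabolicGerm.IsOrbitFatou f k a x₀ v W ℓ ψ h) ∧
        (∀ (v : ℂ) (W : Set ℂ) (ℓ ψ : ℂ → ℂ) (h : PowerSeries ℂ),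
          ParabolicGerm.IsOrbitFatou f k a x₀ v W ℓ ψ h →
          ∃ μ : ℂ,
            Tendsto (fun m : ℕ => ℓ (f^[m] x₀) + ((Real.log m / k : ℝ) : ℂ)) atTop (𝓝 μ) ∧
            Complex.exp (-(k : ℂ) * μ) = -a * k ∧
            ∃ Φ : MvPowerSeries (Fin 2) ℂ,
              ParabolicGerm.IsFormalInverse k (ParabolicGerm.residualInvariant f k) h μ Φ ∧
              (∀ Φ' : MvPowerSeries (Fin 2) ℂ,
                ParabolicGerm.IsFormalInverse k (ParabolicGerm.residualInvariant f k) h μ Φ' →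
                Φ' = Φ) ∧
              ParabolicGerm.HasPowerLogExpansion k (ParabolicGerm.residualInvariant f k)
                (fun m => f^[m] x₀) Φ) ∧
        Tendsto (fun m : ℕ => -((Real.log m : ℝ) : ℂ) / Complex.log (f^[m] x₀)) atTop
          (𝓝 (k : ℂ)) ∧
        Tendsto (fun m : ℕ => -((f^[m] x₀) ^ k)⁻¹ / ((k : ℂ) * (m : ℂ))) atTop (𝓝 a) := by
  obtain ⟨R, hR, H⟩ := hf.exists_isOrbitFatou
  refine ⟨R, hR, fun r hr hrR x₀ hx₀ hx0 => ?_⟩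
  have hex := H r hr hrR x₀ hx₀ hx0
  refine ⟨hex, fun v W ℓ ψ h HO => HO.exists_expansion hf, ?_⟩
  obtain ⟨v, W, ℓ, ψ, h, HO⟩ := hex
  have hw := HO.tendsto_approxCoord_div hf
  refine ⟨ParabolicGerm.tendsto_neg_log_div_log hf.pos hf.ne_zero HO.iterate_ne_zero hw, ?_⟩
  -- Multiplying w(x_m)/m → 1 by a cancels the factor 1/a in w and gives the limit formula for a.
  have h1 := hw.const_mul a
  rw [mul_one] at h1
  refine h1.congr fun m => ?_
  have ha := hf.ne_zero
  have hk : (k : ℂ) ≠ 0 := by exact_mod_cast hf.pos.ne'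
  rw [ParabolicGerm.approxCoord, mul_inv, mul_inv]
  field_simp
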